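/- **Setting.** Let $n\ge 1$ and $s>0$. Let $h:\mathbb R^n\to[0,\infty)$ be a proper log-concave function (log-concave, upper semicontinuous, $0<\int h<\infty$), positive on a neighbourhood of the closed unit ball $B^n$. Write $A\oplus\alpha=\begin{pmatrix}A&0\\0&\alpha\end{pmatrix}$ for an $n\times n$ matrix $A$ and $\alpha\in\mathbb R$, $\overline{\mathrm{Id}}=\mathrm{Id}\oplus 1$, and $\mathcal E_+=\{(A\oplus\alpha,a): A \text{ symmetric positive definite},\ \alpha>0,\ a\in\mathbb R^n\}$. Let $\hslash(x)=\sqrt{1-|x|^2}$ on $B^n$ and $0$ elsewhere. Assume that $\hslash^s$ is the John $s$-function of $h$; that is, $B^{n+1}$ is the John $s$-ellipsoid of $h$: it is contained in ${}^{(s)}\bar h=\{(x,\xi)\in\mathbb R^n\times\mathbb R:|\xi|\le h(x)^{1/s}\}$ and has the largest $s$-volume ${}^{(s)}\mu(\bar C)=\int_{\mathbb R^n}\big[\tfrac12\,\mathrm{length}\{\xi:(x,\xi)\in\bar C\}\big]^s\,dx$ among all ellipsoids $(A\oplus\alpha)B^{n+1}+(a,0)$, $(A\oplus\alpha,a)\in\mathcal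 E_+$, contained in it. Let $\Lambda=\{x\in B^n:h(x)^{1/s}=\hslash(x)\}$. Let $f,g:\mathbb R\to\mathbb R$ be locally Lipschitz; let $f$ be convex, zero on $(-\infty,-1]$ and strictly increasing on $[-1,\infty)$; let $g$ be non-increasing, equal to $1$ on $(-\infty,-1]$, positive on $(-1,1)$ and zero on $[1,\infty)$. For $r<1$ and $\gamma:\mathbb R\to\mathbb R$ put $\gamma_r(u)=\gamma\big(\tfrac{u-1}{1-r}\big)$. Let $F(x)=\int_{\mathbb R}f(t)g(t-x)\,dt$, i.e. $F=f*\bar g$ with $\bar g(x)=g(-x)$. For $r\in(1/2,1)$ let $\bar L_r$, with values in $[0,\infty]$, be $$\bar L_r(A\oplus\alpha,v)=\frac1{1-r}\int_{\mathbb R^n}\int_0^\infty f_r\Big(\frac{\alpha y}{h(Ax+v)^{1/s}}\Big)\,g_r\Big(\frac{|x|^2+y^2-1}{2h(x)^{2/s}}+1\Big)\,dy\,dx,$$ and let $\mathcal U=\{(A\oplus\alpha,v)\in\mathcal E_+:\alpha^s\det A=1\}$. Let $$\bar I_1(M\oplus\beta,w)=\int_\Lambda h(x)^{1/s}F\Big(\frac{\langle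 x,Mx+w\rangle}{h(x)^{2/s}}+\beta\Big)\,dx .$$ At points where $h$ vanishes the quotients above are read as $+\infty$, with $f(+\infty)=+\infty$, $g(+\infty)=0$ and $\infty\cdot0=0$; the same convention for $g$ is used in the measures below, and their density is $0$ where $h(x)=0$. **Theorem.** Assume that $\bar I_1$, restricted to the triples $(M\oplus\beta,w)$ with $M$ symmetric, $\beta\in\mathbb R$, $w\in\mathbb R^n$ and $s\beta+\operatorname{tr}M=0$, has a unique global minimum $(M_0\oplus\beta_0,w_0)$. Then: 1. For every $r\in(1/2,1)$ the restriction of $\bar L_r$ to $\mathcal U$ has a global minimum. For any choice of global minima $(A_r\oplus\alpha_r,v_r)$, $r\in(1/2,1)$, extended by $(\overline{\mathrm{Id}},0)$ at $r=1$, the left derivative at $r=1$ is $$\left.\frac{\partial(A_r\oplus\alpha_r,v_r)}{\partial r}\right|_{r=1}=-(M_0\oplus\beta_0,w_0).$$ 2. The measure $$d\mu_0=\mathbf 1_\Lambda(x)\,\frac1{h(x)^{1/s}}F'\Big(\frac{\langle x,M_0x+w_0\rangle}{h(x)^{2/s}}+\beta_0\Big)\,dx$$ is finite, centered, i.e. $\int_{B^n}u\,d\mu_0=0$,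 and $s$-isotropic, i.e. $\int_{B^n}\big(u\otimes u\oplus(1-|u|^2)\big)d\mu_0=\lambda(\mathrm{Id}\oplus s)$ for some $\lambda\ne0$. 3. If $(\tilde A_r\oplus\tilde\alpha_r,\tilde v_r)$ is a curve which lies in $\mathcal E_+$ for $r<1$ close to $1$ and satisfies $$(\tilde A_r\oplus\tilde\alpha_r,\tilde v_r)=(\overline{\mathrm{Id}},0)+(1-r)(M_0\oplus\beta_0,w_0)+o(1-r)\qquad(r\to1^-),$$ then the measures on $\mathbb R^n$ with density $$\frac{\tilde\alpha_r^{\,s-1}}{1-r}\int_0^\infty (f')_r\Big(\frac{y}{h(x)^{1/s}}\Big)\,g_r\Big(\frac{|\tilde A_r^{-1}(x-\tilde v_r)|^2+(\tilde\alpha_r^{-1}y)^2-1}{2h(\tilde A_r^{-1}(x-\tilde v_r))^{2/s}}+1\Big)\frac{y}{h(x)^{3/s}}\,dy$$ are finite for $r$ close to $1$ and converge weakly to $\mu_0$ as $r\to1^-$. In particular, this holds for $(\tilde A_r\oplus\tilde\alpha_r,\tilde v_r)=(A_r\oplus\alpha_r,v_r)$ and for $(\tilde A_r\oplus\tilde\alpha_r,\tilde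 v_r)=(\overline{\mathrm{Id}}+(1-r)(M_0\oplus\beta_0),(1-r)w_0)$. -/

import Mathlib

open Set Filter Topology MeasureTheory
open scoped ENNReal

noncomputable section

namespace FunctionalJohn

/-- Euclidean space `ℝⁿ`. -/
abbrev Space (n : ℕ) := EuclideanSpace ℝ (Fin n)

/-- The pair `(A ⊕ α, a)` of a block diagonal matrix and a translation vector,
stored as the triple `(A, α, a)`. -/
abbrev Param (n : ℕ) := Matrix (Fin n) (Fin n) ℝ × ℝ × Space n

variable {n : ℕ}

/-- The block matrix `A ⊕ α`. -/
def oplus (A : Matrix (Fin n) (Fin n) ℝ) (α : ℝ) : Matrix (Fin n ⊕ Unit) (Fin n ⊕ Unit) ℝ :=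
  Matrix.fromBlocks A 0 0 (Matrix.of fun _ _ => α)

/-- The matrix `A` acting on the vector `x`. -/
def act (A : Matrix (Fin n) (Fin n) ℝ) (x : Space n) : Space n :=
  WithLp.toLp 2 (A.mulVec x.ofLp)

/-- The pair `(Id ⊕ 1, 0)`. -/
def idParam (n : ℕ) : Param n := (1, 1, 0)

/-- `𝓔₊`: the matrix `A` is symmetric positive definite and `α > 0`. -/
def EPos (n : ℕ) : Set (Param n) := {p | p.1.PosDef ∧ 0 < p.2.1}

/-- The `s`-determinant `α ^ s * det A`. -/
def sDet (s : ℝ) (p : Param n) : ℝ := p.2.1 ^ s * p.1.det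

/-- The `s`-trace `s * β + tr M`. -/
def sTrace (s : ℝ) (p : Param n) : ℝ := s * p.2.1 + p.1.trace

/-- The elements of `𝓔₊` of `s`-determinant one. -/
def EUnit (n : ℕ) (s : ℝ) : Set (Param n) := {p | p ∈ EPos n ∧ sDet s p = 1}

/-- The `s`-trace-zero subspace: `(M ⊕ β, w)` with `M` symmetric and `s * β + tr M = 0`. -/
def TraceZero (n : ℕ) (s : ℝ) : Set (Param n) := {p | p.1.IsSymm ∧ sTrace s p = 0}

/-- Proper log-concave functions: nonnegative, log-concave, upper semicontinuous, with finite
positive integral. -/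
structure ProperLogConcave (h : Space n → ℝ) : Prop where
  nonneg : ∀ x, 0 ≤ h x
  logConcave : ∀ x y : Space n, ∀ t : ℝ, 0 < t → t < 1 →
    h x ^ t * h y ^ (1 - t) ≤ h (t • x + (1 - t) • y)
  usc : UpperSemicontinuous h
  integrable : Integrable h
  integral_pos : 0 < ∫ x, h x

/-- The `s`-lifting of `h`, a subset of `ℝⁿ × ℝ`. -/
def lifting (h : Space n → ℝ) (s : ℝ) : Set (Space n × ℝ) := {z | |z.2| ≤ h z.1 ^ (1 / s)}

/-- The `n`-symmetric ellipsoid `(A ⊕ α) Bⁿ⁺¹ + a`. -/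
def ellipsoid (p : Param n) : Set (Space n × ℝ) :=
  {z | ∃ (x : Space n) (t : ℝ), ‖x‖ ^ 2 + t ^ 2 ≤ 1 ∧ z = (act p.1 x + p.2.2, p.2.1 * t)}

/-- The `s`-volume of a subset of `ℝⁿ × ℝ`: integrate the `s`-th power of half of the length of
the vertical sections. -/
def sVolume (s : ℝ) (C : Set (Space n × ℝ)) : ℝ≥0∞ :=
  ∫⁻ x : Space n, (volume {t : ℝ | (x, t) ∈ C} / 2) ^ s

/-- `(A ⊕ α) Bⁿ⁺¹ + a` is the John `s`-ellipsoid of `h`: it lies in the `s`-lifting of `h` and has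
the largest `s`-volume among the `n`-symmetric ellipsoids that do.  The John `s`-function of `h`
is the density of the `s`-marginal of this ellipsoid; for `p = idParam n` the ellipsoid is the
unit ball `Bⁿ⁺¹`, and the John `s`-function is the `s`-th power of its height function. -/
def IsJohnEllipsoid (h : Space n → ℝ) (s : ℝ) (p : Param n) : Prop :=
  p ∈ EPos n ∧ ellipsoid p ⊆ lifting h s ∧
    ∀ q ∈ EPos n, ellipsoid q ⊆ lifting h s → sVolume s (ellipsoid q) ≤ sVolume s (ellipsoid p)

/-- The height function of the unit ball `Bⁿ⁺¹`. -/
def ballHeight (x : Space n) : ℝ := if ‖x‖ ≤ 1 then √(1 - ‖x‖ ^ 2) else 0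

/-- The set `Λ` of the points of the unit ball where `h ^ (1 / s)` equals the height function. -/
def contactSet (h : Space n → ℝ) (s : ℝ) : Set (Space n) :=
  {x | x ∈ Metric.closedBall (0 : Space n) 1 ∧ h x ^ (1 / s) = ballHeight x}

/-- `f` is locally Lipschitz, convex, zero up to `-1` and strictly increasing from there on. -/
structure PropF (f : ℝ → ℝ) : Prop where
  locallyLipschitz : LocallyLipschitz f
  convex : ConvexOn ℝ univ f
  eq_zero : ∀ x ≤ -1, f x = 0
  strictMono : StrictMonoOn f (Ici (-1))

/-- `g` is locally Lipschitz, non-increasing, one up to `-1`, positive on `(-1, 1)` and zero from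
`1` on. -/
structure PropG (g : ℝ → ℝ) : Prop where
  locallyLipschitz : LocallyLipschitz g
  antitone : Antitone g
  eq_one : ∀ x ≤ -1, g x = 1
  pos : ∀ x ∈ Ioo (-1 : ℝ) 1, 0 < g x
  eq_zero : ∀ x, 1 ≤ x → g x = 0

/-- `γ_r (u) = γ ((u - 1) / (1 - r))`. -/
def rescale (γ : ℝ → ℝ) (r u : ℝ) : ℝ := γ ((u - 1) / (1 - r))

/-- `f_r (y / h(x) ^ (1 / s))` for `y > 0`, with value `f(+∞) = +∞` at the zeros of `h`. -/
def fFactor (f : ℝ → ℝ) (h : Space n → ℝ) (s r : ℝ) (x : Space n) (y : ℝ) : ℝ≥0∞ :=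
  if h x = 0 then ⊤ else ENNReal.ofReal (rescale f r (y / h x ^ (1 / s)))

/-- `g_r ((|x|² + y² - 1) / (2 h(x) ^ (2 / s)) + 1)`, with value `g(+∞) = 0` at the zeros of `h`
(when `h > 0` on the unit ball, `|x| > 1` at these points). -/
def gFactor (g : ℝ → ℝ) (h : Space n → ℝ) (s r : ℝ) (x : Space n) (y : ℝ) : ℝ :=
  if h x = 0 then 0
  else rescale g r ((‖x‖ ^ 2 + y ^ 2 - 1) / (2 * h x ^ (2 / s)) + 1)

/-- The functional `L̄_r`, with values in `[0, ∞]`. -/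
def Lbar (f g : ℝ → ℝ) (h : Space n → ℝ) (s r : ℝ) (p : Param n) : ℝ≥0∞ :=
  ENNReal.ofReal (1 / (1 - r)) *
    ∫⁻ x : Space n, ∫⁻ y in Ioi (0 : ℝ),
      fFactor f h s r (act p.1 x + p.2.2) (p.2.1 * y) * ENNReal.ofReal (gFactor g h s r x y)

/-- `p` is a global minimum of the restriction of `L̄_r` to the elements of `𝓔₊` of
`s`-determinant one. -/
def IsMinimizerLbar (f g : ℝ → ℝ) (h : Space n → ℝ) (s r : ℝ) (p : Param n) : Prop :=
  p ∈ EUnit n s ∧ IsMinOn (Lbar f g h s r) (EUnit n s) p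

/-- The convolution `F = f ⋆ ḡ`, where `ḡ(x) = g(-x)`. -/
def convF (f g : ℝ → ℝ) : ℝ → ℝ :=
  convolution f (fun x => g (-x)) (ContinuousLinearMap.mul ℝ ℝ) volume

/-- The argument `⟨x, M x + w⟩ / h(x) ^ (2 / s) + β`. -/
def slopeArg (h : Space n → ℝ) (s : ℝ) (p : Param n) (x : Space n) : ℝ :=
  inner ℝ x (act p.1 x + p.2.2) / h x ^ (2 / s) + p.2.1

/-- The functional `Ī₁`. -/
def Ione (f g : ℝ → ℝ) (h : Space n → ℝ) (s : ℝ) (p : Param n) : ℝ :=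
  ∫ x in contactSet h s, h x ^ (1 / s) * convF f g (slopeArg h s p x)

/-- `p` is the unique global minimum of the restriction of `Ī₁` to the `s`-trace-zero subspace. -/
def IsUniqueMinimizerIone (f g : ℝ → ℝ) (h : Space n → ℝ) (s : ℝ) (p : Param n) : Prop :=
  p ∈ TraceZero n s ∧ ∀ q ∈ TraceZero n s, q ≠ p → Ione f g h s p < Ione f g h s q

/-- The measure on `ℝⁿ` attached to `r` and `p = (A ⊕ α, v)`, with density
`α ^ (s - 1) / (1 - r) * ∫₀^∞ (f')_r (y / h(x) ^ (1 / s)) *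
  g_r ((|A⁻¹ (x - v)|² + (α⁻¹ y)² - 1) / (2 h (A⁻¹ (x - v)) ^ (2 / s)) + 1) *
  y / h(x) ^ (3 / s) dy`. -/
def muMeasure (f g : ℝ → ℝ) (h : Space n → ℝ) (s r : ℝ) (p : Param n) : Measure (Space n) :=
  volume.withDensity fun x =>
    ENNReal.ofReal (p.2.1 ^ (s - 1) / (1 - r)) *
      ∫⁻ y in Ioi (0 : ℝ), ENNReal.ofReal
        (rescale (deriv f) r (y / h x ^ (1 / s)) *
          gFactor g h s r (act p.1⁻¹ (x - p.2.2)) (p.2.1⁻¹ * y) *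
          (y / h x ^ (3 / s)))

/-- The measure `h(x) ^ (-1 / s) F' (⟨x, M x + w⟩ / h(x) ^ (2 / s) + β) dx` on `Λ`. -/
def limitMeasure (f g : ℝ → ℝ) (h : Space n → ℝ) (s : ℝ) (p : Param n) : Measure (Space n) :=
  (volume.restrict (contactSet h s)).withDensity fun x =>
    ENNReal.ofReal (1 / h x ^ (1 / s) * deriv (convF f g) (slopeArg h s p x))

/-- `∫ u ⊗ u ⊕ (1 - |u|²) dμ = l (Id ⊕ s)` over the unit ball, for some `l ≠ 0`. -/
def IsSIsotropic (s : ℝ) (μ : Measure (Space n)) : Prop :=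
  ∃ l : ℝ, l ≠ 0 ∧
    (Matrix.of fun i j => ∫ u in Metric.closedBall (0 : Space n) 1,
      oplus (Matrix.vecMulVec u.ofLp u.ofLp) (1 - ‖u‖ ^ 2) i j ∂μ) = l • oplus 1 s

/-- `∫ u dμ = 0` over the unit ball. -/
def IsCentered (μ : Measure (Space n)) : Prop :=
  ∫ u in Metric.closedBall (0 : Space n) 1, u ∂μ = 0

/-- Weak convergence of the measures `μ r` to the measure `ν` as `r → 1⁻`, tested on bounded
continuous functions; the measures are finite for `r` close to `1`, and `ν` is finite. -/
def ConvergesWeakly (μ : ℝ → Measure (Space n)) (ν : Measure (Space n)) : Prop :=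
  (∀ᶠ r in 𝓝[<] (1 : ℝ), IsFiniteMeasure (μ r)) ∧ IsFiniteMeasure ν ∧
    ∀ φ : BoundedContinuousFunction (Space n) ℝ,
      Tendsto (fun r => ∫ x, φ x ∂(μ r)) (𝓝[<] 1) (𝓝 (∫ x, φ x ∂ν))

/-- The curve `p` has the form `(Id ⊕ 1, 0) + (1 - r) m + o(1 - r)` as `r → 1⁻`. -/
def HasExpansion (p : ℝ → Param n) (m : Param n) : Prop :=
  Asymptotics.IsLittleOTVS ℝ (𝓝[<] (1 : ℝ))
    (fun r => p r - (idParam n + (1 - r) • m)) (fun r => 1 - r)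

end FunctionalJohn

end

open FunctionalJohn

namespace FunctionalJohn

variable {n : ℕ}

/-! Put `H = h ^ (1 / s)` and `ε = 1 - r`. The inclusion of the ball in the lifting says `H ^ 2 ≥ 1
- |x| ^ 2`, with equality exactly on the contact set Λ. After the substitution `y = H x (1 + ε t)`
the prefactor `1 / ε` cancels, and everything reduces to first order expansions in `ε`. Off Λ the
factor of `g` vanishes for small `ε`. At a contact point, log-concavity squeezes `H` between the
height function of the ball and a reflected upper barrier, so `H` is differentiable there with
gradient `-x / H x` (`IsProfile.hasFDerivAt`). Along `(Id ⊕ 1, 0) + ε m` the arguments of `f` and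
`g` therefore tend to `t + ⟨x, Mx + w⟩ / H ^ 2 + β` and `t`; integrating over `t` produces `F`, and
dominated convergence gives convergence of the functionals to `Ī₁` (`tendsto_profileL`). The same
expansion for the densities gives the weak convergence to μ₀ (`tendsto_profileDensity`).

Minimizers exist by the direct method: exponential decay of `H` makes the functional coercive
(`IsProfile.coercive`), upper semicontinuity of `H` and Fatou's lemma make it lower semicontinuous.

For the derivative, the difference quotients of the minimizers are not bounded a priori; convexity
replaces the bound. With the height parameter written as `α = exp (ε β)` the functional is convex
(`IsProfile.profileL_expCurve_convex`), so on the segment from a competitor whose quotient tends to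
`m₀` to the minimizer it stays below its value at the competitor. Any limit of points on such
segments then has `Ī₁` at most `Ī₁(m₀)`. These points leave the determinant-one surface, but `log
det A ≤ tr (A - 1)` keeps their `s`-trace nonnegative, and monotonicity of `F` extends the unique
minimality of `m₀` to that half-space (`IsStrictMinimizer.eq_of_le`). So the only such limit is
`m₀`, which forces convergence (`tendsto_of_segment`).

Centering and isotropy are the first order condition for `m₀` on the trace-zero subspace, rewritten
on Λ by `H ^ 2 = 1 - |x| ^ 2`. The constant λ is nonzero because uniqueness of `m₀` prevents `F'`
from vanishing almost everywhere on Λ (`IsStrictMinimizer.not_slope_le`). -/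

/-- A nonnegative log-concave upper semicontinuous function which decays exponentially, dominates
the height function of the unit ball, and is positive and log-Lipschitz on a ball of radius larger
than one. -/
structure IsProfile (H : Space n → ℝ) : Prop where
  nonneg : ∀ x, 0 ≤ H x
  logConcave : ∀ x y : Space n, ∀ t : ℝ, 0 < t → t < 1 →
    H x ^ t * H y ^ (1 - t) ≤ H (t • x + (1 - t) • y)
  usc : UpperSemicontinuous H
  le_sq : ∀ x, 1 - ‖x‖ ^ 2 ≤ H x ^ 2
  decay : ∃ K > 0, ∃ c > 0, ∀ x, H x ≤ K * Real.exp (-(c * ‖x‖))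
  logLipschitz : ∃ δ > 0, ∃ L ≥ 0, ∃ c₀ > 0, (∀ x, ‖x‖ ≤ 1 + δ → c₀ ≤ H x) ∧
    ∀ x y, ‖x‖ ≤ 1 + δ → ‖y‖ ≤ 1 + δ → H x ≤ Real.exp (L * ‖x - y‖) * H y

/-! ### Decay and regularity of log-concave functions. -/

section LogConcave

variable {H : Space n → ℝ}

/-- Log-concavity puts the convex hull of `x` and the unit ball inside the superlevel set. If `x` is
far away, this hull contains `N` disjoint balls of radius 1/2 centred on the segment from 0 to `x`,
whose total volume is too large. -/
theorem isBounded_superlevel (hlc : ∀ x y : Space n, ∀ t : ℝ, 0 < t → t < 1 →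
      H x ^ t * H y ^ (1 - t) ≤ H (t • x + (1 - t) • y))
    {m : ℝ} (hm : 0 < m) (hball : ∀ x, ‖x‖ ≤ 1 → m ≤ H x) (hfin : volume {x | m ≤ H x} < ⊤) :
    ∃ R, ∀ x, m ≤ H x → ‖x‖ ≤ R := by
  set V := volume (Metric.ball (0 : Space n) (1 / 2)) with hV
  have hV0 : V ≠ 0 := (Metric.measure_ball_pos volume _ (by norm_num)).ne'
  obtain ⟨N, hN⟩ := ENNReal.exists_nat_mul_gt hV0 hfin.ne
  refine ⟨2 * N + 1, fun x hx => ?_⟩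
  by_contra! hlt
  have hρ : 0 < ‖x‖ := by have : (0 : ℝ) ≤ N := N.cast_nonneg; linarith
  have hsub : (⋃ k ∈ Finset.range N, Metric.ball (((k : ℝ) / ‖x‖) • x) (1 / 2)) ⊆
      {x | m ≤ H x} := by
    intro z hz
    simp only [mem_iUnion, Finset.mem_range, exists_prop] at hz
    obtain ⟨k, hk, hz⟩ := hz
    have hkN : (k : ℝ) + 1 ≤ N := by exact_mod_cast hk
    set t := (k : ℝ) / ‖x‖ with ht
    have hkt : t * ‖x‖ = k := div_mul_cancel₀ _ hρ.ne'
    have ht0 : 0 ≤ t := by positivity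
    have ht1 : t ≤ 1 / 2 := by rw [ht, div_le_iff₀ hρ]; linarith
    rw [Metric.mem_ball, dist_eq_norm] at hz
    -- Since `t ≤ 1/2`, the ball of radius 1/2 about `t • x` lies in `t • x` plus `1 - t` times the
    -- unit ball.
    have hy : ‖(1 - t)⁻¹ • (z - t • x)‖ ≤ 1 := by
      rw [norm_smul, norm_inv, Real.norm_of_nonneg (by linarith), inv_mul_le_iff₀ (by linarith)]
      linarith
    have hz' : t • x + (1 - t) • ((1 - t)⁻¹ • (z - t • x)) = z := by
      rw [smul_inv_smul₀ (by linarith)]; abel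
    have hHy := hball _ hy
    rcases ht0.eq_or_lt with h0 | h0
    · rw [← h0] at hHy hz'
      simpa using hHy
    have := hlc x _ t h0 (by linarith) |>.trans_eq (congrArg H hz')
    refine le_trans ?_ this
    calc m = m ^ t * m ^ (1 - t) := by rw [← Real.rpow_add hm]; simp
      _ ≤ _ := by
        have h2 : (0 : ℝ) ≤ 1 - t := by linarith
        have h3 : m ≤ H x := hx
        have h4 : 0 ≤ H x := hm.le.trans h3
        gcongr
  have hdisj : (↑(Finset.range N) : Set ℕ).PairwiseDisjoint
      (fun k => Metric.ball (((k : ℝ) / ‖x‖) • x) (1 / 2)) := by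
    intro i _ j _ hij
    apply Metric.ball_disjoint_ball
    rw [dist_eq_norm, ← sub_smul, norm_smul, ← sub_div, norm_div, norm_norm,
      div_mul_cancel₀ _ hρ.ne', Real.norm_eq_abs]
    have : (1 : ℤ) ≤ |(i : ℤ) - j| := Int.one_le_abs (by omega)
    have : (1 : ℝ) ≤ |(i : ℝ) - j| := by exact_mod_cast this
    linarith
  have h1 := measure_mono (μ := volume) hsub
  rw [measure_biUnion_finset hdisj (fun k _ => measurableSet_ball)] at h1
  simp only [Measure.addHaar_ball_center, ← hV, Finset.sum_const, Finset.card_range,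
    nsmul_eq_mul] at h1
  exact absurd hN (not_lt.2 h1)

/-- Between the origin and radius `R` the function drops from at least `m` to below `m / e`.
Log-concavity along rays forces at least this rate further out, so `H x ≤ m exp (-‖x‖ / R)` there;
inside radius `R`, upper semicontinuity on a compact ball gives a bound. -/
theorem exists_decay (hlc : ∀ x y : Space n, ∀ t : ℝ, 0 < t → t < 1 →
      H x ^ t * H y ^ (1 - t) ≤ H (t • x + (1 - t) • y))
    (hnn : ∀ x, 0 ≤ H x) (husc : UpperSemicontinuous H)
    {m : ℝ} (hm : 0 < m) (hball : ∀ x, ‖x‖ ≤ 1 → m ≤ H x)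
    (hfin : ∀ a > 0, volume {x | a ≤ H x} < ⊤) :
    ∃ K > 0, ∃ c > 0, ∀ x, H x ≤ K * Real.exp (-(c * ‖x‖)) := by
  set a := m * Real.exp (-1) with ha
  have ha0 : 0 < a := by positivity
  have ham : a ≤ m := by
    rw [ha]; exact mul_le_of_le_one_right hm.le (Real.exp_le_one_iff.2 (by norm_num))
  obtain ⟨R₀, hR₀⟩ := isBounded_superlevel hlc ha0 (fun x hx => ham.trans (hball x hx)) (hfin a ha0)
  set R := max R₀ 0 + 1 with hR
  have hRpos : 0 < R := by positivity
  have hRlt : ∀ x, R ≤ ‖x‖ → H x < a := fun x hx => by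
    by_contra! hcon
    have := hR₀ x hcon
    have := le_max_left R₀ 0
    linarith
  obtain ⟨M, hM⟩ := (husc.upperSemicontinuousOn (Metric.closedBall 0 R)).bddAbove_of_isCompact
    (isCompact_closedBall 0 R)
  have hM' : ∀ x, ‖x‖ ≤ R → H x ≤ max M 0 := fun x hx =>
    (hM (mem_image_of_mem H (by simpa using hx))).trans (le_max_left _ _)
  refine ⟨m + max M 0 * Real.exp 1, by positivity, R⁻¹, by positivity, fun x => ?_⟩
  rcases le_or_gt ‖x‖ R with hx | hx
  · have h1 : (-1 : ℝ) ≤ -(R⁻¹ * ‖x‖) := by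
      have : R⁻¹ * ‖x‖ ≤ 1 := by rw [inv_mul_le_iff₀ hRpos]; linarith
      linarith
    calc H x ≤ max M 0 := hM' x hx
      _ = max M 0 * Real.exp 1 * Real.exp (-1) := by rw [mul_assoc, ← Real.exp_add]; simp
      _ ≤ (m + max M 0 * Real.exp 1) * Real.exp (-(R⁻¹ * ‖x‖)) := by
        gcongr
        linarith
  · have hxp : 0 < ‖x‖ := hRpos.trans hx
    set t := R / ‖x‖ with ht
    have ht0 : 0 < t := by positivity
    have ht1 : t < 1 := by rw [ht, div_lt_one hxp]; exact hx
    have h1 := hlc x 0 t ht0 ht1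
    have h2 : H (t • x + (1 - t) • (0 : Space n)) < a := by
      apply hRlt
      rw [smul_zero, add_zero, norm_smul, Real.norm_of_nonneg ht0.le, ht,
        div_mul_cancel₀ _ hxp.ne']
    have h0 : m ≤ H 0 := hball 0 (by simp)
    have h3 : H x ^ t * m ^ (1 - t) ≤ m * Real.exp (-1) :=
      le_trans (by
        have := hnn x
        have h2 : (0 : ℝ) ≤ 1 - t := by linarith
        gcongr) (h1.trans h2.le)
    have h4 : H x ^ t ≤ (m * Real.exp (-(R⁻¹ * ‖x‖))) ^ t := by
      rw [Real.mul_rpow hm.le (Real.exp_pos _).le, ← Real.exp_mul]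
      have e1 : -(R⁻¹ * ‖x‖) * t = -1 := by rw [ht]; field_simp
      have e2 : m = m ^ t * m ^ (1 - t) := by rw [← Real.rpow_add hm]; simp
      rw [e1]
      have hp : 0 < m ^ (1 - t) := Real.rpow_pos_of_pos hm _
      refine le_of_mul_le_mul_right (h3.trans_eq ?_) hp
      nth_rewrite 1 [e2]
      ring
    have h5 := (Real.rpow_le_rpow_iff (hnn x) (by positivity) ht0).1 h4
    refine h5.trans ?_
    gcongr
    have : 0 ≤ max M 0 * Real.exp 1 := by positivity
    linarith

/-- `log H` is finite and concave on an open ball, hence locally Lipschitz, hence Lipschitz on a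
smaller closed ball. The lower bound `c₀` then comes from comparison with the origin. -/
theorem exists_logLipschitz (hlc : ∀ x y : Space n, ∀ t : ℝ, 0 < t → t < 1 →
      H x ^ t * H y ^ (1 - t) ≤ H (t • x + (1 - t) • y))
    {δ : ℝ} (hδ : 0 < δ) (hpos : ∀ x, ‖x‖ ≤ 1 + δ → 0 < H x) :
    ∃ δ > 0, ∃ L ≥ 0, ∃ c₀ > 0, (∀ x, ‖x‖ ≤ 1 + δ → c₀ ≤ H x) ∧
      ∀ x y, ‖x‖ ≤ 1 + δ → ‖y‖ ≤ 1 + δ → H x ≤ Real.exp (L * ‖x - y‖) * H y := by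
  have hconc : ConcaveOn ℝ (Metric.ball (0 : Space n) (1 + δ)) (fun x => Real.log (H x)) := by
    refine ⟨convex_ball _ _, fun x hx y hy a b ha hb hab => ?_⟩
    rw [mem_ball_zero_iff] at hx hy
    have hHx := hpos x hx.le
    have hHy := hpos y hy.le
    rcases ha.eq_or_lt with rfl | ha
    · have : b = 1 := by linarith
      simp [this]
    rcases hb.eq_or_lt with rfl | hb
    · have : a = 1 := by linarith
      simp [this]
    have h1 := hlc x y a ha (by linarith)
    have hb' : 1 - a = b := by linarith
    rw [hb'] at h1
    have h2 := Real.log_le_log (by positivity) h1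
    rwa [Real.log_mul (by positivity) (by positivity), Real.log_rpow hHx, Real.log_rpow hHy] at h2
  have hlip := (hconc.locallyLipschitzOn Metric.isOpen_ball).mono
    (Metric.closedBall_subset_ball (show 1 + δ / 2 < 1 + δ by linarith))
  obtain ⟨L, hL⟩ := hlip.exists_lipschitzOnWith_of_compact (isCompact_closedBall _ _)
  have hlip : ∀ x y, ‖x‖ ≤ 1 + δ / 2 → ‖y‖ ≤ 1 + δ / 2 →
      H x ≤ Real.exp (L * ‖x - y‖) * H y := by
    intro x y hx hy
    have h1 := hL.dist_le_mul x (by simpa using hx) y (by simpa using hy)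
    rw [Real.dist_eq, dist_eq_norm] at h1
    have hHx := hpos x (by linarith)
    have hHy := hpos y (by linarith)
    have h2 : Real.log (H x) ≤ L * ‖x - y‖ + Real.log (H y) := by
      have := le_abs_self (Real.log (H x) - Real.log (H y)); linarith
    rw [← Real.exp_le_exp, Real.exp_log hHx, Real.exp_add, Real.exp_log hHy] at h2
    exact h2
  have h0 : 0 < H 0 := hpos 0 (by simp; linarith)
  refine ⟨δ / 2, by linarith, L, L.2, Real.exp (-(L * (1 + δ / 2))) * H 0, by positivity,
    fun x hx => ?_, hlip⟩
  have h1 := hlip 0 x (by simp; linarith) hx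
  rw [zero_sub, norm_neg] at h1
  have h2 : H 0 ≤ Real.exp (L * (1 + δ / 2)) * H x :=
    h1.trans (by have := (hpos x (by linarith)).le; have := L.2; gcongr)
  calc _ ≤ Real.exp (-(L * (1 + δ / 2))) * (Real.exp (L * (1 + δ / 2)) * H x) := by gcongr
    _ = H x := by rw [← mul_assoc, ← Real.exp_add]; simp

end LogConcave

theorem one_sub_sq_le_of_ball_subset {h : Space n → ℝ} {s : ℝ}
    (hball : ellipsoid (idParam n) ⊆ lifting h s) (x : Space n) :
    1 - ‖x‖ ^ 2 ≤ (h x ^ (1 / s)) ^ 2 := by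
  rcases le_or_gt ‖x‖ 1 with hx | hx
  · have hq : 0 ≤ 1 - ‖x‖ ^ 2 := by nlinarith [norm_nonneg x]
    have hmem : (x, √(1 - ‖x‖ ^ 2)) ∈ ellipsoid (idParam n) :=
      ⟨x, √(1 - ‖x‖ ^ 2), by rw [Real.sq_sqrt hq]; linarith, by simp [idParam, act]⟩
    have h1 : |√(1 - ‖x‖ ^ 2)| ≤ h x ^ (1 / s) := hball hmem
    rw [abs_of_nonneg (Real.sqrt_nonneg _)] at h1
    calc 1 - ‖x‖ ^ 2 = √(1 - ‖x‖ ^ 2) ^ 2 := (Real.sq_sqrt hq).symm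
      _ ≤ _ := by gcongr
  · nlinarith [sq_nonneg (h x ^ (1 / s))]

theorem ProperLogConcave.isProfile {h : Space n → ℝ} (hh : ProperLogConcave h) {s : ℝ}
    (hs : 0 < s) (hpos : Metric.closedBall (0 : Space n) 1 ⊆ interior {x | 0 < h x})
    (hball : ellipsoid (idParam n) ⊆ lifting h s) : IsProfile (fun x => h x ^ (1 / s)) := by
  have hs' : 0 < 1 / s := by positivity
  have hnn : ∀ x, 0 ≤ h x ^ (1 / s) := fun x => Real.rpow_nonneg (hh.nonneg x) _
  have hlc : ∀ x y : Space n, ∀ t : ℝ, 0 < t → t < 1 →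
      (h x ^ (1 / s)) ^ t * (h y ^ (1 / s)) ^ (1 - t) ≤ h (t • x + (1 - t) • y) ^ (1 / s) := by
    intro x y t ht0 ht1
    have hx := hh.nonneg x
    have hy := hh.nonneg y
    rw [← Real.rpow_mul hx, ← Real.rpow_mul hy, mul_comm (1 / s), mul_comm (1 / s),
      Real.rpow_mul hx, Real.rpow_mul hy, ← Real.mul_rpow (by positivity) (by positivity)]
    exact Real.rpow_le_rpow (by positivity) (hh.logConcave x y t ht0 ht1) hs'.le
  have husc : UpperSemicontinuous (fun x => h x ^ (1 / s)) := by
    intro x y hxy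
    have hy : 0 < y := (hnn x).trans_lt hxy
    have h1 : h x < y ^ s := by
      rw [← Real.rpow_lt_rpow_iff (hh.nonneg x) (by positivity) hs', ← Real.rpow_mul hy.le,
        mul_one_div_cancel hs.ne', Real.rpow_one]
      exact hxy
    filter_upwards [hh.usc x _ h1] with z hz
    rw [← Real.rpow_lt_rpow_iff (hh.nonneg z) (by positivity) hs', ← Real.rpow_mul hy.le,
        mul_one_div_cancel hs.ne', Real.rpow_one] at hz
    exact hz
  -- Compactness of the closed ball gives a margin `δ` around it on which `h` is still positive.
  obtain ⟨δ, hδ, hsub⟩ := (isCompact_closedBall (0 : Space n) 1).exists_cthickening_subset_open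
    isOpen_interior hpos
  have hpos' : ∀ x : Space n, ‖x‖ ≤ 1 + δ → 0 < h x ^ (1 / s) := by
    intro x hx
    have hmem : x ∈ Metric.cthickening δ (Metric.closedBall (0 : Space n) 1) := by
      rw [cthickening_closedBall hδ.le zero_le_one]
      simpa [add_comm] using hx
    have h2 : x ∈ {x | 0 < h x} := interior_subset (hsub hmem)
    have h1 : 0 < h x := h2
    exact Real.rpow_pos_of_pos h1 _
  have hlip := exists_logLipschitz hlc hδ hpos'
  refine ⟨hnn, hlc, husc, one_sub_sq_le_of_ball_subset hball, ?_, hlip⟩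
  obtain ⟨δ', hδ', -, -, c₀, hc₀, hlow, -⟩ := hlip
  refine exists_decay hlc hnn husc hc₀ (fun x hx => hlow x (by linarith)) fun a ha => ?_
  refine lt_of_le_of_lt (measure_mono fun x hx => ?_)
    (hh.integrable.measure_ge_lt_top (ε := a ^ s) (by positivity))
  change a ≤ h x ^ (1 / s) at hx
  change a ^ s ≤ h x
  calc a ^ s ≤ (h x ^ (1 / s)) ^ s := by gcongr
    _ = h x := by rw [← Real.rpow_mul (hh.nonneg x), one_div_mul_cancel hs.ne', Real.rpow_one]

/-! ### Differentiability at contact points. -/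

namespace IsProfile

variable {H : Space n → ℝ}

theorem measurable (hH : IsProfile H) : Measurable H := hH.usc.measurable

theorem bounded (hH : IsProfile H) : ∃ K > 0, ∀ x, H x ≤ K := by
  obtain ⟨K, hK, c, hc, hb⟩ := hH.decay
  refine ⟨K, hK, fun x => (hb x).trans (mul_le_of_le_one_right hK.le ?_)⟩
  exact Real.exp_le_one_iff.2 (by have := norm_nonneg x; nlinarith)

theorem pos_of_norm_le (hH : IsProfile H) {x : Space n} (hx : ‖x‖ ≤ 1) : 0 < H x := by
  obtain ⟨δ, hδ, -, -, c₀, hc₀, hlow, -⟩ := hH.logLipschitz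
  exact hc₀.trans_le (hlow x (by linarith))

/-- On the unit sphere the height function is 0 while `H` is positive, so contact occurs only in the
open ball, where the height function is smooth. -/
theorem norm_lt_one (hH : IsProfile H) {x : Space n} (hx : H x ^ 2 = 1 - ‖x‖ ^ 2) : ‖x‖ < 1 := by
  have h1 : ‖x‖ ≤ 1 := by nlinarith [sq_nonneg (H x), norm_nonneg x]
  have h2 := hH.pos_of_norm_le h1
  nlinarith [norm_nonneg x]

/-- A log-concave function which touches the height function of the ball from above at `x` has the
same differential there. -/
theorem hasFDerivAt_sq (hH : IsProfile H) {x : Space n} (hx : H x ^ 2 = 1 - ‖x‖ ^ 2) :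
    HasFDerivAt (fun z => H z ^ 2) (-(2 : ℝ) • innerSL ℝ x) x := by
  have hx1 := hH.norm_lt_one hx
  have hq : 0 < 1 - ‖x‖ ^ 2 := by nlinarith [norm_nonneg x]
  have hlo : HasFDerivAt (fun z : Space n => 1 - ‖z‖ ^ 2) (-(2 : ℝ) • innerSL ℝ x) x := by
    have := (hasStrictFDerivAt_norm_sq (F := Space n) x).hasFDerivAt.const_sub 1
    exact this.congr_fderiv (by ext z; simp)
  have hup : HasFDerivAt (fun z : Space n => (1 - ‖x‖ ^ 2) ^ 2 / (1 - ‖(2 : ℝ) • x - z‖ ^ 2))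
      (-(2 : ℝ) • innerSL ℝ x) x := by
    have h1 : HasFDerivAt (fun z : Space n => 1 - ‖(2 : ℝ) • x - z‖ ^ 2) ((2 : ℝ) • innerSL ℝ x) x := by
      have e : (2 : ℝ) • x - x = x := by rw [two_smul]; abel
      have h2 : HasFDerivAt (fun z : Space n => (2 : ℝ) • x - z)
          (-ContinuousLinearMap.id ℝ (Space n)) x := (hasFDerivAt_id x).const_sub _
      have h3 : HasFDerivAt (fun z : Space n => 1 - ‖z‖ ^ 2) (-(2 : ℝ) • innerSL ℝ x)
        ((2 : ℝ) • x - x) := by rw [e]; exact hlo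
      exact (h3.comp x h2).congr_fderiv (by ext z; simp)
    have h4 := (hasDerivAt_inv (x := (1 - ‖(2 : ℝ) • x - x‖ ^ 2)) (by
      have e : (2 : ℝ) • x - x = x := by rw [two_smul]; abel
      rw [e]; exact hq.ne')).comp_hasFDerivAt x h1
    have h5 := h4.const_mul ((1 - ‖x‖ ^ 2) ^ 2)
    refine h5.congr_fderiv ?_
    have e : (2 : ℝ) • x - x = x := by rw [two_smul]; abel
    rw [e]
    ext z
    simp only [FunLike.coe_smul, Pi.smul_apply, smul_eq_mul]
    field_simp
  have hnear : ∀ᶠ z in 𝓝 x, ‖(2 : ℝ) • x - z‖ < 1 := by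
    have hc : ContinuousAt (fun z : Space n => ‖(2 : ℝ) • x - z‖) x := by fun_prop
    refine hc.eventually_lt continuousAt_const ?_
    rwa [two_smul, add_sub_cancel_right]
  -- `x` is the midpoint of `z` and its reflection `2x - z`, so `H z * H (2x - z) ≤ H x ^ 2`;
  -- bounding `H (2x - z)` below by the height function bounds `H z` above. Both barriers touch `H ^
  -- 2` at `x` with gradient `-2x`.
  have hle : ∀ᶠ z in 𝓝 x, H z ^ 2 ≤ (1 - ‖x‖ ^ 2) ^ 2 / (1 - ‖(2 : ℝ) • x - z‖ ^ 2) := by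
    filter_upwards [hnear] with z hz
    have hz0 : 0 < 1 - ‖(2 : ℝ) • x - z‖ ^ 2 := by nlinarith [norm_nonneg ((2 : ℝ) • x - z)]
    rw [le_div_iff₀ hz0]
    have h1 := hH.logConcave z ((2 : ℝ) • x - z) (1 / 2) (by norm_num) (by norm_num)
    have e : (1 / 2 : ℝ) • z + (1 - 1 / 2 : ℝ) • ((2 : ℝ) • x - z) = x := by
      rw [smul_sub, smul_smul]; norm_num
    rw [e, show (1 - 1 / 2 : ℝ) = 1 / 2 by norm_num, ← Real.sqrt_eq_rpow, ← Real.sqrt_eq_rpow,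
      ← Real.sqrt_mul (hH.nonneg z)] at h1
    have hA := mul_nonneg (hH.nonneg z) (hH.nonneg ((2 : ℝ) • x - z))
    have h2 : H z * H ((2 : ℝ) • x - z) ≤ H x ^ 2 := by
      calc _ = √(H z * H ((2 : ℝ) • x - z)) ^ 2 := (Real.sq_sqrt hA).symm
        _ ≤ _ := by gcongr
    calc H z ^ 2 * (1 - ‖(2 : ℝ) • x - z‖ ^ 2) ≤ H z ^ 2 * H ((2 : ℝ) • x - z) ^ 2 := by
          gcongr; exact hH.le_sq _
      _ = (H z * H ((2 : ℝ) • x - z)) ^ 2 := by ring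
      _ ≤ (H x ^ 2) ^ 2 := by gcongr
      _ = _ := by rw [hx]
  rw [hasFDerivAt_iff_isLittleO] at hlo hup ⊢
  refine Asymptotics.IsBigO.trans_isLittleO (Asymptotics.IsBigO.of_bound 1 ?_)
    (hlo.norm_left.add hup.norm_left)
  filter_upwards [hle] with z hz
  have e : (2 : ℝ) • x - x = x := by rw [two_smul]; abel
  have h1 := hH.le_sq z
  have h2 : (1 - ‖x‖ ^ 2) ^ 2 / (1 - ‖(2 : ℝ) • x - x‖ ^ 2) = 1 - ‖x‖ ^ 2 := by
    rw [e, sq (1 - ‖x‖ ^ 2), mul_div_assoc, div_self hq.ne', mul_one]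
  rw [h2, hx]
  set D := (-(2 : ℝ) • innerSL ℝ x) (z - x)
  set U := (1 - ‖x‖ ^ 2) ^ 2 / (1 - ‖(2 : ℝ) • x - z‖ ^ 2)
  simp only [Real.norm_eq_abs, one_mul]
  refine le_trans ?_ (le_abs_self _)
  have a1 := neg_abs_le (1 - ‖z‖ ^ 2 - (1 - ‖x‖ ^ 2) - D)
  have a2 := le_abs_self (U - (1 - ‖x‖ ^ 2) - D)
  have a3 := abs_nonneg (1 - ‖z‖ ^ 2 - (1 - ‖x‖ ^ 2) - D)
  have a4 := abs_nonneg (U - (1 - ‖x‖ ^ 2) - D)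
  rw [abs_le]
  constructor <;> linarith

theorem hasFDerivAt (hH : IsProfile H) {x : Space n} (hx : H x ^ 2 = 1 - ‖x‖ ^ 2) :
    HasFDerivAt H (-(H x)⁻¹ • innerSL ℝ x) x := by
  have hp : 0 < H x := hH.pos_of_norm_le (hH.norm_lt_one hx).le
  have h1 := (hH.hasFDerivAt_sq hx).sqrt (pow_ne_zero 2 hp.ne')
  have h2 : (fun z => √(H z ^ 2)) = H := funext fun z => Real.sqrt_sq (hH.nonneg z)
  rw [h2] at h1
  refine h1.congr_fderiv ?_
  rw [Real.sqrt_sq hp.le]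
  ext z
  simp only [FunLike.coe_smul, Pi.smul_apply, smul_eq_mul]
  field_simp

end IsProfile
end FunctionalJohn

namespace FunctionalJohn

/-! ### The one-variable functions `f` and `g` and the convolution `F`. -/

namespace PropF

variable {f : ℝ → ℝ}

theorem continuous (hf : PropF f) : Continuous f := hf.locallyLipschitz.continuous

theorem nonneg (hf : PropF f) (x : ℝ) : 0 ≤ f x := by
  rcases le_or_gt x (-1) with hx | hx
  · rw [hf.eq_zero x hx]
  · rw [← hf.eq_zero (-1) le_rfl]
    exact (hf.strictMono (mem_Ici.2 le_rfl) (mem_Ici.2 hx.le) hx).le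

theorem monotone (hf : PropF f) : Monotone f := by
  intro x y hxy
  rcases le_or_gt x (-1) with hx | hx
  · rw [hf.eq_zero x hx]; exact hf.nonneg y
  · exact hf.strictMono.monotoneOn (mem_Ici.2 hx.le) (mem_Ici.2 (hx.le.trans hxy)) hxy

theorem lt_of_lt (hf : PropF f) {x y : ℝ} (hxy : x < y) (hy : -1 < y) : f x < f y := by
  rcases le_or_gt x (-1) with hx | hx
  · rw [hf.eq_zero x hx, ← hf.eq_zero (-1) le_rfl]
    exact hf.strictMono (mem_Ici.2 le_rfl) (mem_Ici.2 hy.le) hy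
  · exact hf.strictMono (mem_Ici.2 hx.le) (mem_Ici.2 hy.le) hxy

theorem pos (hf : PropF f) {x : ℝ} (hx : -1 < x) : 0 < f x := by
  rw [← hf.eq_zero (-1) le_rfl]; exact hf.lt_of_lt hx hx

/-- By convexity the slope on `[a, b]` is at most the slope on `[b, T + 1]`, an interval of length
at least one on which `f` grows by at most `f (T + 1)`. -/
theorem sub_le (hf : PropF f) {a b T : ℝ} (hab : a ≤ b) (hb : b ≤ T) :
    f b - f a ≤ f (T + 1) * (b - a) := by
  rcases hab.eq_or_lt with rfl | hab
  · simp
  have h1 := hf.convex.slope_mono_adjacent (mem_univ a) (mem_univ (T + 1)) hab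
    (show b < T + 1 by linarith)
  have h2 : (f (T + 1) - f b) / (T + 1 - b) ≤ f (T + 1) := by
    rw [div_le_iff₀ (by linarith)]
    nlinarith [hf.nonneg b, hf.nonneg (T + 1)]
  have h3 := h1.trans h2
  rwa [div_le_iff₀ (by linarith)] at h3

/-- For `t > 1` the slope on `[0, t]` is at least the slope `f 0` on `[-1, 0]`; for `t ≤ 1`
monotonicity suffices. -/
theorem add_mul_le (hf : PropF f) {t : ℝ} (ht : 0 ≤ t) : t * f 0 ≤ f t := by
  rcases le_or_gt t 1 with h1 | h1
  · have := hf.monotone ht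
    nlinarith [hf.nonneg 0]
  have h0 := hf.convex.slope_mono_adjacent (mem_univ (-1)) (mem_univ t) (show (-1 : ℝ) < 0 by norm_num)
    (show 0 < t by linarith)
  rw [hf.eq_zero (-1) le_rfl] at h0
  simp only [sub_zero, sub_neg_eq_add, zero_add, div_one] at h0
  rw [le_div_iff₀ (by linarith)] at h0
  nlinarith [hf.nonneg 0]

theorem tendsto_atTop (hf : PropF f) : Tendsto f atTop atTop := by
  have h0 : 0 < f 0 := hf.pos (by norm_num)
  refine tendsto_atTop_mono' _ ?_ (tendsto_id.atTop_mul_const h0)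
  filter_upwards [eventually_ge_atTop 0] with t ht using hf.add_mul_le ht

theorem deriv_nonneg (hf : PropF f) (t : ℝ) : 0 ≤ deriv f t :=
  hf.monotone.deriv_nonneg

/-- `sub_le` bounds the difference quotients near `t`. At kinks of `f` the derivative has the
default value 0, so the bound holds at every point. -/
theorem deriv_le (hf : PropF f) {t T : ℝ} (ht : t ≤ T) : deriv f t ≤ f (T + 2) := by
  have h0 := hf.nonneg (T + 2)
  refine (Real.le_norm_self _).trans (norm_deriv_le_of_lip' (x₀ := t) (f := f) h0 ?_)
  have hnear : ∀ᶠ x in 𝓝 t, x < T + 1 := (isOpen_Iio.mem_nhds (show t < T + 1 by linarith))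
  filter_upwards [hnear] with x hx
  rcases le_total x t with hxt | hxt
  · have := hf.sub_le hxt (show t ≤ T + 1 by linarith)
    rw [Real.norm_eq_abs, Real.norm_eq_abs, abs_sub_comm, abs_sub_comm x,
      abs_of_nonneg (sub_nonneg.2 (hf.monotone hxt)), abs_of_nonneg (sub_nonneg.2 hxt)]
    convert this using 2; ring_nf
  · have := hf.sub_le hxt hx.le
    rw [Real.norm_eq_abs, Real.norm_eq_abs, abs_of_nonneg (sub_nonneg.2 (hf.monotone hxt)),
      abs_of_nonneg (sub_nonneg.2 hxt)]
    convert this using 2; ring_nf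

theorem deriv_eq_zero (hf : PropF f) {t : ℝ} (ht : t < -1) : deriv f t = 0 := by
  have : f =ᶠ[𝓝 t] fun _ => 0 := by
    filter_upwards [isOpen_Iio.mem_nhds ht] with x hx using hf.eq_zero x (le_of_lt hx)
  rw [this.deriv_eq, deriv_const]

end PropF

namespace PropG

variable {g : ℝ → ℝ}

theorem continuous (hg : PropG g) : Continuous g := hg.locallyLipschitz.continuous

theorem nonneg (hg : PropG g) (x : ℝ) : 0 ≤ g x := by
  rcases le_total 1 x with hx | hx
  · rw [hg.eq_zero x hx]
  · rw [← hg.eq_zero 1 le_rfl]; exact hg.antitone hx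

theorem le_one (hg : PropG g) (x : ℝ) : g x ≤ 1 := by
  rcases le_total x (-1) with hx | hx
  · rw [hg.eq_one x hx]
  · rw [← hg.eq_one (-1) le_rfl]; exact hg.antitone hx

theorem pos_of_lt (hg : PropG g) {x : ℝ} (hx : x < 1) : 0 < g x := by
  rcases le_or_gt x (-1) with h1 | h1
  · rw [hg.eq_one x h1]; norm_num
  · exact hg.pos x ⟨h1, hx⟩

end PropG

section Convolution

variable {f g : ℝ → ℝ}

theorem convF_eq (c : ℝ) : convF f g c = ∫ t, f (t + c) * g t := by
  rw [convF, convolution_def, ← integral_add_right_eq_self _ c]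
  simp

theorem continuous_mul_shift (hf : PropF f) (hg : PropG g) (c : ℝ) :
    Continuous fun t => f (t + c) * g t :=
  (hf.continuous.comp (continuous_id.add continuous_const)).mul hg.continuous

theorem integrable_mul_shift (hf : PropF f) (hg : PropG g) (c : ℝ) :
    Integrable fun t => f (t + c) * g t := by
  refine (continuous_mul_shift hf hg c).integrable_of_hasCompactSupport
    (HasCompactSupport.intro (isCompact_Icc (a := -1 - c) (b := 1)) fun t ht => ?_)
  rw [mem_Icc, not_and_or, not_le, not_le] at ht
  rcases ht with ht | ht
  · rw [hf.eq_zero _ (by linarith), zero_mul]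
  · rw [hg.eq_zero _ ht.le, mul_zero]

theorem convF_nonneg (hf : PropF f) (hg : PropG g) (c : ℝ) : 0 ≤ convF f g c := by
  rw [convF_eq]; exact integral_nonneg fun t => mul_nonneg (hf.nonneg _) (hg.nonneg _)

theorem convF_monotone (hf : PropF f) (hg : PropG g) : Monotone (convF f g) := by
  intro a b hab
  rw [convF_eq, convF_eq]
  exact integral_mono (integrable_mul_shift hf hg a) (integrable_mul_shift hf hg b)
    fun t => mul_le_mul_of_nonneg_right (hf.monotone (by linarith)) (hg.nonneg t)

theorem convF_lt (hf : PropF f) (hg : PropG g) {a b : ℝ} (hab : a < b) (hb : -2 < b) :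
    convF f g a < convF f g b := by
  rw [convF_eq, convF_eq, ← sub_pos, ← integral_sub (integrable_mul_shift hf hg b)
    (integrable_mul_shift hf hg a)]
  have hnn : ∀ t, 0 ≤ f (t + b) * g t - f (t + a) * g t := fun t => sub_nonneg.2
    (mul_le_mul_of_nonneg_right (hf.monotone (by linarith)) (hg.nonneg t))
  -- At `t = -b / 2` the condition `b > -2` gives both `t + b > -1`, where `f` is strictly
  -- increasing, and `t < 1`, where `g` is positive.
  refine Continuous.integral_pos_of_hasCompactSupport_nonneg_nonzero (x := -b / 2)
    ((continuous_mul_shift hf hg b).sub (continuous_mul_shift hf hg a)) ?_ hnn ?_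
  · refine HasCompactSupport.intro (isCompact_Icc (a := -1 - b) (b := 1)) fun t ht => ?_
    rw [mem_Icc, not_and_or, not_le, not_le] at ht
    rcases ht with ht | ht
    · rw [hf.eq_zero _ (by linarith), hf.eq_zero (t + a) (by linarith)]; simp
    · rw [hg.eq_zero _ ht.le]; simp
  · rw [← sub_mul]
    exact (mul_pos (sub_pos.2 (hf.lt_of_lt (by linarith) (by linarith)))
      (hg.pos_of_lt (by linarith))).ne'

theorem convF_eq_zero (hf : PropF f) (hg : PropG g) {c : ℝ} (hc : c ≤ -2) : convF f g c = 0 := by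
  rw [convF_eq]
  refine integral_eq_zero_of_ae (Eventually.of_forall fun t => ?_)
  rcases le_total 1 t with ht | ht
  · simp [hg.eq_zero t ht]
  · simp [hf.eq_zero (t + c) (by linarith)]

theorem convF_convex (hf : PropF f) (hg : PropG g) : ConvexOn ℝ univ (convF f g) := by
  refine ⟨convex_univ, fun x _ y _ a b ha hb hab => ?_⟩
  simp only [convF_eq, smul_eq_mul]
  rw [← integral_const_mul, ← integral_const_mul, ← integral_add
    ((integrable_mul_shift hf hg x).const_mul a) ((integrable_mul_shift hf hg y).const_mul b)]
  refine integral_mono (integrable_mul_shift hf hg _) 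
    (((integrable_mul_shift hf hg x).const_mul a).add ((integrable_mul_shift hf hg y).const_mul b))
    fun t => ?_
  have h1 := hf.convex.2 (mem_univ (t + x)) (mem_univ (t + y)) ha hb hab
  simp only [smul_eq_mul] at h1
  have h2 : a * (t + x) + b * (t + y) = t + (a * x + b * y) := by
    linear_combination t * hab
  rw [h2] at h1
  have := mul_le_mul_of_nonneg_right h1 (hg.nonneg t)
  simp only
  linarith

/-- `f` may have kinks, but a monotone function is differentiable almost everywhere. With a local
Lipschitz bound this suffices to differentiate under the integral, so `F` is differentiable
everywhere. -/
theorem hasDerivAt_convF (hf : PropF f) (hg : PropG g) (c : ℝ) :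
    HasDerivAt (convF f g) (∫ t, deriv f (t + c) * g t) c := by
  -- For `|x - c| < 1` and `t ≤ 1` the argument `t + x` is at most `c + 2`, where `sub_le` gives the
  -- Lipschitz constant `f (c + 3)`; for `t < -2 - c` it is below -1, where `f` vanishes.
  set D := f (c + 3) with hD
  have hD0 : 0 ≤ D := hf.nonneg _
  have hae : ∀ᵐ t, HasDerivAt (fun x => f (t + x) * g t) (deriv f (t + c) * g t) c := by
    have h1 : ∀ᵐ t, DifferentiableAt ℝ f t := hf.monotone.ae_differentiableAt
    have h2 : ∀ᵐ t, DifferentiableAt ℝ f (t + c) :=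
      (measurePreserving_add_right volume c).quasiMeasurePreserving.ae h1
    filter_upwards [h2] with t ht
    exact (ht.hasDerivAt.comp_const_add t c).mul_const _
  have key := hasDerivAt_integral_of_dominated_loc_of_lip (μ := volume) (𝕜 := ℝ)
    (F := fun x t => f (t + x) * g t) (F' := fun t => deriv f (t + c) * g t) (x₀ := c)
    (s := Metric.ball c 1) (bound := (Icc (-2 - c) 1).indicator fun _ => D)
    (Metric.ball_mem_nhds c one_pos)
    (Eventually.of_forall fun x => (continuous_mul_shift hf hg x).aestronglyMeasurable)
    (integrable_mul_shift hf hg c)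
    (((measurable_deriv f).comp (measurable_add_const c)).mul
      hg.continuous.measurable).aestronglyMeasurable
    (Eventually.of_forall fun t => ?_)
    ((integrable_indicator_iff measurableSet_Icc).2 (by simp [IntegrableOn]))
    hae
  · have := key.2
    rwa [← funext fun x => convF_eq (f := f) (g := g) x] at this
  · refine LipschitzOnWith.of_dist_le_mul fun x hx y hy => ?_
    rw [Metric.mem_ball, Real.dist_eq, abs_lt] at hx hy
    rw [Real.dist_eq, Real.dist_eq, Real.coe_nnabs]
    by_cases ht : t ∈ Icc (-2 - c) 1
    · rw [indicator_of_mem ht, abs_of_nonneg hD0]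
      wlog hxy : y ≤ x generalizing x y
      · rw [abs_sub_comm, abs_sub_comm x]
        exact this y hy x hx (le_of_not_ge hxy)
      rw [← sub_mul, abs_mul, abs_of_nonneg (hg.nonneg t), abs_of_nonneg (sub_nonneg.2 hxy),
        abs_of_nonneg (sub_nonneg.2 (hf.monotone (by linarith)))]
      have h1 := hf.sub_le (show t + y ≤ t + x by linarith) (show t + x ≤ c + 2 by linarith [ht.2])
      have e1 : c + 2 + 1 = c + 3 := by ring
      have e2 : t + x - (t + y) = x - y := by ring
      rw [e1, e2, ← hD] at h1
      exact (mul_le_of_le_one_right (sub_nonneg.2 (hf.monotone (by linarith)))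
        (hg.le_one t)).trans h1
    · rw [indicator_of_notMem ht]
      rw [mem_Icc, not_and_or, not_le, not_le] at ht
      rcases ht with ht | ht
      · rw [hf.eq_zero _ (by linarith), hf.eq_zero (t + y) (by linarith)]; simp
      · rw [hg.eq_zero _ ht.le]; simp

theorem deriv_convF (hf : PropF f) (hg : PropG g) (c : ℝ) :
    deriv (convF f g) c = ∫ t, deriv f t * g (t - c) := by
  rw [(hasDerivAt_convF hf hg c).deriv,
    ← integral_add_right_eq_self (fun t => deriv f t * g (t - c)) c]
  simp only [add_sub_cancel_right]

theorem deriv_convF_nonneg (hf : PropF f) (hg : PropG g) (c : ℝ) : 0 ≤ deriv (convF f g) c :=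
  (convF_monotone hf hg).deriv_nonneg

/-- If `c > -2`, convexity bounds the slope of `F` from -2 to `c` by `F' c = 0`, although `F c > F
(-2)`. -/
theorem le_neg_two_of_deriv_eq_zero (hf : PropF f) (hg : PropG g) {c : ℝ}
    (hc : deriv (convF f g) c = 0) : c ≤ -2 := by
  by_contra! hlt
  have h1 := (convF_convex hf hg).slope_le_of_hasDerivAt (mem_univ (-2)) (mem_univ c) hlt
    (hc ▸ (hasDerivAt_convF hf hg c).differentiableAt.hasDerivAt)
  have h2 := convF_lt hf hg hlt hlt
  rw [slope_def_field] at h1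
  have h3 : 0 < (convF f g c - convF f g (-2)) / (c - -2) := div_pos (by linarith) (by linarith)
  linarith

theorem lintegral_deriv_mul (hf : PropF f) (hg : PropG g) (c : ℝ) :
    ∫⁻ t, ENNReal.ofReal (deriv f t * g (t - c)) = ENNReal.ofReal (deriv (convF f g) c) := by
  rw [deriv_convF hf hg, ofReal_integral_eq_lintegral_ofReal]
  · refine Integrable.mono' (g := (Icc (-1) (1 + c)).indicator fun _ => f (c + 3)) 
      ((integrable_indicator_iff measurableSet_Icc).2 (by simp [IntegrableOn])) 
      ((measurable_deriv f).mul
        (hg.continuous.measurable.comp (measurable_sub_const c))).aestronglyMeasurable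
      (Eventually.of_forall fun t => ?_)
    rw [Real.norm_of_nonneg (mul_nonneg (hf.deriv_nonneg t) (hg.nonneg _))]
    by_cases ht : t ∈ Icc (-1) (1 + c)
    · rw [indicator_of_mem ht]
      refine (mul_le_of_le_one_right (hf.deriv_nonneg t) (hg.le_one _)).trans ?_
      have := hf.deriv_le ht.2
      rwa [show 1 + c + 2 = c + 3 by ring] at this
    · rw [indicator_of_notMem ht]
      rw [mem_Icc, not_and_or, not_le, not_le] at ht
      rcases ht with ht | ht
      · rw [hf.deriv_eq_zero ht, zero_mul]
      · rw [hg.eq_zero _ (by linarith), mul_zero]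
  · exact Eventually.of_forall fun t => mul_nonneg (hf.deriv_nonneg t) (hg.nonneg _)

theorem lintegral_mul_shift (hf : PropF f) (hg : PropG g) (c : ℝ) :
    ∫⁻ t, ENNReal.ofReal (f (t + c) * g t) = ENNReal.ofReal (convF f g c) := by
  rw [convF_eq, ofReal_integral_eq_lintegral_ofReal (integrable_mul_shift hf hg c)]
  exact Eventually.of_forall fun t => mul_nonneg (hf.nonneg _) (hg.nonneg _)

end Convolution
end FunctionalJohn

namespace FunctionalJohn

variable {n : ℕ}

/-! ### The action of matrices on Euclidean space. -/

section Act

theorem act_eq_toEuclideanCLM (A : Matrix (Fin n) (Fin n) ℝ) (x : Space n) :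
    act A x = Matrix.toEuclideanCLM (𝕜 := ℝ) A x := rfl

theorem act_one (x : Space n) : act 1 x = x := by simp [act]

theorem act_act (A B : Matrix (Fin n) (Fin n) ℝ) (x : Space n) :
    act A (act B x) = act (A * B) x := by simp [act, Matrix.mulVec_mulVec]

theorem act_add_left (A B : Matrix (Fin n) (Fin n) ℝ) (x : Space n) :
    act (A + B) x = act A x + act B x := by simp [act_eq_toEuclideanCLM]

theorem act_smul_left (c : ℝ) (A : Matrix (Fin n) (Fin n) ℝ) (x : Space n) :
    act (c • A) x = c • act A x := by simp [act_eq_toEuclideanCLM]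

theorem act_add_right (A : Matrix (Fin n) (Fin n) ℝ) (x y : Space n) :
    act A (x + y) = act A x + act A y := by
  simp [act_eq_toEuclideanCLM]

theorem act_neg_right (A : Matrix (Fin n) (Fin n) ℝ) (x : Space n) :
    act A (-x) = -act A x := by
  simp [act_eq_toEuclideanCLM]

theorem continuous_toEuclideanCLM : Continuous fun A : Matrix (Fin n) (Fin n) ℝ =>
    (Matrix.toEuclideanCLM (𝕜 := ℝ) A : Space n →L[ℝ] Space n) :=
  LinearMap.continuous_of_finiteDimensional
    ((Matrix.toEuclideanCLM (n := Fin n) (𝕜 := ℝ)).toAlgEquiv.toLinearMap)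

theorem continuous_act : Continuous fun q : Matrix (Fin n) (Fin n) ℝ × Space n => act q.1 q.2 :=
  (continuous_toEuclideanCLM.comp continuous_fst).clm_apply continuous_snd

theorem norm_act_le (A : Matrix (Fin n) (Fin n) ℝ) (x : Space n) :
    ‖act A x‖ ≤ ‖(Matrix.toEuclideanCLM (𝕜 := ℝ) A : Space n →L[ℝ] Space n)‖ * ‖x‖ :=
  (Matrix.toEuclideanCLM (𝕜 := ℝ) A : Space n →L[ℝ] Space n).le_opNorm x

theorem act_act_inv {A : Matrix (Fin n) (Fin n) ℝ} (hA : A.det ≠ 0) (x : Space n) :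
    act A (act A⁻¹ x) = x := by
  rw [act_act, Matrix.mul_nonsing_inv _ (isUnit_iff_ne_zero.2 hA), act_one]

end Act

/-! ### Reduction to `H = h ^ (1 / s)` and the rescaled height variable. -/

section Reduction

/-- The factor of `f` in terms of `H = h ^ (1 / s)` and `ε = 1 - r`. -/
noncomputable def fExt (f : ℝ → ℝ) (H : Space n → ℝ) (ε : ℝ) (x : Space n) (y : ℝ) : ℝ≥0∞ :=
  if H x = 0 then ⊤ else ENNReal.ofReal (f ((y / H x - 1) / ε))

/-- The factor of `g` in terms of `H = h ^ (1 / s)` and `ε = 1 - r`. -/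
noncomputable def gExt (g : ℝ → ℝ) (H : Space n → ℝ) (ε : ℝ) (x : Space n) (y : ℝ) : ℝ≥0∞ :=
  if H x = 0 then 0 else ENNReal.ofReal (g ((‖x‖ ^ 2 + y ^ 2 - 1) / (2 * H x ^ 2) / ε))

/-- The functional `Lbar` in terms of `H = h ^ (1 / s)` and `ε = 1 - r`. -/
noncomputable def profileL (f g : ℝ → ℝ) (H : Space n → ℝ) (ε : ℝ) (p : Param n) : ℝ≥0∞ :=
  ENNReal.ofReal (1 / ε) * ∫⁻ x : Space n, ∫⁻ y in Ioi (0 : ℝ),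
    fExt f H ε (act p.1 x + p.2.2) (p.2.1 * y) * gExt g H ε x y

/-- The density of `muMeasure` in terms of `H = h ^ (1 / s)` and `ε = 1 - r`. -/
noncomputable def profileDensity (f g : ℝ → ℝ) (H : Space n → ℝ) (s ε : ℝ) (p : Param n)
    (x : Space n) : ℝ≥0∞ :=
  ENNReal.ofReal (p.2.1 ^ (s - 1) / ε) * ∫⁻ y in Ioi (0 : ℝ),
    ENNReal.ofReal (deriv f ((y / H x - 1) / ε) * (y / H x ^ 3)) *
      gExt g H ε (act p.1⁻¹ (x - p.2.2)) (p.2.1⁻¹ * y)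

variable {f g : ℝ → ℝ} {H : Space n → ℝ}

theorem rpow_two_div {a s : ℝ} (ha : 0 ≤ a) : a ^ (2 / s) = (a ^ (1 / s)) ^ 2 := by
  rw [← Real.rpow_natCast, ← Real.rpow_mul ha]; congr 1; push_cast; ring

theorem rpow_three_div {a s : ℝ} (ha : 0 ≤ a) : a ^ (3 / s) = (a ^ (1 / s)) ^ 3 := by
  rw [← Real.rpow_natCast, ← Real.rpow_mul ha]; congr 1; push_cast; ring

theorem rpow_one_div_eq_zero {a s : ℝ} (ha : 0 ≤ a) (hs : 0 < s) : a ^ (1 / s) = 0 ↔ a = 0 :=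
  Real.rpow_eq_zero ha (by positivity)

theorem fFactor_eq {h : Space n → ℝ} {s : ℝ} (hs : 0 < s) (hnn : ∀ x, 0 ≤ h x) (r : ℝ) (x : Space n)
    (y : ℝ) : fFactor f h s r x y = fExt f (fun x => h x ^ (1 / s)) (1 - r) x y := by
  simp only [fFactor, fExt, rpow_one_div_eq_zero (hnn x) hs, rescale]

theorem gFactor_eq {h : Space n → ℝ} {s : ℝ} (hs : 0 < s) (hnn : ∀ x, 0 ≤ h x) (r : ℝ) (x : Space n)
    (y : ℝ) : ENNReal.ofReal (gFactor g h s r x y) =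
      gExt g (fun x => h x ^ (1 / s)) (1 - r) x y := by
  simp only [gFactor, gExt, rpow_one_div_eq_zero (hnn x) hs, rescale, add_sub_cancel_right,
    rpow_two_div (hnn x)]
  split_ifs <;> simp

theorem Lbar_eq_profileL {h : Space n → ℝ} {s : ℝ} (hs : 0 < s) (hnn : ∀ x, 0 ≤ h x) (r : ℝ)
    (p : Param n) : Lbar f g h s r p = profileL f g (fun x => h x ^ (1 / s)) (1 - r) p := by
  simp only [Lbar, profileL, fFactor_eq hs hnn, gFactor_eq hs hnn]

theorem muMeasure_eq {h : Space n → ℝ} {s : ℝ} (hs : 0 < s) (hnn : ∀ x, 0 ≤ h x) (hf : PropF f)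
    (r : ℝ) (p : Param n) : muMeasure f g h s r p =
      volume.withDensity (profileDensity f g (fun x => h x ^ (1 / s)) s (1 - r) p) := by
  unfold muMeasure
  congr 1
  funext x
  simp only [profileDensity]
  congr 1
  refine setLIntegral_congr_fun measurableSet_Ioi fun y hy => ?_
  have hy' : 0 < y := hy
  have h3 : 0 ≤ y / (h x ^ (1 / s)) ^ 3 := by have := hnn x; positivity
  simp only [rpow_three_div (hnn x), rescale]
  rw [mul_right_comm, ENNReal.ofReal_mul (mul_nonneg (hf.deriv_nonneg _) h3), gFactor_eq hs hnn]

theorem lintegral_affine {Φ : ℝ → ℝ≥0∞} (hΦ : Measurable Φ) {a : ℝ} (ha : 0 < a) (b : ℝ) :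
    ∫⁻ y, Φ y = ENNReal.ofReal a * ∫⁻ t, Φ (b + a * t) := by
  have h1 : ∫⁻ t, Φ (b + a * t) = ∫⁻ t, Φ (b + t) ∂(Measure.map (fun t => a * t) volume) := by
    exact (lintegral_map (hΦ.comp (measurable_const_add b)) (measurable_const_mul a)).symm
  rw [h1, Real.map_volume_mul_left ha.ne', lintegral_smul_measure,
    lintegral_add_left_eq_self Φ b, smul_eq_mul, ← mul_assoc, ← ENNReal.ofReal_mul ha.le,
    abs_of_pos (inv_pos.2 ha), mul_inv_cancel₀ ha.ne', ENNReal.ofReal_one, one_mul]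

theorem measurable_fExt (hH : Measurable H) (hf : Continuous f) (ε : ℝ) :
    Measurable fun q : Space n × ℝ => fExt f H ε q.1 q.2 := by
  refine Measurable.ite ?_ measurable_const ?_
  · exact (hH.comp measurable_fst) (measurableSet_singleton 0)
  · exact (hf.measurable.comp (((measurable_snd.div (hH.comp measurable_fst)).sub_const 1).div_const
      ε)).ennreal_ofReal

theorem measurable_gExt (hH : Measurable H) (hg : Continuous g) (ε : ℝ) :
    Measurable fun q : Space n × ℝ => gExt g H ε q.1 q.2 := by
  refine Measurable.ite ?_ measurable_const ?_
  · exact (hH.comp measurable_fst) (measurableSet_singleton 0)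
  · exact (hg.measurable.comp (by fun_prop)).ennreal_ofReal

theorem measurable_act (A : Matrix (Fin n) (Fin n) ℝ) : Measurable (act A) :=
  (Matrix.toEuclideanCLM (𝕜 := ℝ) A : Space n →L[ℝ] Space n).continuous.measurable

/-- The integrand of `profileL` in the rescaled height variable. -/
noncomputable def kernelL (f g : ℝ → ℝ) (H : Space n → ℝ) (ε : ℝ) (p : Param n)
    (x : Space n) (t : ℝ) : ℝ≥0∞ :=
  ENNReal.ofReal (H x) * (Ioi (0 : ℝ)).indicator
    (fun y => fExt f H ε (act p.1 x + p.2.2) (p.2.1 * y) * gExt g H ε x y) (H x + H x * ε * t)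

/-- The integrand of `profileDensity` in the rescaled height variable. -/
noncomputable def kernelMu (f g : ℝ → ℝ) (H : Space n → ℝ) (s ε : ℝ) (p : Param n) (x : Space n) (t : ℝ) :
    ℝ≥0∞ :=
  ENNReal.ofReal (p.2.1 ^ (s - 1) * H x) * (Ioi (0 : ℝ)).indicator
    (fun y => ENNReal.ofReal (deriv f ((y / H x - 1) / ε) * (y / H x ^ 3)) *
      gExt g H ε (act p.1⁻¹ (x - p.2.2)) (p.2.1⁻¹ * y)) (H x + H x * ε * t)

theorem measurable_integrandL (hH : Measurable H) (hf : Continuous f) (hg : Continuous g) (ε : ℝ)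
    (p : Param n) : Measurable fun q : Space n × ℝ =>
      fExt f H ε (act p.1 q.1 + p.2.2) (p.2.1 * q.2) * gExt g H ε q.1 q.2 := by
  have h1 : Measurable fun q : Space n × ℝ => (act p.1 q.1 + p.2.2, p.2.1 * q.2) :=
    (((measurable_act p.1).comp measurable_fst).add_const _).prodMk (measurable_snd.const_mul _)
  exact ((measurable_fExt hH hf ε).comp h1).mul (measurable_gExt hH hg ε)

theorem measurable_integrandMu (hH : Measurable H) (hg : Continuous g) (ε : ℝ)
    (p : Param n) : Measurable fun q : Space n × ℝ =>
      ENNReal.ofReal (deriv f ((q.2 / H q.1 - 1) / ε) * (q.2 / H q.1 ^ 3)) *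
      gExt g H ε (act p.1⁻¹ (q.1 - p.2.2)) (p.2.1⁻¹ * q.2) := by
  have h1 : Measurable fun q : Space n × ℝ => (act p.1⁻¹ (q.1 - p.2.2), p.2.1⁻¹ * q.2) :=
    ((measurable_act _).comp (measurable_fst.sub_const _)).prodMk (measurable_snd.const_mul _)
  have h2 := measurable_deriv f
  exact (Measurable.ennreal_ofReal (by fun_prop)).mul ((measurable_gExt hH hg ε).comp h1)

theorem measurable_indicator_shift (hH : Measurable H) (ε : ℝ) {Φ : Space n × ℝ → ℝ≥0∞}
    (hΦ : Measurable Φ) : Measurable fun q : Space n × ℝ =>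
      (Ioi (0 : ℝ)).indicator (fun y => Φ (q.1, y)) (H q.1 + H q.1 * ε * q.2) := by
  have h1 : Measurable fun q : Space n × ℝ => (q.1, H q.1 + H q.1 * ε * q.2) :=
    measurable_fst.prodMk (by fun_prop)
  have h2 : Measurable ({q : Space n × ℝ | 0 < q.2}.indicator Φ) :=
    hΦ.indicator (measurableSet_lt measurable_const measurable_snd)
  exact h2.comp h1

theorem measurable_kernelL (hH : Measurable H) (hf : Continuous f) (hg : Continuous g) (ε : ℝ)
    (p : Param n) : Measurable fun q : Space n × ℝ => kernelL f g H ε p q.1 q.2 :=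
  (hH.comp measurable_fst).ennreal_ofReal.mul
    (measurable_indicator_shift hH ε (measurable_integrandL hH hf hg ε p))

theorem measurable_kernelMu (hH : Measurable H) (hg : Continuous g) (s ε : ℝ)
    (p : Param n) : Measurable fun q : Space n × ℝ => kernelMu f g H s ε p q.1 q.2 :=
  ((hH.comp measurable_fst).const_mul _).ennreal_ofReal.mul
    (measurable_indicator_shift hH ε (measurable_integrandMu hH hg ε p))

theorem measurable_section {Φ : Space n × ℝ → ℝ≥0∞} (hΦ : Measurable Φ) (x : Space n) :
    Measurable fun y => Φ (x, y) := hΦ.comp measurable_prodMk_left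

/-- The substitution `y = H x (1 + ε t)` has Jacobian `ε H x`, which absorbs the prefactor `1 / ε`
and leaves a kernel with a pointwise limit. Where `H` vanishes both sides are 0, on the left because
of the factor of `g`. -/
theorem profileL_eq (hH : Measurable H) (hnn : ∀ x, 0 ≤ H x) (hf : Continuous f)
    (hg : Continuous g) {ε : ℝ} (hε : 0 < ε) (p : Param n) :
    profileL f g H ε p = ∫⁻ x, ∫⁻ t, kernelL f g H ε p x t := by
  rw [profileL, ← lintegral_const_mul' _ _ ENNReal.ofReal_ne_top]
  refine lintegral_congr fun x => ?_
  rcases (hnn x).eq_or_lt with h0 | h0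
  · simp [kernelL, gExt, ← h0]
  have hm : Measurable fun y : ℝ =>
      fExt f H ε (act p.1 x + p.2.2) (p.2.1 * y) * gExt g H ε x y :=
    measurable_section (measurable_integrandL hH hf hg ε p) x
  rw [← lintegral_indicator measurableSet_Ioi,
    lintegral_affine (hm.indicator measurableSet_Ioi) (mul_pos h0 hε) (H x), ← mul_assoc,
    ← ENNReal.ofReal_mul (by positivity)]
  simp only [kernelL]
  rw [lintegral_const_mul' _ _ ENNReal.ofReal_ne_top]
  have e : 1 / ε * (H x * ε) = H x := by field_simp
  rw [e]

theorem profileDensity_eq (hH : Measurable H) (hnn : ∀ x, 0 ≤ H x)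
    (hg : Continuous g) {s ε : ℝ} (hε : 0 < ε) (p : Param n) (hp : 0 < p.2.1) (x : Space n) :
    profileDensity f g H s ε p x = ∫⁻ t, kernelMu f g H s ε p x t := by
  rw [profileDensity]
  rcases (hnn x).eq_or_lt with h0 | h0
  -- Division by zero makes the weight `y / H x ^ 3` equal to 0, which is the convention that the
  -- density is 0 at zeros of `h`.
  · simp [kernelMu, ← h0]
  have hm : Measurable fun y : ℝ =>
      ENNReal.ofReal (deriv f ((y / H x - 1) / ε) * (y / H x ^ 3)) *
      gExt g H ε (act p.1⁻¹ (x - p.2.2)) (p.2.1⁻¹ * y) :=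
    measurable_section (measurable_integrandMu hH hg ε p) x
  rw [← lintegral_indicator measurableSet_Ioi,
    lintegral_affine (hm.indicator measurableSet_Ioi) (mul_pos h0 hε) (H x), ← mul_assoc,
    ← ENNReal.ofReal_mul (by positivity)]
  simp only [kernelMu]
  rw [lintegral_const_mul' _ _ ENNReal.ofReal_ne_top]
  have e : p.2.1 ^ (s - 1) / ε * (H x * ε) = p.2.1 ^ (s - 1) * H x := by field_simp
  rw [e]

theorem measurable_profileDensity (hH : Measurable H) (hg : Continuous g) (s ε : ℝ) (p : Param n) :
    Measurable (profileDensity f g H s ε p) :=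
  (measurable_integrandMu hH hg ε p).lintegral_prod_right'.const_mul _

end Reduction
end FunctionalJohn

/-! ### Uniform majorants for the kernels. -/

namespace FunctionalJohn

variable {n : ℕ} {f g : ℝ → ℝ} {H : Space n → ℝ}

theorem exp_le_one_add_two_mul {x : ℝ} (h0 : 0 ≤ x) (h1 : x ≤ 1) : Real.exp x ≤ 1 + 2 * x := by
  have := Real.abs_exp_sub_one_le (x := x) (by rwa [abs_of_nonneg h0])
  rw [abs_of_nonneg h0] at this
  linarith [le_abs_self (Real.exp x - 1)]

/-- On the support of the factor of `g`, points stay close to the unit ball. -/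
theorem IsProfile.exists_regime (hH : IsProfile H) : ∃ L ≥ 0, ∃ c₀ > 0, ∃ η > 0, η ≤ 1 ∧
    ∀ ε B, 0 < ε → ε ≤ η → ε * B ≤ η → ∀ (x z : Space n) (y : ℝ),
      (‖x‖ ≤ 2 → ‖z - x‖ ≤ ε * B) → 0 < H x → ‖x‖ ^ 2 + y ^ 2 - 1 < 2 * ε * H x ^ 2 →
      ‖x‖ ≤ 2 ∧ ‖z‖ ≤ 2 ∧ c₀ ≤ H x ∧ c₀ ≤ H z ∧ H x ≤ Real.exp (ε * (L * B)) * H z ∧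
        H z ≤ Real.exp (ε * (L * B)) * H x ∧ y ≤ (1 + ε) * H x := by
  obtain ⟨K, hK, hHK⟩ := hH.bounded
  obtain ⟨δ, hδ, L, hL, c₀, hc₀, hlow, hlip⟩ := hH.logLipschitz
  -- The bound on `ε` gives `2 ε H ^ 2 ≤ min 1 δ`, which keeps `x` within radius `1 + min 1 δ / 2`;
  -- the bound on `ε * B` by 1/2 and `δ / 2` then keeps `z` within radii 2 and `1 + δ`.
  refine ⟨L, hL, c₀, hc₀, min (min (1 / 2) (δ / 2)) (min 1 δ / (2 * K ^ 2)), by positivity,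
    (min_le_left _ _).trans ((min_le_left _ _).trans (by norm_num)), ?_⟩
  intro ε B hε hεη hεB x z y hzx hHx hlt
  have e1 : ε * B ≤ 1 / 2 := hεB.trans ((min_le_left _ _).trans (min_le_left _ _))
  have e2 : ε * B ≤ δ / 2 := hεB.trans ((min_le_left _ _).trans (min_le_right _ _))
  have e3 : ε * (2 * K ^ 2) ≤ min 1 δ := by
    have := hεη.trans (min_le_right _ _)
    rwa [le_div_iff₀ (by positivity)] at this
  have e4 : 2 * ε * H x ^ 2 ≤ min 1 δ := by
    have : H x ^ 2 ≤ K ^ 2 := by have := hHK x; gcongr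
    nlinarith
  have hm1 : min 1 δ ≤ 1 := min_le_left _ _
  have hm2 : min 1 δ ≤ δ := min_le_right _ _
  have hm0 : 0 < min 1 δ := by positivity
  have hx : ‖x‖ ≤ 1 + min 1 δ / 2 := by
    refine le_of_sq_le_sq ?_ (by positivity)
    nlinarith [sq_nonneg y]
  have hzx' := hzx (by linarith)
  have hz : ‖z‖ ≤ ‖x‖ + ε * B := by
    have := norm_add_le x (z - x)
    rw [add_sub_cancel] at this
    linarith
  have hx1 : ‖x‖ ≤ 1 + δ := by linarith
  have hz1 : ‖z‖ ≤ 1 + δ := by linarith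
  have hexp : Real.exp (L * ‖z - x‖) ≤ Real.exp (ε * (L * B)) := by
    rw [Real.exp_le_exp]; nlinarith
  refine ⟨by linarith, by linarith, hlow x hx1, hlow z hz1, ?_, ?_, ?_⟩
  · have h1 := hlip x z hx1 hz1
    rw [norm_sub_rev] at h1
    exact h1.trans (mul_le_mul_of_nonneg_right hexp (hH.nonneg z))
  · exact (hlip z x hz1 hx1).trans (mul_le_mul_of_nonneg_right hexp (hH.nonneg x))
  -- `y ^ 2 < 1 - ‖x‖ ^ 2 + 2 ε H ^ 2 ≤ (1 + 2 ε) H ^ 2 ≤ ((1 + ε) H) ^ 2`.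
  · refine le_of_sq_le_sq ?_ (by positivity)
    have := hH.le_sq x
    nlinarith [sq_nonneg (ε * H x)]

theorem lt_of_gExt_ne_zero (hH : IsProfile H) (hg : PropG g) {ε : ℝ} (hε : 0 < ε) {x : Space n}
    {y : ℝ} (h : gExt g H ε x y ≠ 0) : 0 < H x ∧ ‖x‖ ^ 2 + y ^ 2 - 1 < 2 * ε * H x ^ 2 := by
  unfold gExt at h
  split_ifs at h with h0
  · exact absurd rfl h
  have hp : 0 < H x := lt_of_le_of_ne (hH.nonneg x) (Ne.symm h0)
  refine ⟨hp, ?_⟩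
  by_contra! hcon
  refine h ?_
  rw [hg.eq_zero, ENNReal.ofReal_zero]
  rw [le_div_iff₀ hε, le_div_iff₀ (by positivity)]
  linarith

theorem gExt_le_one (hg : PropG g) (ε : ℝ) (x : Space n) (y : ℝ) : gExt g H ε x y ≤ 1 := by
  unfold gExt
  split_ifs
  · exact zero_le
  · exact ENNReal.ofReal_le_one.2 (hg.le_one _)

/-- The factor of `g` confines `x` to a ball and gives `t ≤ 1`. The factor of `f` is nonzero only if
`α y / H (Ax + v) > 1 - ε`, and since `α` and `H x / H (Ax + v)` are at most `exp (O(ε))`, this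
bounds `t` from below. The resulting box does not depend on `ε`. -/
theorem kernelL_le (hH : IsProfile H) (hf : PropF f) (hg : PropG g) {B : ℝ} (hB : 0 ≤ B) :
    ∃ C : ℝ, ∃ ε₀ > 0, ∀ (ε : ℝ) (p : Param n), 0 < ε → ε ≤ ε₀ →
      (∀ x, ‖x‖ ≤ 2 → ‖act p.1 x + p.2.2 - x‖ ≤ ε * B) → 0 < p.2.1 → p.2.1 ≤ Real.exp (ε * B) →
      ∀ x t, kernelL f g H ε p x t ≤
        (Metric.closedBall (0 : Space n) 2 ×ˢ Icc (-C) C).indicator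
          (fun _ => ENNReal.ofReal C) (x, t) := by
  obtain ⟨L, hL, c₀, hc₀, η, hη, hη1, hreg⟩ := hH.exists_regime
  obtain ⟨K, hK, hHK⟩ := hH.bounded
  -- `exp (ε * C₃)` bounds `α * H x / H (Ax + v)`: `B` comes from `α`, and `L * B` from the
  -- log-Lipschitz estimate.
  set C₃ := B + L * B with hC₃
  have hC₃0 : 0 ≤ C₃ := by positivity
  have hV := hf.nonneg (2 * (C₃ + 1))
  have hKV : 0 ≤ K * f (2 * (C₃ + 1)) := by positivity
  refine ⟨C₃ + 1 + K * f (2 * (C₃ + 1)), min η (min (η / (B + 1)) (1 / (C₃ + 1))),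
    by positivity, ?_⟩
  intro ε p hε hε₀ hact hα hαB x t
  by_cases hzero : kernelL f g H ε p x t = 0
  · rw [hzero]; exact zero_le
  have e1 : ε ≤ η := hε₀.trans (min_le_left _ _)
  have e2 : ε * (B + 1) ≤ η := by
    have := hε₀.trans ((min_le_right _ _).trans (min_le_left _ _))
    rwa [le_div_iff₀ (by positivity)] at this
  have e3 : ε * (C₃ + 1) ≤ 1 := by
    have := hε₀.trans ((min_le_right _ _).trans (min_le_right _ _))
    rwa [le_div_iff₀ (by positivity)] at this
  simp only [kernelL, mul_eq_zero, not_or] at hzero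
  set y := H x + H x * ε * t with hy
  obtain ⟨hHx0, hind⟩ := hzero
  have hy0 : 0 < y := by
    by_contra hcon
    exact hind (indicator_of_notMem (by simpa using hcon) _)
  have hy0' : y ∈ Ioi (0 : ℝ) := hy0
  rw [indicator_of_mem hy0', mul_eq_zero, not_or] at hind
  obtain ⟨hf0, hg0⟩ := hind
  obtain ⟨hHx, hlt⟩ := lt_of_gExt_ne_zero hH hg hε hg0
  set z := act p.1 x + p.2.2 with hz
  obtain ⟨hx2, -, -, hHz, hxz, -, hyx⟩ := hreg ε B hε e1 (by linarith) x z y (hact x) hHx hlt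
  have hHz0 : 0 < H z := hc₀.trans_le hHz
  have hyt : y = H x * (1 + ε * t) := by rw [hy]; ring
  have ht1 : t ≤ 1 := by
    rw [hyt, mul_comm (1 + ε)] at hyx
    have := le_of_mul_le_mul_left hyx hHx
    nlinarith
  have h1t : 0 < 1 + ε * t := by
    rw [hyt] at hy0; exact pos_of_mul_pos_right hy0 hHx.le
  have hf0' : f ((p.2.1 * y / H z - 1) / ε) ≠ 0 := by
    intro hcon
    apply hf0
    rw [fExt, if_neg hHz0.ne', hcon, ENNReal.ofReal_zero]
  have hgt : -1 < (p.2.1 * y / H z - 1) / ε := by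
    by_contra! hcon
    exact hf0' (hf.eq_zero _ hcon)
  set a := p.2.1 * y / H z with ha
  rw [lt_div_iff₀ hε] at hgt
  have haw : a ≤ Real.exp (ε * C₃) * (1 + ε * t) := by
    rw [ha, div_le_iff₀ hHz0, hyt]
    calc p.2.1 * (H x * (1 + ε * t)) ≤
        Real.exp (ε * B) * ((Real.exp (ε * (L * B)) * H z) * (1 + ε * t)) := by gcongr
      _ = _ := by rw [hC₃, mul_add ε, Real.exp_add]; ring
  have hlow : -(C₃ + 1) ≤ t := by
    have h1 : Real.exp (-(ε * C₃)) * (1 - ε) ≤ 1 + ε * t := by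
      calc _ ≤ Real.exp (-(ε * C₃)) * (Real.exp (ε * C₃) * (1 + ε * t)) := by
            gcongr; linarith
        _ = _ := by rw [← mul_assoc, ← Real.exp_add]; simp
    have h2 := Real.add_one_le_exp (-(ε * C₃))
    have h3 : (1 - ε * C₃) * (1 - ε) ≤ 1 + ε * t := by
      refine le_trans (mul_le_mul_of_nonneg_right ?_ (by linarith)) h1
      linarith
    have h4 : 0 ≤ ε * (t + (C₃ + 1)) := by nlinarith [mul_nonneg hε.le (mul_nonneg hε.le hC₃0)]
    have := nonneg_of_mul_nonneg_right h4 hε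
    linarith
  have hup : (a - 1) / ε ≤ 2 * (C₃ + 1) := by
    rw [div_le_iff₀ hε]
    have h1 : a ≤ Real.exp (ε * (C₃ + 1)) := by
      refine haw.trans ?_
      rw [mul_add ε C₃ 1, Real.exp_add, mul_one]
      gcongr
      have := Real.add_one_le_exp ε
      nlinarith
    have h2 := exp_le_one_add_two_mul (by positivity) e3
    linarith
  have hmem : (x, t) ∈ Metric.closedBall (0 : Space n) 2 ×ˢ
      Icc (-(C₃ + 1 + K * f (2 * (C₃ + 1)))) (C₃ + 1 + K * f (2 * (C₃ + 1))) := by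
    refine ⟨by simpa using hx2, ?_, ?_⟩ <;> simp only <;> linarith
  rw [indicator_of_mem hmem, kernelL, ← hy, indicator_of_mem hy0', ← hz]
  calc _ ≤ ENNReal.ofReal K * (ENNReal.ofReal (f (2 * (C₃ + 1))) * 1) := by
        gcongr
        · exact hHK x
        · rw [fExt, if_neg hHz0.ne']
          exact ENNReal.ofReal_le_ofReal (hf.monotone hup)
        · exact gExt_le_one hg _ _ _
    _ = ENNReal.ofReal (K * f (2 * (C₃ + 1))) := by rw [mul_one, ENNReal.ofReal_mul hK.le]
    _ ≤ _ := ENNReal.ofReal_le_ofReal (by linarith)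

/-- The roles are exchanged compared with `kernelL_le`: the argument of `f'` is exactly `t`, which
gives `t ≥ -1`, and the factor of `g`, evaluated at the preimage `A⁻¹ (x - v)`, gives the upper
bound on `t`. -/
theorem kernelMu_le (hH : IsProfile H) (hf : PropF f) (hg : PropG g) {B : ℝ} (hB : 0 ≤ B) (s : ℝ) :
    ∃ C : ℝ, ∃ ε₀ > 0, ∀ (ε : ℝ) (p : Param n), 0 < ε → ε ≤ ε₀ → p.1.det ≠ 0 →
      (∀ x, ‖x‖ ≤ 2 → ‖act p.1 x + p.2.2 - x‖ ≤ ε * B) → 0 < p.2.1 → p.2.1 ≤ Real.exp (ε * B) →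
      p.2.1 ^ (s - 1) ≤ 2 →
      ∀ x t, kernelMu f g H s ε p x t ≤
        (Metric.closedBall (0 : Space n) 2 ×ˢ Icc (-C) C).indicator
          (fun _ => ENNReal.ofReal C) (x, t) := by
  obtain ⟨L, hL, c₀, hc₀, η, hη, hη1, hreg⟩ := hH.exists_regime
  set C₃ := B + L * B with hC₃
  have hC₃0 : 0 ≤ C₃ := by positivity
  set T := 2 * (C₃ + 1) with hT
  have hV := hf.nonneg (T + 2)
  have hKV : 0 ≤ 2 * f (T + 2) * 3 / c₀ ^ 2 := by positivity
  refine ⟨T + (2 * (f (T + 2) * (3 / c₀))), min η (min (η / (B + 1)) (1 / (C₃ + 1))),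
    by positivity, ?_⟩
  intro ε p hε hε₀ hdet hact hα hαB hαs x t
  by_cases hzero : kernelMu f g H s ε p x t = 0
  · rw [hzero]; exact zero_le
  have e1 : ε ≤ η := hε₀.trans (min_le_left _ _)
  have e2 : ε * (B + 1) ≤ η := by
    have := hε₀.trans ((min_le_right _ _).trans (min_le_left _ _))
    rwa [le_div_iff₀ (by positivity)] at this
  have e3 : ε * (C₃ + 1) ≤ 1 := by
    have := hε₀.trans ((min_le_right _ _).trans (min_le_right _ _))
    rwa [le_div_iff₀ (by positivity)] at this
  simp only [kernelMu, mul_eq_zero, not_or] at hzero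
  set y := H x + H x * ε * t with hy
  obtain ⟨hHx0, hind⟩ := hzero
  have hy0 : 0 < y := by
    by_contra hcon
    exact hind (indicator_of_notMem (by simpa using hcon) _)
  have hy0' : y ∈ Ioi (0 : ℝ) := hy0
  rw [indicator_of_mem hy0', mul_eq_zero, not_or] at hind
  obtain ⟨hf0, hg0⟩ := hind
  obtain ⟨hHx', hlt⟩ := lt_of_gExt_ne_zero hH hg hε hg0
  set x' := act p.1⁻¹ (x - p.2.2) with hx'
  have hx'x : act p.1 x' + p.2.2 = x := by rw [hx', act_act_inv hdet, sub_add_cancel]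
  obtain ⟨-, hx2, -, hHx, -, hxx', hyx⟩ := hreg ε B hε e1 (by linarith) x' x (p.2.1⁻¹ * y)
    (fun hx => by have := hact x' hx; rwa [hx'x] at this) hHx' hlt
  obtain ⟨-, -, -, -, hx'x2, -, -⟩ := hreg ε B hε e1 (by linarith) x' x (p.2.1⁻¹ * y)
    (fun hx => by have := hact x' hx; rwa [hx'x] at this) hHx' hlt
  have hHx0 : 0 < H x := hc₀.trans_le hHx
  have hyt : y = H x * (1 + ε * t) := by rw [hy]; ring
  have harg : (y / H x - 1) / ε = t := by rw [hyt]; field_simp; ring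
  rw [harg] at hf0
  have ht1 : -1 ≤ t := by
    by_contra! hcon
    apply hf0
    rw [hf.deriv_eq_zero hcon, zero_mul, ENNReal.ofReal_zero]
  have h1t : 1 + ε * t ≤ Real.exp (ε * (C₃ + 1)) := by
    rw [inv_mul_le_iff₀ hα, hyt] at hyx
    have : H x * (1 + ε * t) ≤ H x * Real.exp (ε * (C₃ + 1)) := by
      calc _ ≤ p.2.1 * ((1 + ε) * H x') := hyx
        _ ≤ Real.exp (ε * B) * (Real.exp ε * (Real.exp (ε * (L * B)) * H x)) := by
          have := Real.add_one_le_exp ε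
          gcongr
          linarith
        _ = _ := by
          rw [hC₃, mul_add ε, mul_add ε, Real.exp_add, Real.exp_add, mul_one]; ring
    exact le_of_mul_le_mul_left this hHx0
  have h2 := exp_le_one_add_two_mul (by positivity) e3
  have htT : t ≤ T := by
    have : ε * t ≤ ε * T := by rw [hT]; linarith
    exact le_of_mul_le_mul_left this hε
  have h1t' : 1 + ε * t ≤ 3 := by linarith
  have hT1 : 1 ≤ T := by rw [hT]; linarith
  have hpos3 : 0 ≤ 2 * (f (T + 2) * (3 / c₀)) := by positivity
  have hmem : (x, t) ∈ Metric.closedBall (0 : Space n) 2 ×ˢ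
      Icc (-(T + (2 * (f (T + 2) * (3 / c₀))))) (T + (2 * (f (T + 2) * (3 / c₀)))) := by
    refine ⟨by simpa using hx2, ?_, ?_⟩ <;> simp only <;> linarith
  rw [indicator_of_mem hmem, kernelMu, ← hy, indicator_of_mem hy0', ← hx', harg]
  have hαs0 : 0 ≤ p.2.1 ^ (s - 1) := by positivity
  calc _ ≤ ENNReal.ofReal (p.2.1 ^ (s - 1) * H x) *
        (ENNReal.ofReal (deriv f t * (y / H x ^ 3)) * 1) := by
        gcongr
        exact gExt_le_one hg _ _ _
    _ = ENNReal.ofReal (p.2.1 ^ (s - 1) * (deriv f t * ((1 + ε * t) / H x))) := by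
        rw [mul_one, ← ENNReal.ofReal_mul (by positivity), hyt]
        congr 1
        field_simp
    _ ≤ _ := by
        refine ENNReal.ofReal_le_ofReal ?_
        have h3 : (1 + ε * t) / H x ≤ 3 / c₀ := by gcongr
        have h4 := hf.deriv_le htT
        have h5 := hf.deriv_nonneg t
        have h6 : 0 ≤ (1 + ε * t) / H x := by
          rw [hyt] at hy0
          have := pos_of_mul_pos_right hy0 hHx0.le
          positivity
        have : p.2.1 ^ (s - 1) * (deriv f t * ((1 + ε * t) / H x)) ≤
            2 * (f (T + 2) * (3 / c₀)) := by gcongr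
        linarith

end FunctionalJohn

/-! ### First order expansions and pointwise limits of the kernels. -/

namespace FunctionalJohn

variable {n : ℕ} {f g : ℝ → ℝ} {H : Space n → ℝ}

/-- The curve `(Id ⊕ 1, 0) + ε m`. -/
noncomputable def curve (ε : ℝ) (m : Param n) : Param n := idParam n + ε • m

theorem curve_fst (ε : ℝ) (m : Param n) : (curve ε m).1 = 1 + ε • m.1 := rfl

theorem curve_snd_fst (ε : ℝ) (m : Param n) : (curve ε m).2.1 = 1 + ε * m.2.1 := rfl

theorem curve_snd_snd (ε : ℝ) (m : Param n) : (curve ε m).2.2 = ε • m.2.2 := by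
  simp [curve, idParam]

theorem act_curve (ε : ℝ) (m : Param n) (x : Space n) :
    act (curve ε m).1 x + (curve ε m).2.2 = x + ε • (act m.1 x + m.2.2) := by
  rw [curve_fst, curve_snd_snd, act_add_left, act_one, act_smul_left, smul_add, add_assoc]

/-- The argument of `F` in terms of `H = h ^ (1 / s)`. -/
noncomputable def profileSlope (H : Space n → ℝ) (m : Param n) (x : Space n) : ℝ :=
  inner ℝ x (act m.1 x + m.2.2) / H x ^ 2 + m.2.1

/-- The contact set in terms of `H = h ^ (1 / s)`. -/
def profileContact (H : Space n → ℝ) : Set (Space n) := {x | H x ^ 2 = 1 - ‖x‖ ^ 2}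

section Limits

variable {ι : Type*} {l : Filter ι} {ε : ι → ℝ}

/-- Convergence of `(a - 1) / ε` to `a'` encodes `a = 1 + ε a' + o(ε)`. In the calculus of such
expansions, first order terms add under products and change sign under inversion. -/
theorem tendsto_one_of_firstOrder (hε : Tendsto ε l (𝓝[>] 0)) {a : ι → ℝ} {a' : ℝ}
    (ha : Tendsto (fun i => (a i - 1) / ε i) l (𝓝 a')) : Tendsto a l (𝓝 1) := by
  have h1 := ((tendsto_nhds_of_tendsto_nhdsWithin hε).mul ha).const_add 1
  rw [zero_mul, add_zero] at h1
  refine h1.congr' ?_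
  filter_upwards [hε self_mem_nhdsWithin] with i hi
  have : ε i ≠ 0 := (mem_Ioi.1 hi).ne'
  field_simp
  ring

theorem firstOrder_mul (hε : Tendsto ε l (𝓝[>] 0)) {a b : ι → ℝ} {a' b' : ℝ}
    (ha : Tendsto (fun i => (a i - 1) / ε i) l (𝓝 a'))
    (hb : Tendsto (fun i => (b i - 1) / ε i) l (𝓝 b')) :
    Tendsto (fun i => (a i * b i - 1) / ε i) l (𝓝 (a' + b')) := by
  have h1 := (ha.mul (tendsto_one_of_firstOrder hε hb)).add hb
  rw [mul_one] at h1
  exact h1.congr fun i => by ring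

theorem firstOrder_inv (hε : Tendsto ε l (𝓝[>] 0)) {a : ι → ℝ} {a' : ℝ}
    (ha : Tendsto (fun i => (a i - 1) / ε i) l (𝓝 a')) :
    Tendsto (fun i => ((a i)⁻¹ - 1) / ε i) l (𝓝 (-a')) := by
  have h0 := tendsto_one_of_firstOrder hε ha
  have h1 := (ha.neg).mul (h0.inv₀ one_ne_zero)
  rw [inv_one, mul_one] at h1
  refine h1.congr' ?_
  filter_upwards [h0.eventually_ne one_ne_zero] with i hi
  field_simp
  ring

theorem firstOrder_affine (hε : Tendsto ε l (𝓝[>] 0)) {b : ι → ℝ} {b' : ℝ}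
    (hb : Tendsto b l (𝓝 b')) : Tendsto (fun i => (1 + ε i * b i - 1) / ε i) l (𝓝 b') := by
  refine hb.congr' ?_
  filter_upwards [hε self_mem_nhdsWithin] with i hi
  have : ε i ≠ 0 := (mem_Ioi.1 hi).ne'
  field_simp
  ring

/-- The direction may vary with the index; this is needed because the parameters and the preimages
`A⁻¹ (x - v)` move with `ε`. -/
theorem tendsto_difference_quotient {E F : Type*} [NormedAddCommGroup E] [NormedSpace ℝ E]
    [NormedAddCommGroup F] [NormedSpace ℝ F] {φ : E → F} {φ' : E →L[ℝ] F} {x : E}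
    (hφ : HasFDerivAt φ φ' x) (hε : Tendsto ε l (𝓝[>] 0)) {u : ι → E} {u' : E}
    (hu : Tendsto u l (𝓝 u')) :
    Tendsto (fun i => (ε i)⁻¹ • (φ (x + ε i • u i) - φ x)) l (𝓝 (φ' u')) := by
  have h0 := (tendsto_nhds_of_tendsto_nhdsWithin hε).smul hu
  rw [zero_smul] at h0
  refine hφ.hasFDerivWithinAt.lim (s := univ) h0 (by simp) (hu.congr' ?_)
  filter_upwards [hε self_mem_nhdsWithin] with i hi
  rw [inv_smul_smul₀ (mem_Ioi.1 hi).ne']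

theorem tendsto_add_smul (hε : Tendsto ε l (𝓝[>] 0)) {E : Type*} [NormedAddCommGroup E]
    [NormedSpace ℝ E] {u : ι → E} {u' : E} (hu : Tendsto u l (𝓝 u')) (x : E) :
    Tendsto (fun i => x + ε i • u i) l (𝓝 x) := by
  have h0 := ((tendsto_nhds_of_tendsto_nhdsWithin hε).smul hu).const_add x
  simpa using h0

/-- First order expansion of `H x / H (x + ε u)` at a contact point. -/
theorem IsProfile.firstOrder_div (hH : IsProfile H) {x : Space n} (hx : x ∈ profileContact H)
    (hε : Tendsto ε l (𝓝[>] 0)) {u : ι → Space n} {u' : Space n} (hu : Tendsto u l (𝓝 u')) :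
    Tendsto (fun i => (H x / H (x + ε i • u i) - 1) / ε i) l (𝓝 (inner ℝ x u' / H x ^ 2)) := by
  have hp : 0 < H x := hH.pos_of_norm_le (hH.norm_lt_one hx).le
  have h1 := tendsto_difference_quotient (hH.hasFDerivAt hx) hε hu
  have h2 : Tendsto (fun i => H (x + ε i • u i)) l (𝓝 (H x)) :=
    (hH.hasFDerivAt hx).continuousAt.tendsto.comp (tendsto_add_smul hε hu x)
  have h3 := h1.neg.mul (h2.inv₀ hp.ne')
  have e : -(-(H x)⁻¹ • innerSL ℝ x) u' * (H x)⁻¹ = inner ℝ x u' / H x ^ 2 := by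
    simp only [FunLike.coe_smul, Pi.smul_apply, smul_eq_mul, innerSL_apply_apply]
    field_simp
  rw [e] at h3
  refine h3.congr' ?_
  filter_upwards [h2.eventually_ne hp.ne'] with i hi
  rw [smul_eq_mul]
  field_simp
  ring

theorem firstOrder_norm_sq (hε : Tendsto ε l (𝓝[>] 0)) {u : ι → Space n} {u' : Space n}
    (hu : Tendsto u l (𝓝 u')) (x : Space n) :
    Tendsto (fun i => (‖x + ε i • u i‖ ^ 2 - ‖x‖ ^ 2) / ε i) l (𝓝 (2 * inner ℝ x u')) := by
  have h1 := tendsto_difference_quotient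
    (hasStrictFDerivAt_norm_sq (F := Space n) x).hasFDerivAt hε hu
  simp only [FunLike.coe_smul, Pi.smul_apply, innerSL_apply_apply, smul_eq_mul] at h1
  rw [nsmul_eq_mul] at h1
  exact h1.congr fun i => by rw [div_eq_inv_mul]

/-- The factor of `g` vanishes eventually at the points where `H` is larger than the height
function of the ball. -/
theorem IsProfile.gExt_eventually_eq_zero (hH : IsProfile H) (hg : PropG g) {x : Space n}
    (hx : x ∉ profileContact H) (hε : Tendsto ε l (𝓝[>] 0)) {z : ι → Space n} {y : ι → ℝ}
    (hz : Tendsto z l (𝓝 x)) (hy : Tendsto y l (𝓝 (H x))) :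
    ∀ᶠ i in l, gExt g H (ε i) (z i) (y i) = 0 := by
  obtain ⟨K, hK, hHK⟩ := hH.bounded
  have h0 : 0 < ‖x‖ ^ 2 + H x ^ 2 - 1 := by
    have h1 := hH.le_sq x
    have h2 : H x ^ 2 ≠ 1 - ‖x‖ ^ 2 := hx
    have := lt_of_le_of_ne h1 h2.symm
    linarith
  have h1 : Tendsto (fun i => ‖z i‖ ^ 2 + y i ^ 2 - 1) l (𝓝 (‖x‖ ^ 2 + H x ^ 2 - 1)) :=
    ((hz.norm.pow 2).add (hy.pow 2)).sub_const 1
  have h2 : Tendsto (fun i => 2 * ε i * K ^ 2) l (𝓝 (2 * 0 * K ^ 2)) :=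
    ((tendsto_nhds_of_tendsto_nhdsWithin hε).const_mul 2).mul_const _
  have h3 := h2.eventually_lt h1 (by simpa using h0)
  filter_upwards [h3, hε self_mem_nhdsWithin] with i hi hεi
  by_contra hcon
  have h4 := (lt_of_gExt_ne_zero hH hg hεi hcon).2
  -- Off the contact set `H (z i)` is not known to converge to `H x`, so the global bound `K` is
  -- used.
  have h5 : H (z i) ^ 2 ≤ K ^ 2 := by
    have := hHK (z i); have := hH.nonneg (z i); gcongr
  have h6 : 0 < ε i := hεi
  nlinarith

/-- Contact means `‖x‖ ^ 2 + H x ^ 2 = 1`, so the zeroth order terms cancel and the numerator is `2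
ε (⟨x, u'⟩ + b' H x ^ 2) + o(ε)`. -/
theorem IsProfile.tendsto_gExt (hH : IsProfile H) (hg : PropG g) {x : Space n}
    (hx : x ∈ profileContact H) (hε : Tendsto ε l (𝓝[>] 0)) {u : ι → Space n} {u' : Space n}
    (hu : Tendsto u l (𝓝 u')) {b : ι → ℝ} {b' : ℝ}
    (hb : Tendsto (fun i => (b i - 1) / ε i) l (𝓝 b')) :
    Tendsto (fun i => gExt g H (ε i) (x + ε i • u i) (b i * H x)) l
      (𝓝 (ENNReal.ofReal (g (inner ℝ x u' / H x ^ 2 + b')))) := by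
  have hp : 0 < H x := hH.pos_of_norm_le (hH.norm_lt_one hx).le
  have h2 : Tendsto (fun i => H (x + ε i • u i)) l (𝓝 (H x)) :=
    (hH.hasFDerivAt hx).continuousAt.tendsto.comp (tendsto_add_smul hε hu x)
  have h3 := firstOrder_norm_sq hε hu x
  have h4 := ((firstOrder_mul hε hb hb).mul_const (H x ^ 2))
  have h5 := (h3.add h4).div ((h2.pow 2).const_mul 2) (by positivity)
  have e : (2 * inner ℝ x u' + (b' + b') * H x ^ 2) / (2 * H x ^ 2) =
      inner ℝ x u' / H x ^ 2 + b' := by field_simp; ring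
  rw [e] at h5
  refine (ENNReal.tendsto_ofReal ((hg.continuous.tendsto _).comp h5)).congr' ?_
  filter_upwards [h2.eventually_ne hp.ne', hε self_mem_nhdsWithin] with i hi hεi
  have hεi' : ε i ≠ 0 := (mem_Ioi.1 hεi).ne'
  rw [gExt, if_neg hi, Function.comp_apply]
  congr 2
  have hx' : ‖x‖ ^ 2 = 1 - H x ^ 2 := by have : H x ^ 2 = 1 - ‖x‖ ^ 2 := hx; linarith
  simp only [Pi.div_apply]
  rw [hx']
  field_simp
  ring

variable {m : ι → Param n} {m' : Param n}

theorem tendsto_displacement (hm : Tendsto m l (𝓝 m')) {z : ι → Space n} {x : Space n}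
    (hz : Tendsto z l (𝓝 x)) :
    Tendsto (fun i => act (m i).1 (z i) + (m i).2.2) l (𝓝 (act m'.1 x + m'.2.2)) := by
  have h1 : Tendsto (fun i => (m i).1) l (𝓝 m'.1) := (continuous_fst.tendsto m').comp hm
  have h2 : Tendsto (fun i => (m i).2.2) l (𝓝 m'.2.2) :=
    ((continuous_snd.comp continuous_snd).tendsto m').comp hm
  exact ((continuous_act.tendsto (m'.1, x)).comp (h1.prodMk_nhds hz)).add h2

theorem tendsto_snd_fst (hm : Tendsto m l (𝓝 m')) :
    Tendsto (fun i => (m i).2.1) l (𝓝 m'.2.1) :=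
  ((continuous_fst.comp continuous_snd).tendsto m').comp hm

/-- At a contact point the argument of `f` comes from the product `(1 + ε β)(1 + ε t) H x / H (Ax +
v)`, whose first order terms add up to `t` plus the slope. The factor of `g` sees the undisplaced
`x`, so its argument tends to `t`. -/
theorem tendsto_kernelL (hH : IsProfile H) (hf : PropF f) (hg : PropG g)
    (hε : Tendsto ε l (𝓝[>] 0)) (hm : Tendsto m l (𝓝 m')) (x : Space n) (t : ℝ) :
    Tendsto (fun i => kernelL f g H (ε i) (curve (ε i) (m i)) x t) l
      (𝓝 ((profileContact H).indicator
        (fun x => ENNReal.ofReal (H x) *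
          ENNReal.ofReal (f (t + profileSlope H m' x) * g t)) x)) := by
  have hε0 := tendsto_nhds_of_tendsto_nhdsWithin hε
  have hb : Tendsto (fun i => (1 + ε i * t - 1) / ε i) l (𝓝 t) :=
    firstOrder_affine hε tendsto_const_nhds
  have hb1 := tendsto_one_of_firstOrder hε hb
  have hyeq : ∀ i, H x + H x * ε i * t = (1 + ε i * t) * H x := fun i => by ring
  have hy : Tendsto (fun i => (1 + ε i * t) * H x) l (𝓝 (H x)) := by
    simpa using hb1.mul_const (H x)
  by_cases hx : x ∈ profileContact H
  · rw [indicator_of_mem hx]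
    have hp : 0 < H x := hH.pos_of_norm_le (hH.norm_lt_one hx).le
    have hu := tendsto_displacement hm (tendsto_const_nhds (x := x) (f := l))
    have h1 := hH.firstOrder_div hx hε hu
    have h2 := firstOrder_mul hε (firstOrder_mul hε
      (firstOrder_affine hε (tendsto_snd_fst hm)) hb) h1
    have hz : Tendsto (fun i => H (x + ε i • (act (m i).1 x + (m i).2.2))) l (𝓝 (H x)) :=
      (hH.hasFDerivAt hx).continuousAt.tendsto.comp (tendsto_add_smul hε hu x)
    have h3 := ENNReal.tendsto_ofReal ((hf.continuous.tendsto _).comp h2)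
    have h4 := hH.tendsto_gExt hg hx hε (tendsto_const_nhds (x := (0 : Space n))) hb
    simp only [smul_zero, add_zero, inner_zero_right, zero_div, zero_add] at h4
    have h5 := ENNReal.Tendsto.const_mul (a := ENNReal.ofReal (H x))
      (ENNReal.Tendsto.mul h3 (Or.inr ENNReal.ofReal_ne_top) h4 (Or.inr ENNReal.ofReal_ne_top))
      (Or.inr ENNReal.ofReal_ne_top)
    rw [← ENNReal.ofReal_mul (hf.nonneg _)] at h5
    have e : m'.2.1 + t + inner ℝ x (act m'.1 x + m'.2.2) / H x ^ 2 = t + profileSlope H m' x := by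
      rw [profileSlope]; ring
    rw [e] at h5
    refine h5.congr' ?_
    filter_upwards [hy.eventually_const_lt hp, hz.eventually_ne hp.ne'] with i hi hzi
    have hi' : (1 + ε i * t) * H x ∈ Ioi (0 : ℝ) := hi
    rw [kernelL, hyeq, indicator_of_mem hi', act_curve, fExt, if_neg hzi, curve_snd_fst]
    congr 4
    rw [Function.comp_apply]
    congr 3
    ring
  · rw [indicator_of_notMem hx]
    refine tendsto_const_nhds.congr' ?_
    filter_upwards [hH.gExt_eventually_eq_zero hg hx hε (tendsto_const_nhds (x := x)) hy] with i hi
    rw [kernelL, hyeq]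
    simp [indicator_apply, hi]

theorem tendsto_act_inv (hε : Tendsto ε l (𝓝[>] 0)) (hm : Tendsto m l (𝓝 m')) (x : Space n) :
    (∀ᶠ i in l, (curve (ε i) (m i)).1.det ≠ 0) ∧
    Tendsto (fun i => act (curve (ε i) (m i)).1⁻¹ (x - (curve (ε i) (m i)).2.2)) l (𝓝 x) := by
  have hε0 := tendsto_nhds_of_tendsto_nhdsWithin hε
  have hA : Tendsto (fun i => (curve (ε i) (m i)).1) l (𝓝 1) := by
    have h1 : Tendsto (fun i => (m i).1) l (𝓝 m'.1) := (continuous_fst.tendsto m').comp hm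
    have := (hε0.smul h1).const_add (1 : Matrix (Fin n) (Fin n) ℝ)
    simpa [curve_fst] using this
  have hv : Tendsto (fun i => (curve (ε i) (m i)).2.2) l (𝓝 0) := by
    have h2 : Tendsto (fun i => (m i).2.2) l (𝓝 m'.2.2) :=
      ((continuous_snd.comp continuous_snd).tendsto m').comp hm
    have := hε0.smul h2
    simpa [curve_snd_snd] using this
  have hdet : Tendsto (fun i => (curve (ε i) (m i)).1.det) l (𝓝 1) := by
    have := ((continuous_id.matrix_det).tendsto (1 : Matrix (Fin n) (Fin n) ℝ)).comp hA
    simpa [Function.comp_def] using this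
  have hinv : Tendsto (fun i => (curve (ε i) (m i)).1⁻¹) l (𝓝 1) := by
    have h1 := ((continuous_id.matrix_adjugate).tendsto (1 : Matrix (Fin n) (Fin n) ℝ)).comp hA
    have h2 := (hdet.inv₀ one_ne_zero).smul h1
    simpa [Matrix.inv_def, Matrix.adjugate_one] using h2
  refine ⟨hdet.eventually_ne one_ne_zero, ?_⟩
  have h3 := (continuous_act.tendsto ((1 : Matrix (Fin n) (Fin n) ℝ), x - 0)).comp
    (hinv.prodMk_nhds (hv.const_sub x))
  simpa [act_one, Function.comp_def] using h3

/-- The preimage `A⁻¹ (x - v)` displaces `x` by `-ε (Mx + w) + o(ε)` and `α⁻¹` contributes `-β`, so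
the slope enters `g` with a minus sign. The argument of `f'` stays equal to `t`, so no continuity of
`f'` is needed. -/
theorem tendsto_kernelMu (hH : IsProfile H) (hf : PropF f) (hg : PropG g) (s : ℝ)
    (hε : Tendsto ε l (𝓝[>] 0)) (hm : Tendsto m l (𝓝 m')) (x : Space n) (t : ℝ) :
    Tendsto (fun i => kernelMu f g H s (ε i) (curve (ε i) (m i)) x t) l
      (𝓝 ((profileContact H).indicator
        (fun x => ENNReal.ofReal (1 / H x) *
          ENNReal.ofReal (deriv f t * g (t - profileSlope H m' x))) x)) := by
  have hε0 := tendsto_nhds_of_tendsto_nhdsWithin hε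
  have hb : Tendsto (fun i => (1 + ε i * t - 1) / ε i) l (𝓝 t) :=
    firstOrder_affine hε tendsto_const_nhds
  have hb1 := tendsto_one_of_firstOrder hε hb
  have hyeq : ∀ i, H x + H x * ε i * t = (1 + ε i * t) * H x := fun i => by ring
  have hy : Tendsto (fun i => (1 + ε i * t) * H x) l (𝓝 (H x)) := by
    simpa using hb1.mul_const (H x)
  have hα := firstOrder_affine hε (tendsto_snd_fst hm)
  have hα1 := tendsto_one_of_firstOrder hε hα
  have hαb := firstOrder_mul hε (firstOrder_inv hε hα) hb
  have hαb1 := tendsto_one_of_firstOrder hε hαb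
  have hyα : Tendsto (fun i => (1 + ε i * (m i).2.1)⁻¹ * (1 + ε i * t) * H x) l (𝓝 (H x)) := by
    simpa using hαb1.mul_const (H x)
  obtain ⟨hdet, hz⟩ := tendsto_act_inv hε hm x
  by_cases hx : x ∈ profileContact H
  · rw [indicator_of_mem hx]
    have hp : 0 < H x := hH.pos_of_norm_le (hH.norm_lt_one hx).le
    set z := fun i => act (curve (ε i) (m i)).1⁻¹ (x - (curve (ε i) (m i)).2.2) with hzdef
    have hu := (tendsto_displacement hm hz).neg
    -- Rewriting `A z + v = x` as `z = x - ε (M z + w)` exhibits the displacement without expanding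
    -- the inverse matrix.
    have hzu : ∀ᶠ i in l, z i = x + ε i • -(act (m i).1 (z i) + (m i).2.2) := by
      filter_upwards [hdet] with i hi
      have h1 := act_curve (ε i) (m i) (z i)
      have h2 : act (curve (ε i) (m i)).1 (z i) + (curve (ε i) (m i)).2.2 = x := by
        rw [hzdef]; simp only; rw [act_act_inv hi, sub_add_cancel]
      rw [smul_neg, ← sub_eq_add_neg, eq_sub_iff_add_eq, ← h1, h2]
    have h4 := hH.tendsto_gExt hg hx hε hu hαb
    have h1 : Tendsto (fun i => ENNReal.ofReal ((1 + ε i * (m i).2.1) ^ (s - 1) * H x)) l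
        (𝓝 (ENNReal.ofReal (1 ^ (s - 1) * H x))) :=
      ENNReal.tendsto_ofReal ((hα1.rpow_const (Or.inl one_ne_zero)).mul_const _)
    have h2 : Tendsto (fun i => ENNReal.ofReal (deriv f t * ((1 + ε i * t) * H x / H x ^ 3))) l
        (𝓝 (ENNReal.ofReal (deriv f t * (H x / H x ^ 3)))) :=
      ENNReal.tendsto_ofReal ((hy.div_const _).const_mul _)
    have h5 := ENNReal.Tendsto.mul h1 (Or.inr (ENNReal.mul_ne_top ENNReal.ofReal_ne_top ENNReal.ofReal_ne_top))
      (ENNReal.Tendsto.mul h2 (Or.inr ENNReal.ofReal_ne_top) h4 (Or.inr ENNReal.ofReal_ne_top))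
      (Or.inr ENNReal.ofReal_ne_top)
    have e : ENNReal.ofReal (1 ^ (s - 1) * H x) * (ENNReal.ofReal (deriv f t * (H x / H x ^ 3)) *
        ENNReal.ofReal (g (inner ℝ x (-(act m'.1 x + m'.2.2)) / H x ^ 2 + (-m'.2.1 + t)))) =
        ENNReal.ofReal (1 / H x) *
          ENNReal.ofReal (deriv f t * g (t - profileSlope H m' x)) := by
      have e1 : inner ℝ x (-(act m'.1 x + m'.2.2)) / H x ^ 2 + (-m'.2.1 + t) =
          t - profileSlope H m' x := by rw [inner_neg_right, profileSlope]; ring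
      have := hf.deriv_nonneg t
      rw [e1, ← ENNReal.ofReal_mul (by positivity), ← ENNReal.ofReal_mul (by positivity),
        ← ENNReal.ofReal_mul (by positivity)]
      congr 1
      rw [Real.one_rpow]
      field_simp
    rw [e] at h5
    refine h5.congr' ?_
    filter_upwards [hy.eventually_const_lt hp, hzu, hε self_mem_nhdsWithin] with i hi hzi hεi
    have hi' : (1 + ε i * t) * H x ∈ Ioi (0 : ℝ) := hi
    have hεi' : ε i ≠ 0 := (mem_Ioi.1 hεi).ne'
    rw [kernelMu, hyeq, indicator_of_mem hi', curve_snd_fst, ← hzi, mul_assoc]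
    congr 4
    congr 1
    field_simp
    ring
  · rw [indicator_of_notMem hx]
    refine tendsto_const_nhds.congr' ?_
    filter_upwards [hH.gExt_eventually_eq_zero hg hx hε hz hyα] with i hi
    rw [kernelMu, hyeq, curve_snd_fst]
    rw [mul_assoc] at hi
    simp [indicator_apply, hi]

end Limits
end FunctionalJohn

namespace FunctionalJohn

variable {n : ℕ} {f g : ℝ → ℝ} {H : Space n → ℝ}

/-! ### Passage to the limit in the integrals. -/

section Dominated

variable {ι : Type*} {l : Filter ι} {ε : ι → ℝ} {m : ι → Param n} {m' : Param n}

theorem exists_displacement_bound (hε : Tendsto ε l (𝓝[>] 0)) (hm : Tendsto m l (𝓝 m')) :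
    ∃ B ≥ 0, ∀ᶠ i in l, (∀ x : Space n, ‖x‖ ≤ 2 →
      ‖act (curve (ε i) (m i)).1 x + (curve (ε i) (m i)).2.2 - x‖ ≤ ε i * B) ∧
      (curve (ε i) (m i)).2.1 ≤ Real.exp (ε i * B) := by
  have h1 : Tendsto (fun i => ‖(Matrix.toEuclideanCLM (𝕜 := ℝ) (m i).1 : Space n →L[ℝ] Space n)‖)
      l (𝓝 ‖(Matrix.toEuclideanCLM (𝕜 := ℝ) m'.1 : Space n →L[ℝ] Space n)‖) :=
    (((continuous_toEuclideanCLM.comp continuous_fst).tendsto m').comp hm).norm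
  have h2 : Tendsto (fun i => ‖(m i).2.2‖) l (𝓝 ‖m'.2.2‖) :=
    (((continuous_snd.comp continuous_snd).tendsto m').comp hm).norm
  have h3 := (tendsto_snd_fst hm).abs
  set a := ‖(Matrix.toEuclideanCLM (𝕜 := ℝ) m'.1 : Space n →L[ℝ] Space n)‖
  refine ⟨(a + 1) * 2 + (‖m'.2.2‖ + 1) + (|m'.2.1| + 1), by positivity, ?_⟩
  filter_upwards [h1.eventually_le_const (show a < a + 1 by linarith),
    h2.eventually_le_const (show ‖m'.2.2‖ < ‖m'.2.2‖ + 1 by linarith),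
    h3.eventually_le_const (show |m'.2.1| < |m'.2.1| + 1 by linarith),
    hε self_mem_nhdsWithin] with i hi1 hi2 hi3 hi4
  have hεi : 0 < ε i := hi4
  constructor
  · intro x hx
    rw [act_curve, add_sub_cancel_left, norm_smul, Real.norm_of_nonneg hεi.le]
    gcongr
    calc _ ≤ ‖act (m i).1 x‖ + ‖(m i).2.2‖ := norm_add_le _ _
      _ ≤ (a + 1) * 2 + (‖m'.2.2‖ + 1) := by
        refine add_le_add ((norm_act_le _ _).trans ?_) hi2
        gcongr
      _ ≤ _ := by linarith [abs_nonneg m'.2.1]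
  · rw [curve_snd_fst]
    refine le_trans ?_ (Real.add_one_le_exp _)
    have h5 := le_abs_self (m i).2.1
    have h6 : (m i).2.1 ≤ (a + 1) * 2 + (‖m'.2.2‖ + 1) + (|m'.2.1| + 1) := by
      have : 0 ≤ a := norm_nonneg _
      have := norm_nonneg m'.2.2
      linarith
    nlinarith

theorem tendsto_curve_snd_fst (hε : Tendsto ε l (𝓝[>] 0)) (hm : Tendsto m l (𝓝 m')) :
    Tendsto (fun i => (curve (ε i) (m i)).2.1) l (𝓝 1) :=
  tendsto_one_of_firstOrder hε (firstOrder_affine hε (tendsto_snd_fst hm))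

/-- Dominated convergence twice, in `t` for fixed `x` and then in `x`. The bound on the inner
integrals is recorded because it later dominates the densities. -/
theorem tendsto_lintegral_of_box_bound [l.IsCountablyGenerated]
    {Φ : ι → Space n → ℝ → ℝ≥0∞} {Ψ : Space n → ℝ → ℝ≥0∞}
    (hmeas : ∀ i, Measurable fun q : Space n × ℝ => Φ i q.1 q.2) {C : ℝ}
    (hle : ∀ᶠ i in l, ∀ x t, Φ i x t ≤ (Metric.closedBall (0 : Space n) 2 ×ˢ Icc (-C) C).indicator
      (fun _ => ENNReal.ofReal C) (x, t))
    (hlim : ∀ x t, Tendsto (fun i => Φ i x t) l (𝓝 (Ψ x t))) :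
    (∃ C' : ℝ, ∀ᶠ i in l, ∀ x, ∫⁻ t, Φ i x t ≤
      (Metric.closedBall (0 : Space n) 2).indicator (fun _ => ENNReal.ofReal C') x) ∧
    (∀ x, Tendsto (fun i => ∫⁻ t, Φ i x t) l (𝓝 (∫⁻ t, Ψ x t))) ∧
    Tendsto (fun i => ∫⁻ x, ∫⁻ t, Φ i x t) l (𝓝 (∫⁻ x, ∫⁻ t, Ψ x t)) := by
  have hbox : ∀ (x : Space n) (t : ℝ), (Metric.closedBall (0 : Space n) 2 ×ˢ Icc (-C) C).indicator
      (fun _ => ENNReal.ofReal C) (x, t) ≤ (Icc (-C) C).indicator (fun _ => ENNReal.ofReal C) t := by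
    intro x t
    by_cases ht : t ∈ Icc (-C) C
    · rw [indicator_of_mem ht]; exact indicator_le_self' (fun _ _ => zero_le) _
    · rw [indicator_of_notMem ht, indicator_of_notMem (fun hc => ht hc.2)]
  have hCint : ∫⁻ t, (Icc (-C) C).indicator (fun _ => ENNReal.ofReal C) t =
      ENNReal.ofReal C * ENNReal.ofReal (C - -C) := by
    rw [lintegral_indicator measurableSet_Icc, setLIntegral_const, Real.volume_Icc]
  have hfin : ENNReal.ofReal C * ENNReal.ofReal (C - -C) ≠ ⊤ :=
    ENNReal.mul_ne_top ENNReal.ofReal_ne_top ENNReal.ofReal_ne_top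
  have h1 : ∀ᶠ i in l, ∀ x, ∫⁻ t, Φ i x t ≤ (Metric.closedBall (0 : Space n) 2).indicator
        (fun _ => ENNReal.ofReal (ENNReal.ofReal C * ENNReal.ofReal (C - -C)).toReal) x := by
    rw [ENNReal.ofReal_toReal hfin]
    filter_upwards [hle] with i hi x
    by_cases hx : x ∈ Metric.closedBall (0 : Space n) 2
    · rw [indicator_of_mem hx, ← hCint]
      exact lintegral_mono fun t => (hi x t).trans (hbox x t)
    · rw [indicator_of_notMem hx]
      refine (lintegral_mono (hi x)).trans_eq ?_
      simp [indicator_of_notMem (fun hc : (x, _) ∈ Metric.closedBall (0 : Space n) 2 ×ˢ Icc (-C) C =>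
        hx hc.1)]
  have h2 : ∀ x, Tendsto (fun i => ∫⁻ t, Φ i x t) l (𝓝 (∫⁻ t, Ψ x t)) := by
    intro x
    refine tendsto_lintegral_filter_of_dominated_convergence _
      (Eventually.of_forall fun i => measurable_section (hmeas i) x) ?_ (hCint.trans_ne hfin)
      (Eventually.of_forall fun t => hlim x t)
    filter_upwards [hle] with i hi
    exact Eventually.of_forall fun t => (hi x t).trans (hbox x t)
  refine ⟨⟨_, h1⟩, h2, ?_⟩
  refine tendsto_lintegral_filter_of_dominated_convergence
    ((Metric.closedBall (0 : Space n) 2).indicator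
      (fun _ => ENNReal.ofReal (ENNReal.ofReal C * ENNReal.ofReal (C - -C)).toReal))
    (Eventually.of_forall fun i => (hmeas i).lintegral_prod_right') ?_ ?_
    (Eventually.of_forall h2)
  · filter_upwards [h1] with i hi using Eventually.of_forall hi
  · rw [lintegral_indicator measurableSet_closedBall, setLIntegral_const]
    exact ENNReal.mul_ne_top ENNReal.ofReal_ne_top measure_closedBall_lt_top.ne

/-- The directions `m i` may vary, so this is continuous convergence of the functionals and can be
applied along sequences of points depending on `ε`. The inner integral of the limit kernel is `F` at
the slope. -/
theorem tendsto_profileL [l.IsCountablyGenerated] (hH : IsProfile H) (hf : PropF f) (hg : PropG g)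
    (hε : Tendsto ε l (𝓝[>] 0)) (hm : Tendsto m l (𝓝 m')) :
    Tendsto (fun i => profileL f g H (ε i) (curve (ε i) (m i))) l
      (𝓝 (∫⁻ x in profileContact H, ENNReal.ofReal (H x * convF f g (profileSlope H m' x)))) := by
  obtain ⟨B, hB, hbound⟩ := exists_displacement_bound hε hm
  obtain ⟨C, ε₀, hε₀, hC⟩ := kernelL_le hH hf hg hB
  have hα := tendsto_curve_snd_fst hε hm
  have hle : ∀ᶠ i in l, ∀ x t, kernelL f g H (ε i) (curve (ε i) (m i)) x t ≤
      (Metric.closedBall (0 : Space n) 2 ×ˢ Icc (-C) C).indicator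
        (fun _ => ENNReal.ofReal C) (x, t) := by
    filter_upwards [hbound, hα.eventually_const_lt one_pos, hε self_mem_nhdsWithin,
      (tendsto_nhds_of_tendsto_nhdsWithin hε).eventually_le_const hε₀] with i h1 h2 h3 h4
    exact hC _ _ h3 h4 h1.1 h2 h1.2
  have key := (tendsto_lintegral_of_box_bound
    (fun i => measurable_kernelL hH.measurable hf.continuous hg.continuous (ε i) _) hle
    (fun x t => tendsto_kernelL hH hf hg hε hm x t)).2.2
  have hlim : ∫⁻ x, ∫⁻ t, (profileContact H).indicator (fun x => ENNReal.ofReal (H x) *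
      ENNReal.ofReal (f (t + profileSlope H m' x) * g t)) x =
      ∫⁻ x in profileContact H, ENNReal.ofReal (H x * convF f g (profileSlope H m' x)) := by
    have hms : MeasurableSet (profileContact H) :=
      measurableSet_eq_fun (hH.measurable.pow_const 2) (by fun_prop)
    rw [← lintegral_indicator hms]
    refine lintegral_congr fun x => ?_
    by_cases hx : x ∈ profileContact H
    · simp only [indicator_of_mem hx]
      rw [lintegral_const_mul' _ _ ENNReal.ofReal_ne_top, lintegral_mul_shift hf hg,
        ENNReal.ofReal_mul (hH.nonneg x)]
    · simp only [indicator_of_notMem hx, lintegral_zero]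
  rw [hlim] at key
  refine key.congr' ?_
  filter_upwards [hε self_mem_nhdsWithin] with i hi
  exact (profileL_eq hH.measurable hH.nonneg hf.continuous hg.continuous hi _).symm

/-- The density of the limit measure in terms of `H = h ^ (1 / s)`. -/
noncomputable def limitDensity (f g : ℝ → ℝ) (H : Space n → ℝ) (m : Param n) : Space n → ℝ≥0∞ :=
  (profileContact H).indicator fun x =>
    ENNReal.ofReal (1 / H x * deriv (convF f g) (profileSlope H m x))

theorem tendsto_profileDensity [l.IsCountablyGenerated] (hH : IsProfile H) (hf : PropF f)
    (hg : PropG g) (s : ℝ) (hε : Tendsto ε l (𝓝[>] 0)) (hm : Tendsto m l (𝓝 m')) :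
    (∃ C' : ℝ, ∀ᶠ i in l, ∀ x, profileDensity f g H s (ε i) (curve (ε i) (m i)) x ≤
      (Metric.closedBall (0 : Space n) 2).indicator (fun _ => ENNReal.ofReal C') x) ∧
    (∀ x, Tendsto (fun i => profileDensity f g H s (ε i) (curve (ε i) (m i)) x) l
      (𝓝 (limitDensity f g H m' x))) := by
  obtain ⟨B, hB, hbound⟩ := exists_displacement_bound hε hm
  obtain ⟨C, ε₀, hε₀, hC⟩ := kernelMu_le hH hf hg hB s
  have hα := tendsto_curve_snd_fst hε hm
  have hαs : Tendsto (fun i => (curve (ε i) (m i)).2.1 ^ (s - 1)) l (𝓝 1) := by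
    simpa using hα.rpow_const (p := s - 1) (Or.inl one_ne_zero)
  have hle : ∀ᶠ i in l, ∀ x t, kernelMu f g H s (ε i) (curve (ε i) (m i)) x t ≤
      (Metric.closedBall (0 : Space n) 2 ×ˢ Icc (-C) C).indicator
        (fun _ => ENNReal.ofReal C) (x, t) := by
    filter_upwards [hbound, hα.eventually_const_lt one_pos, hε self_mem_nhdsWithin,
      (tendsto_nhds_of_tendsto_nhdsWithin hε).eventually_le_const hε₀,
      (tendsto_act_inv hε hm 0).1, hαs.eventually_le_const one_lt_two] with i h1 h2 h3 h4 h5 h6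
    exact hC _ _ h3 h4 h5 h1.1 h2 h1.2 h6
  have key := tendsto_lintegral_of_box_bound
    (fun i => measurable_kernelMu hH.measurable hg.continuous s (ε i) _) hle
    (fun x t => tendsto_kernelMu hH hf hg s hε hm x t)
  have hpos : ∀ᶠ i in l, ∀ x, ∫⁻ t, kernelMu f g H s (ε i) (curve (ε i) (m i)) x t =
      profileDensity f g H s (ε i) (curve (ε i) (m i)) x := by
    filter_upwards [hε self_mem_nhdsWithin, hα.eventually_const_lt one_pos] with i h1 h2 x
    exact (profileDensity_eq hH.measurable hH.nonneg hg.continuous h1 _ h2 x).symm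
  have hlim : ∀ x, ∫⁻ t, (profileContact H).indicator (fun x => ENNReal.ofReal (1 / H x) *
      ENNReal.ofReal (deriv f t * g (t - profileSlope H m' x))) x = limitDensity f g H m' x := by
    intro x
    by_cases hx : x ∈ profileContact H
    · simp only [limitDensity, indicator_of_mem hx]
      have := hH.nonneg x
      rw [lintegral_const_mul' _ _ ENNReal.ofReal_ne_top, lintegral_deriv_mul hf hg,
        ENNReal.ofReal_mul (by positivity)]
    · simp only [limitDensity, indicator_of_notMem hx, lintegral_zero]
  obtain ⟨⟨C', hC'⟩, h2, -⟩ := key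
  refine ⟨⟨C', ?_⟩, fun x => ?_⟩
  · filter_upwards [hC', hpos] with i h3 h4 x
    rw [← h4 x]; exact h3 x
  · have h3 := h2 x
    rw [hlim] at h3
    refine h3.congr' ?_
    filter_upwards [hpos] with i h4 using h4 x

/-- A common integrable majorant passes to the limit density, and dominated convergence against a
bounded test function gives weak convergence. -/
theorem tendsto_integral_withDensity [l.IsCountablyGenerated] [l.NeBot]
    {d : ι → Space n → ℝ≥0∞} {d' : Space n → ℝ≥0∞} (hd : ∀ i, Measurable (d i))
    (hd' : Measurable d') {C : ℝ} (hle : ∀ᶠ i in l, ∀ x, d i x ≤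
      (Metric.closedBall (0 : Space n) 2).indicator (fun _ => ENNReal.ofReal C) x)
    (hlim : ∀ x, Tendsto (fun i => d i x) l (𝓝 (d' x))) :
    (∀ᶠ i in l, IsFiniteMeasure (volume.withDensity (d i))) ∧
    IsFiniteMeasure (volume.withDensity d') ∧
    ∀ φ : BoundedContinuousFunction (Space n) ℝ,
      Tendsto (fun i => ∫ x, φ x ∂(volume.withDensity (d i))) l
        (𝓝 (∫ x, φ x ∂(volume.withDensity d'))) := by
  set b : Space n → ℝ≥0∞ := (Metric.closedBall (0 : Space n) 2).indicator
    (fun _ => ENNReal.ofReal C) with hb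
  have hbfin : ∫⁻ x, b x ≠ ⊤ := by
    rw [hb, lintegral_indicator measurableSet_closedBall, setLIntegral_const]
    exact ENNReal.mul_ne_top ENNReal.ofReal_ne_top measure_closedBall_lt_top.ne
  have hbtop : ∀ x, b x < ⊤ := fun x => by
    by_cases hx : x ∈ Metric.closedBall (0 : Space n) 2 <;> simp [hb, hx]
  have hd'le : ∀ x, d' x ≤ b x := fun x =>
    le_of_tendsto (hlim x) (hle.mono fun i hi => hi x)
  have hfin : ∀ e : Space n → ℝ≥0∞, (∀ x, e x ≤ b x) → IsFiniteMeasure (volume.withDensity e) :=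
    fun e he => isFiniteMeasure_withDensity
      (ne_top_of_le_ne_top hbfin (lintegral_mono he))
  refine ⟨hle.mono fun i hi => hfin _ hi, hfin _ hd'le, fun φ => ?_⟩
  rw [integral_withDensity_eq_integral_toReal_smul hd'
    (Eventually.of_forall fun x => (hd'le x).trans_lt (hbtop x))]
  have h1 : Tendsto (fun i => ∫ x, (d i x).toReal • φ x) l (𝓝 (∫ x, (d' x).toReal • φ x)) := by
    refine tendsto_integral_filter_of_dominated_convergence (fun x => (b x).toReal * ‖φ‖)
      (Eventually.of_forall fun i =>
        ((hd i).ennreal_toReal.aestronglyMeasurable.smul φ.continuous.aestronglyMeasurable)) ?_ ?_ ?_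
    · filter_upwards [hle] with i hi
      refine Eventually.of_forall fun x => ?_
      rw [norm_smul, Real.norm_of_nonneg ENNReal.toReal_nonneg]
      exact mul_le_mul (ENNReal.toReal_mono (hbtop x).ne (hi x)) (φ.norm_coe_le_norm x)
        (norm_nonneg _) ENNReal.toReal_nonneg
    · refine (integrable_toReal_of_lintegral_ne_top ?_ hbfin).mul_const _
      exact (measurable_const.indicator measurableSet_closedBall).aemeasurable
    · refine Eventually.of_forall fun x => ?_
      exact ((ENNReal.tendsto_toReal ((hd'le x).trans_lt (hbtop x)).ne).comp (hlim x)).smul_const _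
  refine h1.congr' ?_
  filter_upwards [hle] with i hi
  rw [integral_withDensity_eq_integral_toReal_smul (hd i)
    (Eventually.of_forall fun x => (hi x).trans_lt (hbtop x))]

end Dominated
end FunctionalJohn

namespace FunctionalJohn

variable {n : ℕ} {f g : ℝ → ℝ} {H : Space n → ℝ}

/-! ### The limit functional `Ī₁` and its unique minimizer. -/

section LimitFunctional

/-- The functional `Ione` in terms of `H = h ^ (1 / s)`. -/
noncomputable def profileI (f g : ℝ → ℝ) (H : Space n → ℝ) (m : Param n) : ℝ :=
  ∫ x in profileContact H, H x * convF f g (profileSlope H m x)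

theorem continuous_act_right (A : Matrix (Fin n) (Fin n) ℝ) : Continuous (act A) :=
  (Matrix.toEuclideanCLM (𝕜 := ℝ) A : Space n →L[ℝ] Space n).continuous

theorem measurable_profileSlope (hH : Measurable H) (m : Param n) :
    Measurable (profileSlope H m) := by
  have h1 : Measurable fun x : Space n => inner ℝ x (act m.1 x + m.2.2) :=
    (continuous_id.inner ((continuous_act_right m.1).add continuous_const)).measurable
  exact (h1.div (hH.pow_const 2)).add_const _

theorem profileSlope_add_smul (m q : Param n) (t : ℝ) (x : Space n) :
    profileSlope H (m + t • q) x = profileSlope H m x + t * profileSlope H q x := by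
  simp only [profileSlope, Prod.fst_add, Prod.snd_add, Prod.smul_fst, Prod.smul_snd, act_add_left,
    act_smul_left, inner_add_right, inner_smul_right, smul_eq_mul]
  ring

theorem measurableSet_profileContact (hH : Measurable H) : MeasurableSet (profileContact H) :=
  measurableSet_eq_fun (hH.pow_const 2) (by fun_prop)

theorem IsProfile.contact_subset (hH : IsProfile H) :
    profileContact H ⊆ Metric.closedBall (0 : Space n) 1 := fun _ hx => by
  simpa using (hH.norm_lt_one hx).le

theorem IsProfile.isFiniteMeasure_contact (hH : IsProfile H) :
    IsFiniteMeasure (volume.restrict (profileContact H)) :=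
  ⟨by
    rw [Measure.restrict_apply_univ]
    exact (measure_mono hH.contact_subset).trans_lt measure_closedBall_lt_top⟩

theorem IsProfile.exists_pos_le_contact (hH : IsProfile H) :
    ∃ c > 0, ∀ x ∈ profileContact H, c ≤ H x := by
  obtain ⟨δ, hδ, -, -, c₀, hc₀, hlow, -⟩ := hH.logLipschitz
  exact ⟨c₀, hc₀, fun x hx => hlow x (by linarith [hH.norm_lt_one hx])⟩

theorem IsProfile.slope_bound (hH : IsProfile H) (m : Param n) :
    ∃ C ≥ 0, ∀ x ∈ profileContact H, |profileSlope H m x| ≤ C := by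
  obtain ⟨c, hc, hlow⟩ := hH.exists_pos_le_contact
  set a := ‖(Matrix.toEuclideanCLM (𝕜 := ℝ) m.1 : Space n →L[ℝ] Space n)‖
  refine ⟨(1 * (a * 1 + ‖m.2.2‖)) / c ^ 2 + |m.2.1|, by positivity, fun x hx => ?_⟩
  have hx1 := (hH.norm_lt_one hx).le
  have hcx := hlow x hx
  refine (abs_add_le _ _).trans (add_le_add ?_ le_rfl)
  rw [abs_div, abs_of_nonneg (sq_nonneg (H x))]
  have h1 : |inner ℝ x (act m.1 x + m.2.2)| ≤ 1 * (a * 1 + ‖m.2.2‖) := by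
    refine (abs_real_inner_le_norm _ _).trans ?_
    gcongr
    refine (norm_add_le _ _).trans ?_
    gcongr
    refine (norm_act_le _ _).trans ?_
    gcongr
  gcongr

theorem integrableOn_of_bound (hH : IsProfile H) {φ : Space n → ℝ} (hφ : Measurable φ) {C : ℝ}
    (hC : ∀ x ∈ profileContact H, |φ x| ≤ C) : IntegrableOn φ (profileContact H) := by
  have := hH.isFiniteMeasure_contact
  refine Integrable.of_bound hφ.aestronglyMeasurable C ?_
  filter_upwards [ae_restrict_mem (measurableSet_profileContact hH.measurable)] with x hx
  exact hC x hx

theorem measurable_convF (hf : PropF f) (hg : PropG g) : Measurable (convF f g) :=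
  (convF_monotone hf hg).measurable

theorem integrable_profileI (hH : IsProfile H) (hf : PropF f) (hg : PropG g) (m : Param n) :
    IntegrableOn (fun x => H x * convF f g (profileSlope H m x)) (profileContact H) := by
  obtain ⟨C, hC0, hC⟩ := hH.slope_bound m
  obtain ⟨K, hK, hHK⟩ := hH.bounded
  refine integrableOn_of_bound hH (C := K * convF f g C) (hH.measurable.mul
    ((measurable_convF hf hg).comp (measurable_profileSlope hH.measurable m))) fun x hx => ?_
  have h1 := hH.nonneg x
  have h2 := convF_nonneg hf hg (profileSlope H m x)
  rw [abs_of_nonneg (mul_nonneg h1 h2)]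
  have h3 := convF_monotone hf hg ((le_abs_self _).trans (hC x hx))
  have := hHK x
  gcongr

theorem profileI_nonneg (hH : IsProfile H) (hf : PropF f) (hg : PropG g) (m : Param n) :
    0 ≤ profileI f g H m :=
  integral_nonneg fun _ => mul_nonneg (hH.nonneg _) (convF_nonneg hf hg _)

theorem lintegral_eq_profileI (hH : IsProfile H) (hf : PropF f) (hg : PropG g) (m : Param n) :
    ∫⁻ x in profileContact H, ENNReal.ofReal (H x * convF f g (profileSlope H m x)) =
      ENNReal.ofReal (profileI f g H m) := by
  rw [profileI, ofReal_integral_eq_lintegral_ofReal (integrable_profileI hH hf hg m)]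
  exact Eventually.of_forall fun _ => mul_nonneg (hH.nonneg _) (convF_nonneg hf hg _)

theorem profileI_eq_zero (hf : PropF f) (hg : PropG g) {m : Param n}
    (h : ∀ᵐ x ∂(volume.restrict (profileContact H)), profileSlope H m x ≤ -2) :
    profileI f g H m = 0 := by
  refine integral_eq_zero_of_ae ?_
  filter_upwards [h] with x hx
  simp [convF_eq_zero hf hg hx]

theorem smul_mem_traceZero {s : ℝ} {q : Param n} (hq : q ∈ TraceZero n s) (c : ℝ) :
    c • q ∈ TraceZero n s := by
  obtain ⟨h1, h2⟩ := hq
  refine ⟨h1.smul c, ?_⟩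
  simp only [sTrace, Prod.smul_fst, Prod.smul_snd, Matrix.trace_smul, smul_eq_mul] at h2 ⊢
  linear_combination c * h2

theorem add_mem_traceZero {s : ℝ} {p q : Param n} (hp : p ∈ TraceZero n s)
    (hq : q ∈ TraceZero n s) : p + q ∈ TraceZero n s := by
  obtain ⟨h1, h2⟩ := hp
  obtain ⟨h3, h4⟩ := hq
  refine ⟨h1.add h3, ?_⟩
  simp only [sTrace, Prod.fst_add, Prod.snd_add, Matrix.trace_add] at h2 h4 ⊢
  linear_combination h2 + h4

/-- The unique minimizer of `profileI` on the trace-zero subspace. -/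
def IsStrictMinimizer (f g : ℝ → ℝ) (H : Space n → ℝ) (s : ℝ) (m : Param n) : Prop :=
  m ∈ TraceZero n s ∧ ∀ q ∈ TraceZero n s, q ≠ m → profileI f g H m < profileI f g H q

variable {s : ℝ} {m₀ : Param n}

/-- If the slope of `m₀` were at most -2 almost everywhere, `Ī₁(m₀)` would be 0, and doubling `m₀`
would give another zero, so `m₀ = 0` by uniqueness. But the slope of 0 is 0, so the contact set
would be null and every trace-zero parameter, in particular a nonzero translation, would be a
minimizer. -/
theorem IsStrictMinimizer.not_slope_le (hm₀ : IsStrictMinimizer f g H s m₀) (hn : 1 ≤ n)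
    (hf : PropF f) (hg : PropG g) :
    ¬ ∀ᵐ x ∂(volume.restrict (profileContact H)), profileSlope H m₀ x ≤ -2 := by
  intro hae
  have h0 := profileI_eq_zero hf hg hae
  have huniq : ∀ q ∈ TraceZero n s,
      (∀ᵐ x ∂(volume.restrict (profileContact H)), profileSlope H q x ≤ -2) → q = m₀ := by
    intro q hq hqae
    by_contra hne
    have := hm₀.2 q hq hne
    rw [h0, profileI_eq_zero hf hg hqae] at this
    exact lt_irrefl _ this
  have h2 : m₀ + (1 : ℝ) • m₀ = m₀ := by
    refine huniq _ (add_mem_traceZero hm₀.1 (smul_mem_traceZero hm₀.1 1)) ?_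
    filter_upwards [hae] with x hx
    rw [profileSlope_add_smul]
    linarith
  have h3 : m₀ = 0 := by rwa [one_smul, add_eq_left] at h2
  have h4 : ∀ᵐ x ∂(volume.restrict (profileContact H)), False := by
    filter_upwards [hae] with x hx
    rw [h3] at hx
    simp [profileSlope, act] at hx
    linarith
  have h5 : ((0, 0, EuclideanSpace.single ⟨0, hn⟩ 1) : Param n) = m₀ := by
    refine huniq _ ⟨Matrix.isSymm_zero, by simp [sTrace]⟩ ?_
    filter_upwards [h4] with x hx using hx.elim
  rw [h3] at h5
  have h6 := congrArg (fun q : Param n => q.2.2 ⟨0, hn⟩) h5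
  simp at h6

/-- Lowering the height parameter by `T = sTrace s z / s` lands in the trace-zero subspace and
lowers the slope by `T`, hence does not increase `Ī₁`; so the lowered point is `m₀`. If `T > 0`,
equality of the integrals and strict monotonicity of `F` above -2 force the slope of `m₀` to be at
most -2 almost everywhere. -/
theorem IsStrictMinimizer.eq_of_le (hm₀ : IsStrictMinimizer f g H s m₀) (hn : 1 ≤ n) (hs : 0 < s)
    (hH : IsProfile H) (hf : PropF f) (hg : PropG g) {z : Param n} (hz : z.1.IsSymm)
    (htr : 0 ≤ sTrace s z) (hle : profileI f g H z ≤ profileI f g H m₀) : z = m₀ := by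
  set T := sTrace s z / s with hT
  have hT0 : 0 ≤ T := by positivity
  set e : Param n := (0, 1, 0) with he
  set z' : Param n := z + (-T) • e with hz'
  have hslope : ∀ x, profileSlope H z x = profileSlope H z' x + T := by
    intro x
    rw [hz', profileSlope_add_smul]
    simp [he, profileSlope, act]
  have hz'tr : z' ∈ TraceZero n s := by
    refine ⟨by simpa [hz', he] using hz, ?_⟩
    have : s * T = sTrace s z := by rw [hT]; field_simp
    simp only [hz', he, sTrace, Prod.fst_add, Prod.snd_add, Prod.smul_fst, Prod.smul_snd,
      smul_zero, add_zero, smul_eq_mul, mul_one] at this ⊢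
    linear_combination -this
  have hmono : ∀ x, H x * convF f g (profileSlope H z' x) ≤ H x * convF f g (profileSlope H z x) :=
    fun x => mul_le_mul_of_nonneg_left (convF_monotone hf hg (by rw [hslope]; linarith))
      (hH.nonneg x)
  have hle' : profileI f g H z' ≤ profileI f g H z :=
    integral_mono (integrable_profileI hH hf hg z') (integrable_profileI hH hf hg z) hmono
  have hzm : z' = m₀ := by
    by_contra hne
    have := hm₀.2 z' hz'tr hne
    linarith
  rcases hT0.eq_or_lt with h0 | h0
  · rw [hz', ← h0, neg_zero, zero_smul, add_zero] at hzm
    exact hzm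
  exfalso
  refine hm₀.not_slope_le hn hf hg ?_
  have hint : ∫ x in profileContact H, (H x * convF f g (profileSlope H z x) -
      H x * convF f g (profileSlope H z' x)) = 0 := by
    rw [integral_sub (integrable_profileI hH hf hg z) (integrable_profileI hH hf hg z')]
    have : profileI f g H z - profileI f g H z' = 0 := by rw [hzm] at hle' ⊢; linarith
    exact this
  rw [integral_eq_zero_iff_of_nonneg (fun x => sub_nonneg.2 (hmono x))
    ((integrable_profileI hH hf hg z).sub (integrable_profileI hH hf hg z'))] at hint
  filter_upwards [hint, ae_restrict_mem (measurableSet_profileContact hH.measurable)] with x hx hxΛ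
  have hp : 0 < H x := hH.pos_of_norm_le (hH.norm_lt_one hxΛ).le
  by_contra! hcon
  rw [← hzm] at hcon
  have h1 := convF_lt hf hg (show profileSlope H z' x < profileSlope H z x by
    rw [hslope]; linarith) (by rw [hslope]; linarith)
  have h2 := mul_lt_mul_of_pos_left h1 hp
  simp only [Pi.zero_apply] at hx
  linarith

theorem hasDerivAt_profileI (hH : IsProfile H) (hf : PropF f) (hg : PropG g) (m q : Param n) :
    IntegrableOn (fun x => H x * (deriv (convF f g) (profileSlope H m x) * profileSlope H q x))
      (profileContact H) ∧
    HasDerivAt (fun t : ℝ => profileI f g H (m + t • q))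
      (∫ x in profileContact H,
        H x * (deriv (convF f g) (profileSlope H m x) * profileSlope H q x)) 0 := by
  obtain ⟨C, hC0, hC⟩ := hH.slope_bound m
  obtain ⟨D, hD0, hD⟩ := hH.slope_bound q
  obtain ⟨K, hK, hHK⟩ := hH.bounded
  -- For `|t| < 1` the slopes of `m + t • q` on the contact set stay in `[-(C + D), C + D]`, where
  -- the convex function `F` is Lipschitz.
  obtain ⟨L, hL⟩ := ((convF_convex hf hg).locallyLipschitz.locallyLipschitzOn
    (s := Icc (-(C + D)) (C + D))).exists_lipschitzOnWith_of_compact isCompact_Icc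
  have := hH.isFiniteMeasure_contact
  have hsm := measurable_profileSlope hH.measurable
  have hΛ := ae_restrict_mem (μ := volume) (measurableSet_profileContact hH.measurable)
  refine hasDerivAt_integral_of_dominated_loc_of_lip (μ := volume.restrict (profileContact H))
    (𝕜 := ℝ) (F := fun t x => H x * convF f g (profileSlope H (m + t • q) x))
    (F' := fun x => H x * (deriv (convF f g) (profileSlope H m x) * profileSlope H q x))
    (x₀ := 0) (s := Metric.ball 0 1) (bound := fun _ => K * (L * D))
    (Metric.ball_mem_nhds 0 one_pos)
    (Eventually.of_forall fun t => (integrable_profileI hH hf hg _).aestronglyMeasurable)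
    (integrable_profileI hH hf hg _) ?_ ?_ (integrable_const _) ?_
  · exact (hH.measurable.mul (((measurable_deriv _).comp (hsm m)).mul (hsm q))).aestronglyMeasurable
  · filter_upwards [hΛ] with x hx
    have hmem : ∀ t ∈ Metric.ball (0 : ℝ) 1,
        profileSlope H (m + t • q) x ∈ Icc (-(C + D)) (C + D) := by
      intro t ht
      rw [mem_ball_zero_iff, Real.norm_eq_abs] at ht
      rw [profileSlope_add_smul, mem_Icc, ← abs_le]
      refine (abs_add_le _ _).trans (add_le_add (hC x hx) ?_)
      rw [abs_mul]
      have := hD x hx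
      have := abs_nonneg (profileSlope H q x)
      nlinarith
    refine LipschitzOnWith.of_dist_le_mul fun t ht u hu => ?_
    rw [Real.coe_nnabs, abs_of_nonneg (by positivity), Real.dist_eq, ← mul_sub, abs_mul,
      abs_of_nonneg (hH.nonneg x)]
    have h1 := hL.dist_le_mul _ (hmem t ht) _ (hmem u hu)
    rw [Real.dist_eq, Real.dist_eq, profileSlope_add_smul, profileSlope_add_smul] at h1
    have e : profileSlope H m x + t * profileSlope H q x -
        (profileSlope H m x + u * profileSlope H q x) = (t - u) * profileSlope H q x := by ring
    rw [e, abs_mul, ← profileSlope_add_smul, ← profileSlope_add_smul] at h1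
    have h2 := hHK x
    have h3 := hD x hx
    calc _ ≤ K * (L * (|t - u| * D)) := by
          gcongr
          exact h1.trans (by gcongr)
      _ = _ := by rw [Real.dist_eq]; ring
  · refine Eventually.of_forall fun x => ?_
    refine HasDerivAt.const_mul _ ?_
    simp only [profileSlope_add_smul]
    have h1 : HasDerivAt (fun t : ℝ => profileSlope H m x + t * profileSlope H q x)
        (profileSlope H q x) 0 := by
      simpa using ((hasDerivAt_id (0 : ℝ)).mul_const (profileSlope H q x)).const_add
        (profileSlope H m x)
    have h2 : HasDerivAt (convF f g) (deriv (convF f g) (profileSlope H m x))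
        (profileSlope H m x + 0 * profileSlope H q x) := by
      rw [zero_mul, add_zero]
      exact (hasDerivAt_convF hf hg _).differentiableAt.hasDerivAt
    exact h2.comp 0 h1

theorem IsStrictMinimizer.stationary (hm₀ : IsStrictMinimizer f g H s m₀)
    (hH : IsProfile H) (hf : PropF f) (hg : PropG g) {q : Param n} (hq : q ∈ TraceZero n s) :
    ∫ x in profileContact H,
      H x * (deriv (convF f g) (profileSlope H m₀ x) * profileSlope H q x) = 0 := by
  refine IsLocalMin.hasDerivAt_eq_zero (Eventually.of_forall fun t => ?_)
    (hasDerivAt_profileI hH hf hg m₀ q).2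
  rw [zero_smul, add_zero]
  by_cases h : m₀ + t • q = m₀
  · rw [h]
  · exact (hm₀.2 _ (add_mem_traceZero hm₀.1 (smul_mem_traceZero hq t)) h).le

end LimitFunctional
end FunctionalJohn

namespace FunctionalJohn

variable {n : ℕ} {f g : ℝ → ℝ} {H : Space n → ℝ}

/-! ### Centering and isotropy of the limit measure. -/

section LimitMeasure

/-- The real-valued density of the limit measure on the contact set. -/
noncomputable def contactWeight (f g : ℝ → ℝ) (H : Space n → ℝ) (m : Param n) (x : Space n) : ℝ :=
  1 / H x * deriv (convF f g) (profileSlope H m x)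

theorem contactWeight_nonneg (hH : IsProfile H) (hf : PropF f) (hg : PropG g) (m : Param n)
    (x : Space n) : 0 ≤ contactWeight f g H m x := by
  have := hH.nonneg x
  have := deriv_convF_nonneg hf hg (profileSlope H m x)
  unfold contactWeight
  positivity

theorem measurable_contactWeight (hH : IsProfile H) (m : Param n) :
    Measurable (contactWeight f g H m) :=
  (hH.measurable.const_div 1).mul
    ((measurable_deriv _).comp (measurable_profileSlope hH.measurable m))

theorem measurable_limitDensity (hH : IsProfile H) (m : Param n) :
    Measurable (limitDensity f g H m) :=
  (measurable_contactWeight hH m).ennreal_ofReal.indicator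
    (measurableSet_profileContact hH.measurable)

theorem contactWeight_bound (hH : IsProfile H) (hf : PropF f) (hg : PropG g) (m : Param n) :
    ∃ C ≥ 0, ∀ x ∈ profileContact H, contactWeight f g H m x ≤ C := by
  obtain ⟨C, hC0, hC⟩ := hH.slope_bound m
  obtain ⟨c, hc, hlow⟩ := hH.exists_pos_le_contact
  have hmono : Monotone (deriv (convF f g)) := by
    have := (convF_convex hf hg).monotoneOn_deriv
      (fun x _ => (hasDerivAt_convF hf hg x).differentiableAt)
    rwa [monotoneOn_univ] at this
  have h0 := deriv_convF_nonneg hf hg C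
  refine ⟨1 / c * deriv (convF f g) C, by positivity, fun x hx => ?_⟩
  have h1 := hlow x hx
  have h2 := hmono ((le_abs_self _).trans (hC x hx))
  have h3 := deriv_convF_nonneg hf hg (profileSlope H m x)
  unfold contactWeight
  gcongr

theorem integrable_contactWeight_mul (hH : IsProfile H) (hf : PropF f) (hg : PropG g)
    (m : Param n) {φ : Space n → ℝ} (hφ : Continuous φ) :
    IntegrableOn (fun x => contactWeight f g H m x * φ x) (profileContact H) := by
  obtain ⟨C, hC0, hC⟩ := contactWeight_bound hH hf hg m
  obtain ⟨D, hD⟩ := (isCompact_closedBall (0 : Space n) 1).exists_bound_of_continuousOn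
    hφ.continuousOn
  refine integrableOn_of_bound hH (C := C * D) ((measurable_contactWeight hH m).mul hφ.measurable)
    fun x hx => ?_
  rw [abs_mul, abs_of_nonneg (contactWeight_nonneg hH hf hg m x)]
  exact mul_le_mul (hC x hx) (hD x (hH.contact_subset hx)) (abs_nonneg _) hC0

theorem setIntegral_limitDensity {E : Type*} [NormedAddCommGroup E] [NormedSpace ℝ E]
    (hH : IsProfile H) (hf : PropF f) (hg : PropG g) (m : Param n) (φ : Space n → E) :
    ∫ u in Metric.closedBall (0 : Space n) 1, φ u ∂(volume.withDensity (limitDensity f g H m)) =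
      ∫ u in profileContact H, contactWeight f g H m u • φ u := by
  have hms := measurableSet_profileContact hH.measurable
  have htop : ∀ x, limitDensity f g H m x < ⊤ := fun x => by
    unfold limitDensity
    by_cases hx : x ∈ profileContact H <;> simp [hx]
  rw [restrict_withDensity measurableSet_closedBall,
    integral_withDensity_eq_integral_toReal_smul (measurable_limitDensity hH m)
      (Eventually.of_forall htop), ← integral_indicator measurableSet_closedBall,
    ← integral_indicator hms]
  refine integral_congr_ae (Eventually.of_forall fun x => ?_)
  by_cases hx : x ∈ profileContact H
  · simp only [indicator_of_mem hx, indicator_of_mem (hH.contact_subset hx), limitDensity]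
    change (ENNReal.ofReal (contactWeight f g H m x)).toReal • φ x = _
    rw [ENNReal.toReal_ofReal (contactWeight_nonneg hH hf hg m x)]
  · simp [limitDensity, hx]

variable {s : ℝ} {m₀ : Param n}

/-- On the contact set `H ^ 2 = 1 - ‖x‖ ^ 2`, so `H` times the slope of `q` is `1 / H` times an
expression linear in `q`. Stationarity thus becomes a linear relation between first and second
moments of the limit measure. -/
theorem IsStrictMinimizer.stationary_weight (hm₀ : IsStrictMinimizer f g H s m₀)
    (hH : IsProfile H) (hf : PropF f) (hg : PropG g) {q : Param n} (hq : q ∈ TraceZero n s) :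
    ∫ x in profileContact H, contactWeight f g H m₀ x *
      (inner ℝ x (act q.1 x + q.2.2) + q.2.1 * (1 - ‖x‖ ^ 2)) = 0 := by
  rw [← hm₀.stationary hH hf hg hq]
  refine setIntegral_congr_fun (measurableSet_profileContact hH.measurable) fun x hx => ?_
  have hp : 0 < H x := hH.pos_of_norm_le (hH.norm_lt_one hx).le
  have hx' : H x ^ 2 = 1 - ‖x‖ ^ 2 := hx
  simp only [contactWeight, profileSlope, ← hx']
  field_simp

/-- The integrand is nonnegative and `1 - ‖x‖ ^ 2` is positive on the contact set, so a zero
integral would mean `F' = 0` at almost every slope, hence slopes at most -2. -/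
theorem IsStrictMinimizer.integral_weight_pos (hm₀ : IsStrictMinimizer f g H s m₀) (hn : 1 ≤ n)
    (hH : IsProfile H) (hf : PropF f) (hg : PropG g) :
    ∫ x in profileContact H, contactWeight f g H m₀ x * (1 - ‖x‖ ^ 2) ≠ 0 := by
  intro h0
  have hms := ae_restrict_mem (μ := volume) (measurableSet_profileContact hH.measurable)
  have hnn : 0 ≤ᵐ[volume.restrict (profileContact H)]
      fun x => contactWeight f g H m₀ x * (1 - ‖x‖ ^ 2) := by
    filter_upwards [hms] with x hx
    have hx' : H x ^ 2 = 1 - ‖x‖ ^ 2 := hx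
    rw [Pi.zero_apply, ← hx']
    exact mul_nonneg (contactWeight_nonneg hH hf hg _ _) (sq_nonneg _)
  rw [integral_eq_zero_iff_of_nonneg_ae hnn
    (integrable_contactWeight_mul hH hf hg m₀ (by fun_prop))] at h0
  refine hm₀.not_slope_le hn hf hg ?_
  filter_upwards [h0, hms] with x hx hxΛ
  have hp : 0 < H x := hH.pos_of_norm_le (hH.norm_lt_one hxΛ).le
  have hx' : H x ^ 2 = 1 - ‖x‖ ^ 2 := hxΛ
  rw [Pi.zero_apply, ← hx', contactWeight] at hx
  refine le_neg_two_of_deriv_eq_zero hf hg ?_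
  have h1 : 1 / H x * H x ^ 2 ≠ 0 := by positivity
  by_contra hne
  refine mul_ne_zero h1 hne ?_
  linear_combination hx

theorem IsStrictMinimizer.isCentered (hm₀ : IsStrictMinimizer f g H s m₀)
    (hH : IsProfile H) (hf : PropF f) (hg : PropG g) :
    IsCentered (volume.withDensity (limitDensity f g H m₀)) := by
  unfold IsCentered
  rw [setIntegral_limitDensity hH hf hg]
  set c := ∫ u in profileContact H, contactWeight f g H m₀ u • u with hc
  have hint : IntegrableOn (fun u => contactWeight f g H m₀ u • u) (profileContact H) := by
    have := hH.isFiniteMeasure_contact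
    obtain ⟨C, hC0, hC⟩ := contactWeight_bound hH hf hg m₀
    refine Integrable.of_bound
      ((measurable_contactWeight hH m₀).smul measurable_id).aestronglyMeasurable C ?_
    filter_upwards [ae_restrict_mem (measurableSet_profileContact hH.measurable)] with x hx
    rw [norm_smul, Real.norm_of_nonneg (contactWeight_nonneg hH hf hg m₀ x)]
    exact (mul_le_mul (hC x hx) (hH.norm_lt_one hx).le (norm_nonneg _) hC0).trans_eq (mul_one C)
  -- Testing with the translation by the first moment `c` itself gives `⟨c, c⟩ = 0`.
  have h1 := hm₀.stationary_weight hH hf hg (q := (0, 0, c)) ⟨Matrix.isSymm_zero, by simp [sTrace]⟩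
  have h2 : inner ℝ c c = 0 := by
    nth_rewrite 2 [hc]
    rw [← integral_inner hint, ← h1]
    refine integral_congr_ae (Eventually.of_forall fun x => ?_)
    simp [act, inner_smul_right, real_inner_comm]
  exact inner_self_eq_zero.1 h2

theorem inner_act_eq_sum (M : Matrix (Fin n) (Fin n) ℝ) (x : Space n) :
    inner ℝ x (act M x) = ∑ i, ∑ j, M i j * (x i * x j) := by
  simp only [act, PiLp.inner_apply, Matrix.mulVec, dotProduct, RCLike.inner_apply, conj_trivial,
    Finset.sum_mul]
  refine Finset.sum_congr rfl fun i _ => Finset.sum_congr rfl fun j _ => by ring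

theorem inner_act_single (i j : Fin n) (x : Space n) :
    inner ℝ x (act (Matrix.single i j 1) x) = x i * x j := by
  rw [inner_act_eq_sum, Finset.sum_eq_single i, Finset.sum_eq_single j]
  · simp
  · intro b _ hb; simp [hb.symm]
  · simp
  · intro b _ hb; simp [hb.symm]
  · simp

theorem IsStrictMinimizer.isSIsotropic (hm₀ : IsStrictMinimizer f g H s m₀) (hn : 1 ≤ n)
    (hs : 0 < s) (hH : IsProfile H) (hf : PropF f) (hg : PropG g) :
    IsSIsotropic s (volume.withDensity (limitDensity f g H m₀)) := by
  set J := ∫ x in profileContact H, contactWeight f g H m₀ x * (1 - ‖x‖ ^ 2) with hJ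
  have hcoord : ∀ i j : Fin n, Continuous fun x : Space n => x i * x j := fun i j => by fun_prop
  have hdiag : ∀ i : Fin n, ∫ x in profileContact H, contactWeight f g H m₀ x * (x i * x i) =
      s⁻¹ * J := by
    intro i
    -- The entry `-s⁻¹` makes the `s`-trace vanish; it is what relates each diagonal second moment
    -- to `J` and gives `λ = J / s`.
    have h1 := hm₀.stationary_weight hH hf hg (q := (Matrix.single i i 1, -s⁻¹, 0))
      ⟨by rw [Matrix.IsSymm, Matrix.transpose_single],
        by simp [sTrace, hs.ne']⟩
    simp only [add_zero, inner_act_single, mul_add] at h1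
    rw [integral_add (integrable_contactWeight_mul hH hf hg m₀ (hcoord i i))
      (integrable_contactWeight_mul hH hf hg m₀ (by fun_prop))] at h1
    have h2 : ∫ x in profileContact H, contactWeight f g H m₀ x * (-s⁻¹ * (1 - ‖x‖ ^ 2)) =
        -s⁻¹ * J := by
      rw [hJ, ← integral_const_mul]
      congr 1; funext x; ring
    rw [h2] at h1
    linarith
  have hoff : ∀ i j : Fin n, i ≠ j →
      ∫ x in profileContact H, contactWeight f g H m₀ x * (x i * x j) = 0 := by
    intro i j hij
    have h1 := hm₀.stationary_weight hH hf hg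
      (q := (Matrix.single i j 1 + Matrix.single j i 1, 0, 0))
      ⟨by rw [Matrix.IsSymm, Matrix.transpose_add, Matrix.transpose_single,
            Matrix.transpose_single, add_comm],
        by simp [sTrace, hij, hij.symm]⟩
    simp only [add_zero, act_add_left, inner_add_right, inner_act_single, zero_mul] at h1
    have h2 : ∫ x in profileContact H, contactWeight f g H m₀ x * (x i * x j + x j * x i) =
        2 * ∫ x in profileContact H, contactWeight f g H m₀ x * (x i * x j) := by
      rw [← integral_const_mul]
      congr 1; funext x; ring
    rw [h2] at h1
    linarith
  refine ⟨s⁻¹ * J, mul_ne_zero (inv_ne_zero hs.ne') (hm₀.integral_weight_pos hn hH hf hg), ?_⟩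
  ext i j
  rw [Matrix.of_apply, setIntegral_limitDensity hH hf hg]
  rcases i with i | i <;> rcases j with j | j
  · simp only [oplus, Matrix.fromBlocks_apply₁₁, Matrix.vecMulVec_apply, smul_eq_mul,
      Matrix.smul_apply, Matrix.one_apply]
    by_cases hij : i = j
    · subst hij
      rw [hdiag i, if_pos rfl, mul_one]
    · rw [hoff i j hij, if_neg hij, mul_zero]
  · simp [oplus]
  · simp [oplus]
  · simp only [oplus, Matrix.fromBlocks_apply₂₂, Matrix.of_apply, smul_eq_mul, Matrix.smul_apply]
    rw [← hJ]
    field_simp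

end LimitMeasure

/-! ### Return to the original functionals, measures and curves. -/

section Bridge

variable {h : Space n → ℝ} {s : ℝ}

theorem contactSet_eq (hH : IsProfile (fun x => h x ^ (1 / s))) :
    contactSet h s = profileContact (fun x => h x ^ (1 / s)) := by
  ext x
  simp only [contactSet, profileContact, mem_ofPred_eq, ballHeight, mem_closedBall_zero_iff]
  constructor
  · rintro ⟨hx, hx2⟩
    rw [hx2, if_pos hx, Real.sq_sqrt (by nlinarith [norm_nonneg x])]
  · intro hx
    have h1 := (hH.norm_lt_one hx).le
    refine ⟨h1, ?_⟩
    rw [if_pos h1, ← hx, Real.sqrt_sq (hH.nonneg x)]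

theorem slopeArg_eq (hnn : ∀ x, 0 ≤ h x) (m : Param n) :
    slopeArg h s m = profileSlope (fun x => h x ^ (1 / s)) m := by
  funext x
  rw [slopeArg, profileSlope, rpow_two_div (hnn x)]

theorem Ione_eq (hH : IsProfile (fun x => h x ^ (1 / s))) (hnn : ∀ x, 0 ≤ h x) (m : Param n) :
    Ione f g h s m = profileI f g (fun x => h x ^ (1 / s)) m := by
  rw [Ione, profileI, contactSet_eq hH, slopeArg_eq hnn]

theorem limitMeasure_eq (hH : IsProfile (fun x => h x ^ (1 / s))) (hnn : ∀ x, 0 ≤ h x)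
    (m : Param n) : limitMeasure f g h s m =
      volume.withDensity (limitDensity f g (fun x => h x ^ (1 / s)) m) := by
  rw [limitMeasure, limitDensity,
    withDensity_indicator (measurableSet_profileContact hH.measurable), contactSet_eq hH,
    slopeArg_eq hnn]

theorem IsUniqueMinimizerIone.isStrictMinimizer {m₀ : Param n}
    (hm₀ : IsUniqueMinimizerIone f g h s m₀) (hH : IsProfile (fun x => h x ^ (1 / s)))
    (hnn : ∀ x, 0 ≤ h x) : IsStrictMinimizer f g (fun x => h x ^ (1 / s)) s m₀ :=
  ⟨hm₀.1, fun q hq hne => by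
    have := hm₀.2 q hq hne
    rwa [Ione_eq hH hnn, Ione_eq hH hnn] at this⟩

/-- The difference quotient of a curve at `r = 1`. -/
noncomputable def quotient (p : ℝ → Param n) (r : ℝ) : Param n :=
  (1 - r)⁻¹ • (p r - idParam n)

theorem curve_quotient (p : ℝ → Param n) {r : ℝ} (hr : r < 1) :
    curve (1 - r) (quotient p r) = p r := by
  rw [curve, quotient, smul_inv_smul₀ (by linarith), add_sub_cancel]

theorem tendsto_one_sub : Tendsto (fun r : ℝ => 1 - r) (𝓝[<] 1) (𝓝[>] 0) := by
  refine tendsto_nhdsWithin_of_tendsto_nhds_of_eventually_within _ ?_ ?_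
  · have : Tendsto (fun r : ℝ => 1 - r) (𝓝 1) (𝓝 (1 - 1)) := tendsto_id.const_sub 1
    rw [sub_self] at this
    exact this.mono_left nhdsWithin_le_nhds
  · filter_upwards [self_mem_nhdsWithin] with r hr
    exact sub_pos.2 (mem_Iio.1 hr)

theorem convergesWeakly_of_tendsto (hs : 0 < s) (hH : IsProfile (fun x => h x ^ (1 / s)))
    (hnn : ∀ x, 0 ≤ h x) (hf : PropF f) (hg : PropG g) {p : ℝ → Param n} {m₀ : Param n}
    (hp : Tendsto (quotient p) (𝓝[<] 1) (𝓝 m₀)) :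
    ConvergesWeakly (fun r => muMeasure f g h s r (p r)) (limitMeasure f g h s m₀) := by
  obtain ⟨⟨C, hC⟩, hlim⟩ := tendsto_profileDensity hH hf hg s tendsto_one_sub hp
  obtain ⟨h1, h2, h3⟩ := tendsto_integral_withDensity
    (fun r => measurable_profileDensity hH.measurable hg.continuous s (1 - r) _)
    (measurable_limitDensity hH m₀) hC hlim
  have heq : ∀ᶠ r in 𝓝[<] (1 : ℝ), volume.withDensity (profileDensity f g (fun x => h x ^ (1 / s)) s
      (1 - r) (curve (1 - r) (quotient p r))) = muMeasure f g h s r (p r) := by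
    filter_upwards [self_mem_nhdsWithin] with r hr
    rw [curve_quotient p hr, muMeasure_eq hs hnn hf]
  unfold ConvergesWeakly
  rw [limitMeasure_eq hH hnn]
  refine ⟨?_, h2, fun φ => (h3 φ).congr' ?_⟩
  · filter_upwards [h1, heq] with r h4 h5
    rwa [h5] at h4
  · filter_upwards [heq] with r h5
    rw [h5]

theorem HasExpansion.tendsto_quotient {p : ℝ → Param n} {m : Param n} (hp : HasExpansion p m) :
    Tendsto (quotient p) (𝓝[<] 1) (𝓝 m) := by
  have h1 := Asymptotics.IsLittleOTVS.tendsto_inv_smul hp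
  have h2 := h1.add_const m
  rw [zero_add] at h2
  refine h2.congr' ?_
  filter_upwards [self_mem_nhdsWithin] with r hr
  have hr' : (1 - r) ≠ 0 := (sub_pos.2 hr).ne'
  rw [quotient, ← sub_sub, smul_sub (1 - r)⁻¹ (p r - idParam n), inv_smul_smul₀ hr',
    sub_add_cancel]

theorem tendsto_quotient_linear (m : Param n) :
    Tendsto (quotient fun r => idParam n + (1 - r) • m) (𝓝[<] 1) (𝓝 m) := by
  refine tendsto_const_nhds.congr' ?_
  filter_upwards [self_mem_nhdsWithin] with r hr
  have hr' : (1 - r) ≠ 0 := (sub_pos.2 hr).ne'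
  rw [quotient, add_sub_cancel_left, inv_smul_smul₀ hr']

/-- `(p r - p 1) / (r - 1)` is the negative of the quotient, whence the sign. The remainder at `r =
1` is 0, so only the limit from strictly below matters. -/
theorem hasDerivWithinAt_of_tendsto_quotient {p : ℝ → Param n} {m : Param n}
    (h1 : p 1 = idParam n) (hp : Tendsto (quotient p) (𝓝[<] 1) (𝓝 m)) :
    HasDerivWithinAt p (-m) (Iic 1) 1 := by
  refine HasFDerivWithinAt.of_isLittleOTVS ?_
  rw [Asymptotics.isLittleOTVS_iff_tendsto_inv_smul (Eventually.of_forall fun r hr => by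
    rw [sub_eq_zero.1 hr]; simp), ← Iio_insert, nhdsWithin_insert, tendsto_sup]
  constructor
  · rw [tendsto_pure_left]
    intro U hU
    simpa using mem_of_mem_nhds hU
  · have h2 := (hp.sub_const m).neg
    rw [sub_self, neg_zero] at h2
    refine h2.congr' ?_
    filter_upwards [self_mem_nhdsWithin] with r hr
    have hr' : r - 1 ≠ 0 := (sub_neg.2 (mem_Iio.1 hr)).ne
    rw [ContinuousLinearMap.toSpanSingleton_apply, smul_sub, inv_smul_smul₀ hr', h1, quotient,
      ← neg_sub r 1, inv_neg, neg_smul]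
    abel

end Bridge
end FunctionalJohn

namespace FunctionalJohn

variable {n : ℕ} {f g : ℝ → ℝ} {H : Space n → ℝ} {ε : ℝ}

/-! ### Lower semicontinuity and coercivity. -/

section Existence

theorem fExt_mono (hf : PropF f) (hnn : ∀ x, 0 ≤ H x) (hε : 0 < ε) (x : Space n) :
    Monotone (fExt f H ε x) := by
  intro y y' hy
  unfold fExt
  split_ifs
  · exact le_rfl
  · have := hnn x
    exact ENNReal.ofReal_le_ofReal (hf.monotone (by gcongr))

theorem ofReal_le_fExt (hf : PropF f) (hnn : ∀ x, 0 ≤ H x) (hε : 0 < ε) {x : Space n} {y t : ℝ}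
    (hy : 0 ≤ y) (ht : H x ≤ t) : ENNReal.ofReal (f ((y / t - 1) / ε)) ≤ fExt f H ε x y := by
  unfold fExt
  split_ifs with h0
  · exact le_top
  · have : 0 < H x := lt_of_le_of_ne (hnn x) (Ne.symm h0)
    exact ENNReal.ofReal_le_ofReal (hf.monotone (by gcongr))

/-- Approaching `H x` from above covers both cases: where `H x = 0` the quotient `y / t` blows up
and `f` tends to the conventional value `∞`. -/
theorem tendsto_fExt_right (hf : PropF f) (hε : 0 < ε) (x : Space n) {y : ℝ}
    (hy : 0 < y) : Tendsto (fun t => ENNReal.ofReal (f ((y / t - 1) / ε))) (𝓝[>] (H x))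
      (𝓝 (fExt f H ε x y)) := by
  unfold fExt
  split_ifs with h0
  · rw [h0]
    refine ENNReal.tendsto_ofReal_atTop.comp (hf.tendsto_atTop.comp ?_)
    refine Tendsto.atTop_div_const hε (tendsto_atTop_add_const_right _ _ ?_)
    exact (tendsto_inv_nhdsGT_zero.const_mul_atTop hy)
  · refine ENNReal.tendsto_ofReal ((hf.continuous.tendsto _).comp ?_)
    have : Tendsto (fun t => (y / t - 1) / ε) (𝓝 (H x)) (𝓝 ((y / H x - 1) / ε)) :=
      ((tendsto_const_nhds.div tendsto_id h0).sub_const 1).div_const ε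
    exact this.mono_left nhdsWithin_le_nhds

/-- Upper semicontinuity keeps `H (z i)` below any level `t > H z'` eventually, and `f` of a
quotient decreases in the denominator; letting `t` decrease to `H z'` gives lower semicontinuity. -/
theorem IsProfile.fExt_le_liminf (hH : IsProfile H) (hf : PropF f) (hε : 0 < ε) {ι : Type*}
    {l : Filter ι} {z : ι → Space n} {z' : Space n} {y : ι → ℝ} {y' : ℝ}
    (hz : Tendsto z l (𝓝 z')) (hy : Tendsto y l (𝓝 y')) (hy' : 0 < y') :
    fExt f H ε z' y' ≤ liminf (fun i => fExt f H ε (z i) (y i)) l := by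
  refine le_of_forall_lt fun a ha => ?_
  obtain ⟨b, hab, hb⟩ := exists_between ha
  refine hab.trans_le (le_liminf_of_le (by isBoundedDefault) ?_)
  obtain ⟨t, htb, ht⟩ := (((tendsto_fExt_right hf hε z' hy').eventually_const_lt hb).and
    self_mem_nhdsWithin).exists
  have ht0 : 0 < t := (hH.nonneg z').trans_lt ht
  have h1 : Tendsto (fun i => ENNReal.ofReal (f ((y i / t - 1) / ε))) l
      (𝓝 (ENNReal.ofReal (f ((y' / t - 1) / ε)))) :=
    ENNReal.tendsto_ofReal ((hf.continuous.tendsto _).comp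
      (((hy.div_const t).sub_const 1).div_const ε))
  filter_upwards [h1.eventually_const_lt htb, hz.eventually (hH.usc z' t ht),
    hy.eventually_const_lt hy'] with i h2 h3 h4
  exact h2.le.trans (ofReal_le_fExt hf hH.nonneg hε h4.le h3.le)

/-- The functional `profileL` without its normalization. -/
noncomputable def rawL (f g : ℝ → ℝ) (H : Space n → ℝ) (ε : ℝ) (p : Param n) : ℝ≥0∞ :=
  ∫⁻ x : Space n, ∫⁻ y in Ioi (0 : ℝ),
    fExt f H ε (act p.1 x + p.2.2) (p.2.1 * y) * gExt g H ε x y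

theorem gExt_ne_top (x : Space n) (y : ℝ) : gExt g H ε x y ≠ ⊤ := by
  unfold gExt
  split_ifs
  · exact ENNReal.zero_ne_top
  · exact ENNReal.ofReal_ne_top

theorem IsProfile.rawL_le_liminf (hH : IsProfile H) (hf : PropF f) (hg : PropG g) (hε : 0 < ε)
    {p : ℕ → Param n} {p' : Param n} (hp : Tendsto p atTop (𝓝 p')) (hp' : 0 < p'.2.1) :
    rawL f g H ε p' ≤ liminf (fun k => rawL f g H ε (p k)) atTop := by
  have hm := fun k => measurable_integrandL hH.measurable hf.continuous hg.continuous ε (p k)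
  refine le_trans (lintegral_mono fun x => ?_)
    (lintegral_liminf_le fun k => (hm k).lintegral_prod_right' (ν := volume.restrict (Ioi 0)))
  refine le_trans (setLIntegral_mono' measurableSet_Ioi fun y hy => ?_)
    (lintegral_liminf_le fun k => measurable_section (hm k) x)
  rw [ENNReal.liminf_mul_const_of_ne_top (gExt_ne_top x y)]
  rw [mul_comm (gExt g H ε x y)]
  refine mul_le_mul_left (hH.fExt_le_liminf hf hε
    (tendsto_displacement hp tendsto_const_nhds) ((tendsto_snd_fst hp).mul_const y)
      (mul_pos hp' hy)) _

/-- Integrating `Ψ + Ψ ∘ T` over the small ball costs at most two integrals of `Ψ` over the larger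
one. Thus it suffices to have a lower bound at one of the two points `x` and `T x`. -/
theorem lintegral_pair_le {Ψ : Space n → ℝ≥0∞} (hΨ : Measurable Ψ) {T : Space n → Space n}
    (hT : MeasurePreserving T volume volume)
    (hball : ∀ x ∈ Metric.ball (0 : Space n) (1 / 4), T x ∈ Metric.ball (0 : Space n) (1 / 2))
    {w : ℝ≥0∞} (hw : ∀ x, w ≤ max (Ψ x) (Ψ (T x))) :
    w * volume (Metric.ball (0 : Space n) (1 / 4)) ≤
      2 * ∫⁻ x in Metric.ball (0 : Space n) (1 / 2), Ψ x := by
  set S := Metric.ball (0 : Space n) (1 / 4)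
  set B := Metric.ball (0 : Space n) (1 / 2)
  have hSB : S ⊆ B := Metric.ball_subset_ball (by norm_num)
  have h1 : ∫⁻ x in S, Ψ (T x) ≤ ∫⁻ x in B, Ψ x := by
    rw [← lintegral_indicator measurableSet_ball, ← lintegral_indicator measurableSet_ball,
      ← hT.lintegral_comp (hΨ.indicator measurableSet_ball)]
    refine lintegral_mono fun x => ?_
    by_cases hx : x ∈ S
    · rw [indicator_of_mem hx, indicator_of_mem (hball x hx)]
    · rw [indicator_of_notMem hx]; exact zero_le
  calc w * volume S = ∫⁻ _ in S, w := by rw [setLIntegral_const]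
    _ ≤ ∫⁻ x in S, (Ψ x + Ψ (T x)) :=
      lintegral_mono fun x => (hw x).trans (max_le le_self_add le_add_self)
    _ = (∫⁻ x in S, Ψ x) + ∫⁻ x in S, Ψ (T x) := lintegral_add_left hΨ _
    _ ≤ (∫⁻ x in B, Ψ x) + ∫⁻ x in B, Ψ x := add_le_add (lintegral_mono_set hSB) h1
    _ = _ := (two_mul _).symm

/-- For `‖x‖ < 1/2` and `1/4 < y < 1/2` the point lies inside the unit ball, so the factor of `g` is
at least `g 0`. -/
theorem IsProfile.lintegral_fExt_le_rawL (hH : IsProfile H) (hf : PropF f) (hg : PropG g)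
    (hε : 0 < ε) {p : Param n} (hp : 0 < p.2.1) :
    (∫⁻ x in Metric.ball (0 : Space n) (1 / 2), fExt f H ε (act p.1 x + p.2.2) (p.2.1 * (1 / 4))) *
      (ENNReal.ofReal (g 0) * ENNReal.ofReal (1 / 4)) ≤ rawL f g H ε p := by
  have hfin : ENNReal.ofReal (g 0) * ENNReal.ofReal (1 / 4) ≠ ⊤ :=
    ENNReal.mul_ne_top ENNReal.ofReal_ne_top ENNReal.ofReal_ne_top
  rw [← lintegral_mul_const' _ _ hfin]
  refine le_trans ?_ (setLIntegral_le_lintegral (Metric.ball (0 : Space n) (1 / 2)) _)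
  refine setLIntegral_mono' measurableSet_ball fun x hx => ?_
  have hsub : Ioo (1 / 4 : ℝ) (1 / 2) ⊆ Ioi 0 := fun y hy => lt_trans (by norm_num) hy.1
  refine le_trans ?_ (lintegral_mono_set hsub)
  have hvol : ENNReal.ofReal (1 / 4) = volume (Ioo (1 / 4 : ℝ) (1 / 2)) := by
    rw [Real.volume_Ioo]; norm_num
  rw [hvol, ← mul_assoc, ← setLIntegral_const]
  refine setLIntegral_mono' measurableSet_Ioo fun y hy => ?_
  have hx' : ‖x‖ < 1 / 2 := by simpa using hx
  have hHx : 0 < H x := hH.pos_of_norm_le (by linarith)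
  refine mul_le_mul' (fExt_mono hf hH.nonneg hε _ (by have := hy.1; gcongr)) ?_
  rw [gExt, if_neg hHx.ne']
  refine ENNReal.ofReal_le_ofReal (hg.antitone ?_)
  refine div_nonpos_of_nonpos_of_nonneg (div_nonpos_of_nonpos_of_nonneg ?_ (by positivity)) hε.le
  nlinarith [hy.1, hy.2, norm_nonneg x]

/-- A bound on the functional bounds `α / H (Ax + v)` at one point of some pair; since `H` decays
exponentially, `α exp (c R)` is bounded whenever each pair has a point with `‖Ax + v‖ ≥ R`. The
pairs `x, -x` control `v`, and the pairs `x, x + e_j / 4` control the columns of `A`. -/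
theorem IsProfile.coercive (hH : IsProfile H) (hf : PropF f) (hg : PropG g) (hε : 0 < ε)
    {T : ℝ≥0∞} (hT : T ≠ ⊤) : ∃ K > 0, ∃ c > 0, ∀ p : Param n, 0 < p.2.1 → rawL f g H ε p ≤ T →
      p.2.1 * Real.exp (c * ‖p.2.2‖) ≤ K ∧ ∀ i j, p.2.1 * Real.exp (c * |p.1 i j|) ≤ K := by
  obtain ⟨K, hK, c, hc, hdecay⟩ := hH.decay
  set V := volume (Metric.ball (0 : Space n) (1 / 4)) with hV
  have hV0 : V ≠ 0 := (Metric.measure_ball_pos volume _ (by norm_num)).ne'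
  set G := ENNReal.ofReal (g 0) * ENNReal.ofReal (1 / 4) with hG
  have hG0 : G ≠ 0 := by
    rw [hG, mul_ne_zero_iff, ENNReal.ofReal_ne_zero_iff, ENNReal.ofReal_ne_zero_iff]
    exact ⟨hg.pos_of_lt (by norm_num), by norm_num⟩
  have hGtop : G ≠ ⊤ := ENNReal.mul_ne_top ENNReal.ofReal_ne_top ENNReal.ofReal_ne_top
  have hD : 2 * (T / G) / V ≠ ⊤ :=
    ENNReal.div_ne_top (ENNReal.mul_ne_top (by norm_num) (ENNReal.div_ne_top hT hG0)) hV0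
  obtain ⟨X, hX⟩ := (hf.tendsto_atTop.eventually_gt_atTop (2 * (T / G) / V).toReal).exists_forall_of_atTop
  -- a lower bound `R` for the norm along each pair of points bounds `α * exp (c R)`
  have key : ∀ p : Param n, 0 < p.2.1 → rawL f g H ε p ≤ T → ∀ (τ : Space n → Space n) (R : ℝ),
      MeasurePreserving τ volume volume →
      (∀ x ∈ Metric.ball (0 : Space n) (1 / 4), τ x ∈ Metric.ball (0 : Space n) (1 / 2)) →
      (∀ x, R ≤ max ‖act p.1 x + p.2.2‖ ‖act p.1 (τ x) + p.2.2‖) →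
      p.2.1 * Real.exp (c * R) ≤ 4 * K * (1 + ε * |X|) := by
    intro p hp hpT τ R hτ hτb hR
    set Ψ : Space n → ℝ≥0∞ := fun x => fExt f H ε (act p.1 x + p.2.2) (p.2.1 * (1 / 4)) with hΨ
    have hΨm : Measurable Ψ := (measurable_fExt hH.measurable hf.continuous ε).comp
      (((measurable_act p.1).add_const _).prodMk measurable_const)
    have hΨle : ∀ x, R ≤ ‖act p.1 x + p.2.2‖ → ENNReal.ofReal
        (f ((p.2.1 * (1 / 4) / (K * Real.exp (-(c * R))) - 1) / ε)) ≤ Ψ x := fun x hx =>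
      ofReal_le_fExt hf hH.nonneg hε (by positivity) ((hdecay _).trans (by gcongr))
    have h1 := lintegral_pair_le hΨm hτ hτb
      (w := ENNReal.ofReal (f ((p.2.1 * (1 / 4) / (K * Real.exp (-(c * R))) - 1) / ε)))
      fun x => by
        rcases le_max_iff.1 (hR x) with h | h
        · exact le_max_of_le_left (hΨle x h)
        · exact le_max_of_le_right (hΨle _ h)
    have h2 : ∫⁻ x in Metric.ball (0 : Space n) (1 / 2), Ψ x ≤ T / G := by
      rw [ENNReal.le_div_iff_mul_le (Or.inl hG0) (Or.inl hGtop)]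
      exact (hH.lintegral_fExt_le_rawL hf hg hε hp).trans hpT
    have h3 : ENNReal.ofReal (f ((p.2.1 * (1 / 4) / (K * Real.exp (-(c * R))) - 1) / ε)) ≤
        2 * (T / G) / V := by
      rw [ENNReal.le_div_iff_mul_le (Or.inl hV0) (Or.inl measure_ball_lt_top.ne)]
      exact h1.trans (by gcongr)
    have h4 := (ENNReal.ofReal_le_iff_le_toReal hD).1 h3
    have h5 : (p.2.1 * (1 / 4) / (K * Real.exp (-(c * R))) - 1) / ε < X := by
      by_contra! hcon
      exact absurd (hX _ hcon) (not_lt.2 h4)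
    rw [div_lt_iff₀ hε, sub_lt_iff_lt_add, div_lt_iff₀ (by positivity)] at h5
    have h6 : X * ε ≤ ε * |X| := by
      rw [mul_comm]; exact mul_le_mul_of_nonneg_left (le_abs_self X) hε.le
    have h7 : p.2.1 * (1 / 4) ≤ (1 + ε * |X|) * (K * Real.exp (-(c * R))) :=
      h5.le.trans (mul_le_mul_of_nonneg_right (by linarith) (by positivity))
    have h8 : Real.exp (-(c * R)) * Real.exp (c * R) = 1 := by rw [← Real.exp_add]; simp
    calc p.2.1 * Real.exp (c * R) = 4 * (p.2.1 * (1 / 4)) * Real.exp (c * R) := by ring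
      _ ≤ 4 * ((1 + ε * |X|) * (K * Real.exp (-(c * R)))) * Real.exp (c * R) := by gcongr
      _ = 4 * K * (1 + ε * |X|) * (Real.exp (-(c * R)) * Real.exp (c * R)) := by ring
      _ = _ := by rw [h8, mul_one]
  -- The factor 1/8 combines the shift of length 1/4 with the halving of a difference over its two
  -- endpoints.
  refine ⟨4 * K * (1 + ε * |X|), by positivity, c / 8, by positivity, fun p hp hpT => ⟨?_, ?_⟩⟩
  · have h1 := key p hp hpT (fun x => -x) ‖p.2.2‖ (Measure.measurePreserving_neg volume)
      (fun x hx => by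
        rw [mem_ball_zero_iff] at hx ⊢
        rw [norm_neg]; linarith) fun x => by
        have h2 : (2 : ℝ) • p.2.2 = (act p.1 x + p.2.2) + (act p.1 (-x) + p.2.2) := by
          rw [act_neg_right, two_smul]; abel
        have h3 : 2 * ‖p.2.2‖ ≤ ‖act p.1 x + p.2.2‖ + ‖act p.1 (-x) + p.2.2‖ := by
          have h4 := norm_add_le (act p.1 x + p.2.2) (act p.1 (-x) + p.2.2)
          rwa [← h2, norm_smul, Real.norm_two] at h4
        by_contra! hcon
        rw [max_lt_iff] at hcon
        linarith [hcon.1, hcon.2]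
    refine le_trans ?_ h1
    have := norm_nonneg p.2.2
    gcongr
    linarith
  · intro i j
    set d : Space n := EuclideanSpace.single j (1 / 4) with hd
    have hdn : ‖d‖ = 1 / 4 := by rw [hd, PiLp.norm_single]; norm_num
    have hAd : |p.1 i j| / 4 ≤ ‖act p.1 d‖ := by
      have h1 := PiLp.norm_apply_le (act p.1 d) i
      have h2 : (act p.1 d) i = p.1 i j / 4 := by
        simp [act, hd, div_eq_mul_inv]
      rw [h2, Real.norm_eq_abs, abs_div] at h1
      simpa using h1
    have h1 := key p hp hpT (fun x => x + d) (|p.1 i j| / 8) (measurePreserving_add_right volume d)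
      (fun x hx => by
        rw [mem_ball_zero_iff] at hx ⊢
        have := norm_add_le x d
        linarith) fun x => by
        have h2 : act p.1 d = (act p.1 (x + d) + p.2.2) - (act p.1 x + p.2.2) := by
          rw [act_add_right]; abel
        have h3 := norm_sub_le (act p.1 (x + d) + p.2.2) (act p.1 x + p.2.2)
        rw [← h2] at h3
        by_contra! hcon
        rw [max_lt_iff] at hcon
        linarith [hcon.1, hcon.2]
    refine le_trans (le_of_eq ?_) h1
    congr 2
    ring

end Existence
end FunctionalJohn

namespace FunctionalJohn

variable {n : ℕ} {f g : ℝ → ℝ} {H : Space n → ℝ} {ε s : ℝ}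

/-! ### The direct method on the determinant-one surface. -/

section ExistenceOfMinimizers

theorem log_sDet {p : Param n} (hp : p ∈ EUnit n s) :
    s * Real.log p.2.1 = -Real.log p.1.det := by
  obtain ⟨⟨hpd, hα⟩, hdet⟩ := hp
  have h1 : Real.log (p.2.1 ^ s * p.1.det) = 0 := by
    rw [show p.2.1 ^ s * p.1.det = 1 from hdet, Real.log_one]
  rw [Real.log_mul (Real.rpow_pos_of_pos hα s).ne' hpd.det_pos.ne', Real.log_rpow hα] at h1
  linarith

/-- With `μ` the largest entry in absolute value, `det A ≤ n! μ ^ n`, so `log α = -(log det A) / s`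
is bounded below by a multiple of `-log μ` plus a constant. As `log α + c μ ≤ log K`, the linear
term wins and `μ` is bounded; the other bounds follow. -/
theorem exists_bounds_of_mem_EUnit (hn : 1 ≤ n) (hs : 0 < s) {K c : ℝ} (hc : 0 < c) :
    ∃ R, ∃ a > 0, ∀ p ∈ EUnit n s, p.2.1 * Real.exp (c * ‖p.2.2‖) ≤ K →
      (∀ i j, p.2.1 * Real.exp (c * |p.1 i j|) ≤ K) →
      (∀ i j, |p.1 i j| ≤ R) ∧ a ≤ p.2.1 ∧ p.2.1 ≤ K ∧ ‖p.2.2‖ ≤ R := by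
  have hn0 : (0 : ℝ) < n := by exact_mod_cast hn
  -- Chosen so that `log μ ≤ η μ - 1 - log η` absorbs exactly half of `c μ`.
  set η := c * s / (2 * n) with hη
  have hη0 : 0 < η := by positivity
  set F := Real.log (n.factorial : ℝ) with hF
  set R₁ := 2 / c * (Real.log K + 1 / s * (F + n * (-1 - Real.log η))) with hR₁
  set D := F + n * Real.log R₁ with hD
  refine ⟨max R₁ ((Real.log K + D / s) / c), Real.exp (-D / s), Real.exp_pos _, ?_⟩
  rintro p ⟨⟨hpd, hα⟩, hdet⟩ hv hA
  have hdet0 : 0 < p.1.det := hpd.det_pos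
  have : Nonempty (Fin n × Fin n) := ⟨(⟨0, hn⟩, ⟨0, hn⟩)⟩
  obtain ⟨⟨i₀, j₀⟩, hmax⟩ := Finite.exists_max fun q : Fin n × Fin n => |p.1 q.1 q.2|
  set μ := |p.1 i₀ j₀| with hμ
  have hle : ∀ i j, |p.1 i j| ≤ μ := fun i j => hmax (i, j)
  have hdetle : p.1.det ≤ n.factorial * μ ^ n := by
    have h1 := Matrix.det_le (A := p.1) (abv := AbsoluteValue.abs) (x := μ) hle
    simp only [Fintype.card_fin, nsmul_eq_mul, AbsoluteValue.abs_apply] at h1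
    exact (le_abs_self _).trans h1
  have hμ0 : 0 < μ := by
    rcases (abs_nonneg (p.1 i₀ j₀)).eq_or_lt with h | h
    · rw [← hμ] at h
      rw [← h, zero_pow (by omega), mul_zero] at hdetle
      linarith
    · exact h
  have hlogdet : Real.log p.1.det ≤ F + n * Real.log μ := by
    have h1 := Real.log_le_log hdet0 hdetle
    rwa [Real.log_mul (by positivity) (by positivity), Real.log_pow] at h1
  have hlogα : s * Real.log p.2.1 = -Real.log p.1.det := log_sDet ⟨⟨hpd, hα⟩, hdet⟩
  have hlogα' : Real.log p.2.1 = -Real.log p.1.det / s := by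
    rw [← hlogα]; field_simp
  have hlogK : ∀ t, p.2.1 * Real.exp (c * t) ≤ K → Real.log p.2.1 + c * t ≤ Real.log K := by
    intro t ht
    have h1 := Real.log_le_log (by positivity) ht
    rwa [Real.log_mul hα.ne' (Real.exp_pos _).ne', Real.log_exp] at h1
  have hμR : μ ≤ R₁ := by
    have h1 := hlogK _ (hA i₀ j₀)
    rw [← hμ, hlogα'] at h1
    have h2 := Real.log_le_sub_one_of_pos (mul_pos hη0 hμ0)
    rw [Real.log_mul hη0.ne' hμ0.ne'] at h2
    have h3 : Real.log p.1.det / s ≤ 1 / s * (F + n * (η * μ - 1 - Real.log η)) := by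
      rw [div_eq_inv_mul, one_div]
      refine mul_le_mul_of_nonneg_left (hlogdet.trans ?_) (by positivity)
      have : n * Real.log μ ≤ n * (η * μ - 1 - Real.log η) :=
        mul_le_mul_of_nonneg_left (by linarith) hn0.le
      linarith
    have h4 : 1 / s * (F + n * (η * μ - 1 - Real.log η)) =
        c * μ / 2 + 1 / s * (F + n * (-1 - Real.log η)) := by
      rw [hη]; field_simp; ring
    rw [neg_div] at h1
    have h5 : c * μ / 2 ≤ Real.log K + 1 / s * (F + n * (-1 - Real.log η)) := by linarith
    rw [hR₁, div_mul_eq_mul_div, le_div_iff₀ hc]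
    linarith
  have hlogdet' : Real.log p.1.det ≤ D := by
    refine hlogdet.trans ?_
    rw [hD]
    have := Real.log_le_log hμ0 hμR
    gcongr
  have hlow : -D / s ≤ Real.log p.2.1 := by
    rw [hlogα']; gcongr
  refine ⟨fun i j => (hle i j).trans (hμR.trans (le_max_left _ _)), ?_, ?_, ?_⟩
  · rwa [Real.le_log_iff_exp_le hα] at hlow
  · refine le_trans ?_ hv
    refine le_mul_of_one_le_right hα.le (Real.one_le_exp (by positivity))
  · refine le_trans ?_ (le_max_right _ _)
    rw [le_div_iff₀ hc]
    have h1 := hlogK _ hv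
    rw [neg_div] at hlow
    linarith

/-- Positive definiteness is not a closed condition, but semidefiniteness together with the
determinant equation is, and the latter excludes singular limits. Writing `max α a` makes the real
power continuous on the whole space. -/
theorem isCompact_EUnit_inter (R a K : ℝ) (ha : 0 < a) : IsCompact {p : Param n | p ∈ EUnit n s ∧
    (∀ i j, |p.1 i j| ≤ R) ∧ a ≤ p.2.1 ∧ p.2.1 ≤ K ∧ ‖p.2.2‖ ≤ R} := by
  set box : Set (Param n) :=
    {A : Matrix (Fin n) (Fin n) ℝ | ∀ i, A i ∈ {v : Fin n → ℝ | ∀ j, v j ∈ Icc (-R) R}} ×ˢ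
      (Icc a K ×ˢ Metric.closedBall (0 : Space n) R) with hbox
  have hcomp : IsCompact box :=
    (isCompact_pi_infinite fun _ => isCompact_pi_infinite fun _ => isCompact_Icc).prod
      (isCompact_Icc.prod (isCompact_closedBall _ _))
  set Q : Set (Param n) := {p | p.1.IsHermitian} ∩
    ((⋂ x : Fin n → ℝ, {p | 0 ≤ star x ⬝ᵥ p.1.mulVec x}) ∩
      {p | p.1.det * max p.2.1 a ^ s = 1}) with hQ
  have hQc : IsClosed Q := by
    refine IsClosed.inter ?_ (IsClosed.inter ?_ ?_)
    · exact isClosed_eq (continuous_fst.matrix_conjTranspose) continuous_fst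
    · exact isClosed_iInter fun x => isClosed_le continuous_const
        (Continuous.dotProduct continuous_const (continuous_fst.matrix_mulVec continuous_const))
    · refine isClosed_eq (continuous_fst.matrix_det.mul ?_) continuous_const
      refine Continuous.rpow_const (by fun_prop) fun p => Or.inl ?_
      exact (lt_max_of_lt_right ha).ne'
  convert hcomp.inter_right hQc using 1
  ext p
  constructor
  · rintro ⟨⟨⟨hpd, -⟩, hdet⟩, hA, h1, h2, h3⟩
    refine ⟨⟨fun i j => abs_le.1 (hA i j), ⟨h1, h2⟩, by simpa using h3⟩,
      hpd.isHermitian, mem_iInter.2 hpd.posSemidef.dotProduct_mulVec_nonneg, ?_⟩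
    rw [mem_ofPred_eq]
    rw [max_eq_left h1, mul_comm]
    exact hdet
  · rintro ⟨⟨hA, ⟨h1, h2⟩, h3⟩, h4, h5, h6⟩
    have hα : 0 < p.2.1 := ha.trans_le h1
    rw [mem_ofPred_eq, max_eq_left h1] at h6
    have hpd : p.1.PosDef := ((Matrix.PosSemidef.of_dotProduct_mulVec_nonneg h4
      (mem_iInter.1 h5)).posDef_iff_det_ne_zero).2
      (left_ne_zero_of_mul_eq_one h6)
    refine ⟨⟨⟨hpd, hα⟩, ?_⟩, fun i j => abs_le.2 (hA i j), h1, h2, by simpa using h3⟩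
    rw [sDet, mul_comm]
    exact h6

theorem idParam_mem_EUnit : idParam n ∈ EUnit n s :=
  ⟨⟨Matrix.PosDef.one, one_pos⟩, by simp [sDet, idParam]⟩

theorem IsProfile.exists_isMinOn_rawL (hH : IsProfile H) (hn : 1 ≤ n) (hs : 0 < s) (hf : PropF f)
    (hg : PropG g) (hε : 0 < ε) : ∃ p ∈ EUnit n s, IsMinOn (rawL f g H ε) (EUnit n s) p := by
  obtain ⟨u, hanti, hu, hmem⟩ := exists_seq_tendsto_sInf
    (S := rawL f g H ε '' EUnit n s) ⟨_, mem_image_of_mem _ idParam_mem_EUnit⟩ (OrderBot.bddBelow _)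
  choose p hp hpu using hmem
  -- If the functional is identically `∞` on the surface, any element is a minimizer; coercivity
  -- needs a finite level.
  by_cases htop : sInf (rawL f g H ε '' EUnit n s) = ⊤
  · refine ⟨idParam n, idParam_mem_EUnit, fun q hq => ?_⟩
    have h1 : rawL f g H ε q = ⊤ := top_le_iff.1 (htop ▸ sInf_le (mem_image_of_mem _ hq))
    rw [mem_ofPred_eq, h1]
    exact le_top
  obtain ⟨N, hN⟩ := (hu.eventually_lt_const (lt_top_iff_ne_top.2 htop)).exists
  obtain ⟨K, hK, c, hc, hcoer⟩ := hH.coercive hf hg hε hN.ne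
  obtain ⟨R, a, ha, hbd⟩ := exists_bounds_of_mem_EUnit (n := n) (K := K) hn hs hc
  have hin : ∀ k, p (k + N) ∈ {p : Param n | p ∈ EUnit n s ∧
      (∀ i j, |p.1 i j| ≤ R) ∧ a ≤ p.2.1 ∧ p.2.1 ≤ K ∧ ‖p.2.2‖ ≤ R} := by
    intro k
    have h1 := hcoer (p (k + N)) (hp _).1.2 (by rw [hpu]; exact hanti (by omega))
    exact ⟨hp _, hbd _ (hp _) h1.1 h1.2⟩
  have : FirstCountableTopology (Matrix (Fin n) (Fin n) ℝ) :=
    inferInstanceAs (FirstCountableTopology (Fin n → Fin n → ℝ))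
  obtain ⟨p', hp', φ, hφ, hlim⟩ := (isCompact_EUnit_inter R a K ha).tendsto_subseq hin
  refine ⟨p', hp'.1, fun q hq => ?_⟩
  have h1 := hH.rawL_le_liminf hf hg hε hlim hp'.1.1.2
  have h2 : Tendsto (fun k => rawL f g H ε (((fun k => p (k + N)) ∘ φ) k)) atTop
      (𝓝 (sInf (rawL f g H ε '' EUnit n s))) := by
    have h3 := hu.comp ((tendsto_add_atTop_nat N).comp hφ.tendsto_atTop)
    exact h3.congr fun k => (hpu _).symm
  rw [h2.liminf_eq] at h1
  exact h1.trans (sInf_le (mem_image_of_mem _ hq))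

theorem profileL_eq_rawL (p : Param n) :
    profileL f g H ε p = ENNReal.ofReal (1 / ε) * rawL f g H ε p := rfl

theorem exists_isMinimizerLbar {h : Space n → ℝ} (hn : 1 ≤ n) (hs : 0 < s)
    (hnn : ∀ x, 0 ≤ h x) (hH : IsProfile (fun x => h x ^ (1 / s))) (hf : PropF f) (hg : PropG g)
    {r : ℝ} (hr : r < 1) : ∃ p, IsMinimizerLbar f g h s r p := by
  obtain ⟨p, hp, hmin⟩ := hH.exists_isMinOn_rawL hn hs hf hg (sub_pos.2 hr)
  refine ⟨p, hp, fun q hq => ?_⟩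
  rw [mem_ofPred_eq, Lbar_eq_profileL hs hnn, Lbar_eq_profileL hs hnn, profileL_eq_rawL,
    profileL_eq_rawL]
  exact mul_le_mul_right (hmin hq) _

end ExistenceOfMinimizers
end FunctionalJohn

namespace FunctionalJohn

variable {n : ℕ} {f g : ℝ → ℝ} {H : Space n → ℝ} {ε s : ℝ}

/-! ### Convexity in logarithmic height coordinates. -/

section LogCoordinates

/-- `exp a * y / H x` is jointly log-convex in `(a, x)`, hence convex by the weighted
arithmetic-geometric mean inequality, and composition with the increasing convex `f` preserves this.
The exponential height coordinate is what makes the product of `α` and `1 / H` convex. -/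
theorem IsProfile.fExt_convex (hH : IsProfile H) (hf : PropF f) (hε : 0 < ε) {t u : ℝ} (ht : 0 < t)
    (hu : 0 < u) (htu : t + u = 1) (x z : Space n) (a b : ℝ) {y : ℝ} (hy : 0 < y) :
    fExt f H ε (t • x + u • z) (Real.exp (t * a + u * b) * y) ≤
      ENNReal.ofReal t * fExt f H ε x (Real.exp a * y) +
        ENNReal.ofReal u * fExt f H ε z (Real.exp b * y) := by
  obtain rfl : u = 1 - t := by linarith
  by_cases hx : H x = 0
  · rw [fExt, fExt, if_pos hx, ENNReal.mul_top (by simpa using ht), top_add]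
    exact le_top
  by_cases hz : H z = 0
  · rw [fExt, fExt, fExt, if_pos hz, ENNReal.mul_top (by simpa using hu), add_top]
    exact le_top
  have hx0 : 0 < H x := lt_of_le_of_ne (hH.nonneg x) (Ne.symm hx)
  have hz0 : 0 < H z := lt_of_le_of_ne (hH.nonneg z) (Ne.symm hz)
  have hlc := hH.logConcave x z t ht (by linarith)
  have hpos : 0 < H x ^ t * H z ^ (1 - t) := by positivity
  have hw0 : 0 < H (t • x + (1 - t) • z) := hpos.trans_le hlc
  have h1 : Real.exp (t * a + (1 - t) * b) * y / H (t • x + (1 - t) • z) ≤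
      t * (Real.exp a * y / H x) + (1 - t) * (Real.exp b * y / H z) := by
    refine le_trans ?_ (Real.geom_mean_le_arith_mean2_weighted ht.le hu.le
      (by positivity) (by positivity) (by ring))
    rw [Real.div_rpow (by positivity) hx0.le, Real.div_rpow (by positivity) hz0.le,
      Real.mul_rpow (Real.exp_pos _).le hy.le, Real.mul_rpow (Real.exp_pos _).le hy.le,
      ← Real.exp_mul, ← Real.exp_mul, div_mul_div_comm]
    have h2 : Real.exp (a * t) * y ^ t * (Real.exp (b * (1 - t)) * y ^ (1 - t)) =
        Real.exp (t * a + (1 - t) * b) * y := by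
      rw [mul_mul_mul_comm, ← Real.exp_add, ← Real.rpow_add hy, add_sub_cancel, Real.rpow_one]
      ring_nf
    rw [h2]
    gcongr
  rw [fExt, fExt, fExt, if_neg hx, if_neg hz, if_neg hw0.ne', ← ENNReal.ofReal_mul ht.le,
    ← ENNReal.ofReal_mul hu.le, ← ENNReal.ofReal_add (mul_nonneg ht.le (hf.nonneg _))
      (mul_nonneg hu.le (hf.nonneg _))]
  refine ENNReal.ofReal_le_ofReal ((hf.monotone ?_).trans
    (hf.convex.2 (mem_univ ((Real.exp a * y / H x - 1) / ε))
      (mem_univ ((Real.exp b * y / H z - 1) / ε)) ht.le hu.le htu))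
  rw [smul_eq_mul, smul_eq_mul, mul_div_assoc', mul_div_assoc', ← add_div]
  gcongr
  linarith

/-- The curve `curve ε m` with the height parameter in logarithmic coordinates. -/
noncomputable def expCurve (ε : ℝ) (m : Param n) : Param n :=
  (1 + ε • m.1, Real.exp (ε * m.2.1), ε • m.2.2)

/-- The inverse of `expCurve ε`. -/
noncomputable def logQuotient (ε : ℝ) (p : Param n) : Param n :=
  (ε⁻¹ • (p.1 - 1), Real.log p.2.1 / ε, ε⁻¹ • p.2.2)

theorem expCurve_logQuotient (hε : ε ≠ 0) {p : Param n} (hp : 0 < p.2.1) :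
    expCurve ε (logQuotient ε p) = p := by
  refine Prod.ext ?_ (Prod.ext ?_ ?_)
  · simp [expCurve, logQuotient, smul_smul, hε]
  · simp only [expCurve, logQuotient]
    rw [mul_div_cancel₀ _ hε, Real.exp_log hp]
  · simp [expCurve, logQuotient, smul_smul, hε]

theorem IsProfile.profileL_expCurve_convex (hH : IsProfile H) (hf : PropF f) (hg : PropG g)
    (hε : 0 < ε) {t u : ℝ} (ht : 0 ≤ t) (hu : 0 ≤ u) (htu : t + u = 1) (m q : Param n) :
    profileL f g H ε (expCurve ε (t • m + u • q)) ≤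
      ENNReal.ofReal t * profileL f g H ε (expCurve ε m) +
        ENNReal.ofReal u * profileL f g H ε (expCurve ε q) := by
  rcases ht.eq_or_lt with rfl | ht
  · obtain rfl : u = 1 := by linarith
    simp
  rcases hu.eq_or_lt with rfl | hu
  · obtain rfl : t = 1 := by linarith
    simp
  have hm := fun p => measurable_integrandL hH.measurable hf.continuous hg.continuous ε p
  have hI := fun p => (hm p).lintegral_prod_right' (ν := volume.restrict (Ioi 0))
  simp only [profileL_eq_rawL]
  rw [mul_left_comm, mul_left_comm (ENNReal.ofReal u), ← mul_add]
  refine mul_le_mul_right ?_ _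
  simp only [rawL]
  rw [← lintegral_const_mul _ (hI _), ← lintegral_const_mul _ (hI _),
    ← lintegral_add_left ((hI _).const_mul _)]
  refine lintegral_mono fun x => ?_
  rw [← lintegral_const_mul _ (measurable_section (hm _) x),
    ← lintegral_const_mul _ (measurable_section (hm _) x),
    ← lintegral_add_left ((measurable_section (hm _) x).const_mul _)]
  refine setLIntegral_mono' measurableSet_Ioi fun y hy => ?_
  rw [← mul_assoc, ← mul_assoc, ← add_mul]
  refine mul_le_mul_left ?_ _
  have h1 : act (expCurve ε (t • m + u • q)).1 x + (expCurve ε (t • m + u • q)).2.2 =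
      t • (act (expCurve ε m).1 x + (expCurve ε m).2.2) +
        u • (act (expCurve ε q).1 x + (expCurve ε q).2.2) := by
    obtain rfl : u = 1 - t := by linarith
    simp only [expCurve, act_add_left, act_smul_left, act_one, Prod.fst_add, Prod.snd_add,
      Prod.smul_fst, Prod.smul_snd]
    module
  have h2 : (expCurve ε (t • m + u • q)).2.1 =
      Real.exp (t * (ε * m.2.1) + u * (ε * q.2.1)) := by
    simp only [expCurve, Prod.fst_add, Prod.snd_add, Prod.smul_fst, Prod.smul_snd, smul_eq_mul]
    ring_nf
  rw [h1, h2]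
  exact hH.fExt_convex hf hε ht hu htu _ _ _ _ hy

theorem log_det_le_trace {A : Matrix (Fin n) (Fin n) ℝ} (hA : A.PosDef) :
    Real.log A.det ≤ (A - 1).trace := by
  rw [hA.isHermitian.det_eq_prod_eigenvalues, Matrix.trace_sub,
    hA.isHermitian.trace_eq_sum_eigenvalues, Matrix.trace_one]
  simp only [RCLike.ofReal_real_eq_id, id_eq]
  rw [Real.log_prod fun i _ => (hA.eigenvalues_pos i).ne']
  calc ∑ i, Real.log (hA.isHermitian.eigenvalues i)
      ≤ ∑ i, (hA.isHermitian.eigenvalues i - 1) :=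
        Finset.sum_le_sum fun i _ => Real.log_le_sub_one_of_pos (hA.eigenvalues_pos i)
    _ = _ := by simp

/-- The constraint turns `s * log α` into `-log det A`, and `log det A ≤ tr (A - 1)` leaves a
nonnegative `s`-trace. This one-sided condition survives convex combinations. -/
theorem logQuotient_mem (hε : 0 < ε) {p : Param n} (hp : p ∈ EUnit n s) :
    (logQuotient ε p).1.IsSymm ∧ 0 ≤ sTrace s (logQuotient ε p) := by
  constructor
  · have h1 : p.1.IsSymm := hp.1.1.isHermitian
    exact (h1.sub Matrix.isSymm_one).smul _
  · have h1 := log_sDet hp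
    have h2 := log_det_le_trace hp.1.1
    have h3 : sTrace s (logQuotient ε p) = ε⁻¹ * (s * Real.log p.2.1 + (p.1 - 1).trace) := by
      simp only [sTrace, logQuotient, Matrix.trace_smul, smul_eq_mul]
      ring
    rw [h3]
    exact mul_nonneg (by positivity) (by linarith)

/-- The elements of determinant-one near the identity with first order part `m`, for `m` of
`s`-trace zero. -/
noncomputable def unitCurve (s ε : ℝ) (m : Param n) : Param n :=
  (1 + ε • m.1, (1 + ε • m.1).det ^ (-(1 / s)), ε • m.2.2)

theorem posDef_one_add_smul {M : Matrix (Fin n) (Fin n) ℝ} (hM : M.IsSymm) :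
    ∀ᶠ ε in 𝓝[>] (0 : ℝ), (1 + ε • M).PosDef := by
  set C := ‖(Matrix.toEuclideanCLM (𝕜 := ℝ) M : Space n →L[ℝ] Space n)‖ with hC
  have h1 : Tendsto (fun ε : ℝ => ε * C) (𝓝[>] 0) (𝓝 (0 * C)) :=
    (tendsto_id.mul_const C).mono_left nhdsWithin_le_nhds
  rw [zero_mul] at h1
  filter_upwards [h1.eventually_lt_const one_pos, self_mem_nhdsWithin] with ε hε hε0
  refine Matrix.PosDef.of_dotProduct_mulVec_pos (Matrix.isSymm_one.add (hM.smul ε)) fun x hx => ?_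
  set u : Space n := WithLp.toLp 2 x with hu
  have hu0 : 0 < ‖u‖ ^ 2 := by
    have : u ≠ 0 := by simpa [hu] using hx
    positivity
  have h2 : star x ⬝ᵥ (1 + ε • M).mulVec x = inner ℝ u (act (1 + ε • M) u) := by
    rw [EuclideanSpace.inner_eq_star_dotProduct, dotProduct_comm]
    simp [hu, act]
  rw [h2, act_add_left, act_one, act_smul_left, inner_add_right, inner_smul_right,
    real_inner_self_eq_norm_sq]
  have h3 := (abs_real_inner_le_norm u (act M u)).trans
    (mul_le_mul_of_nonneg_left (norm_act_le M u) (norm_nonneg u))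
  have h4 : -(C * ‖u‖ ^ 2) ≤ inner ℝ u (act M u) := by
    refine le_trans (neg_le_neg ?_) (abs_le.1 h3).1
    rw [hC]; apply le_of_eq; ring
  have h5 := mul_le_mul_of_nonneg_left h4 (mem_Ioi.1 hε0).le
  nlinarith

theorem unitCurve_mem (hs : 0 < s) {m : Param n} (hm : m.1.IsSymm) :
    ∀ᶠ ε in 𝓝[>] (0 : ℝ), unitCurve s ε m ∈ EUnit n s := by
  filter_upwards [posDef_one_add_smul hm] with ε hε
  have hd := hε.det_pos
  refine ⟨⟨hε, Real.rpow_pos_of_pos hd _⟩, ?_⟩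
  simp only [sDet, unitCurve]
  rw [← Real.rpow_mul hd.le, neg_mul, one_div_mul_cancel hs.ne', Real.rpow_neg_one,
    inv_mul_cancel₀ hd.ne']

/-- `det (1 + ε M)` is a polynomial in `ε` with the expansion `1 + ε tr M + ε ^ 2 Q(ε)`. -/
theorem hasDerivAt_log_det (M : Matrix (Fin n) (Fin n) ℝ) :
    HasDerivAt (fun ε : ℝ => Real.log (1 + ε • M).det) M.trace 0 := by
  have h1 : HasDerivAt (fun ε : ℝ => (1 + ε • M).det) M.trace 0 := by
    rw [funext fun ε : ℝ => Matrix.det_one_add_smul ε M]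
    set Q := (Matrix.det (1 + (Polynomial.X : Polynomial ℝ) • M.map Polynomial.C)).divX.divX
    have h2 : HasDerivAt (fun ε : ℝ => 1 + M.trace * ε + Q.eval ε * ε ^ 2) (M.trace * 1 +
        (Q.derivative.eval 0 * 0 ^ 2 + Q.eval 0 * ((2 : ℕ) * 0 ^ (2 - 1)))) 0 :=
      (((hasDerivAt_id (0 : ℝ)).const_mul M.trace).const_add 1).add
        ((Q.hasDerivAt 0).mul (hasDerivAt_pow 2 0))
    simpa using h2
  simpa using h1.log (by simp)

theorem tendsto_logQuotient_unitCurve (hs : 0 < s) {m : Param n} (hm : m ∈ TraceZero n s) :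
    Tendsto (fun ε => logQuotient ε (unitCurve s ε m)) (𝓝[>] 0) (𝓝 m) := by
  have h1 : Tendsto (fun ε : ℝ => -(1 / s) * (ε⁻¹ * Real.log (1 + ε • m.1).det)) (𝓝[>] 0)
      (𝓝 (-(1 / s) * m.1.trace)) := by
    have h2 := (hasDerivAt_log_det m.1).tendsto_slope_zero_right
    simp only [zero_add, smul_eq_mul, zero_smul, add_zero, Matrix.det_one, Real.log_one,
      sub_zero] at h2
    exact h2.const_mul _
  have h3 : -(1 / s) * m.1.trace = m.2.1 := by
    have : s * m.2.1 + m.1.trace = 0 := hm.2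
    field_simp
    linarith
  rw [h3] at h1
  have h4 : Tendsto (fun ε : ℝ => ((m.1, -(1 / s) * (ε⁻¹ * Real.log (1 + ε • m.1).det), m.2.2) :
      Param n)) (𝓝[>] 0) (𝓝 (m.1, m.2.1, m.2.2)) :=
    tendsto_const_nhds.prodMk_nhds (h1.prodMk_nhds tendsto_const_nhds)
  refine h4.congr' ?_
  filter_upwards [posDef_one_add_smul hm.1, self_mem_nhdsWithin] with ε hε hε0
  have hε' : ε ≠ 0 := (mem_Ioi.1 hε0).ne'
  refine Prod.ext ?_ (Prod.ext ?_ ?_)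
  · simp [logQuotient, unitCurve, smul_smul, hε']
  · simp only [logQuotient, unitCurve]
    rw [Real.log_rpow hε.det_pos]
    ring
  · simp [logQuotient, unitCurve, smul_smul, hε']

variable {ι : Type*} {l : Filter ι} {η : ι → ℝ} {m : ι → Param n} {m' : Param n}

/-- The first order part of `expCurve ε m`. -/
noncomputable def expSlope (ε : ℝ) (m : Param n) : Param n :=
  (m.1, ε⁻¹ * (Real.exp (ε * m.2.1) - 1), m.2.2)

theorem curve_expSlope (hε : ε ≠ 0) (m : Param n) : curve ε (expSlope ε m) = expCurve ε m := by
  refine Prod.ext rfl (Prod.ext ?_ ?_)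
  · rw [curve_snd_fst]
    simp only [expSlope, expCurve]
    rw [mul_inv_cancel_left₀ hε]
    ring
  · rw [curve_snd_snd]
    rfl

theorem tendsto_expSlope (hη : Tendsto η l (𝓝[>] 0)) (hm : Tendsto m l (𝓝 m')) :
    Tendsto (fun i => expSlope (η i) (m i)) l (𝓝 m') := by
  have h1 : Tendsto (fun i => (m i).1) l (𝓝 m'.1) := (continuous_fst.tendsto m').comp hm
  have h2 : Tendsto (fun i => (m i).2.2) l (𝓝 m'.2.2) :=
    ((continuous_snd.comp continuous_snd).tendsto m').comp hm
  have h3 := tendsto_difference_quotient (Real.hasDerivAt_exp 0).hasFDerivAt hη (tendsto_snd_fst hm)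
  simp only [zero_add, smul_eq_mul, Real.exp_zero] at h3
  refine h1.prodMk_nhds (Tendsto.prodMk_nhds ?_ h2)
  simpa using h3

theorem tendsto_profileL_expCurve [l.IsCountablyGenerated] (hH : IsProfile H) (hf : PropF f)
    (hg : PropG g) (hη : Tendsto η l (𝓝[>] 0)) (hm : Tendsto m l (𝓝 m')) :
    Tendsto (fun i => profileL f g H (η i) (expCurve (η i) (m i))) l
      (𝓝 (ENNReal.ofReal (profileI f g H m'))) := by
  rw [← lintegral_eq_profileI hH hf hg]
  refine (tendsto_profileL hH hf hg hη (tendsto_expSlope hη hm)).congr' ?_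
  filter_upwards [hη self_mem_nhdsWithin] with i hi
  rw [curve_expSlope (mem_Ioi.1 hi).ne']

end LogCoordinates

/-! ### Convergence of the difference quotients of minimizers. -/

section Convergence

/-- A family converges to the limit of another one if the only limit of points on the segments
joining the two is that limit. -/
theorem tendsto_of_segment {E ι : Type*} [NormedAddCommGroup E] [NormedSpace ℝ E] [ProperSpace E]
    {l : Filter ι} [l.IsCountablyGenerated] {b q : ι → E} {c : E} (hb : Tendsto b l (𝓝 c))
    (hseg : ∀ (u : ℕ → ι) (z : ℕ → E) (z' : E), Tendsto u atTop l →
      (∀ k, z k ∈ segment ℝ (b (u k)) (q (u k))) → Tendsto z atTop (𝓝 z') → z' = c) :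
    Tendsto q l (𝓝 c) := by
  by_contra hcon
  rw [Metric.tendsto_nhds] at hcon
  push Not at hcon
  obtain ⟨δ, hδ, hfreq⟩ := hcon
  have hev : ∀ᶠ i in l, dist (b i) c < δ / 2 := Metric.tendsto_nhds.1 hb _ (by positivity)
  obtain ⟨u, hu, huk⟩ := exists_seq_forall_of_frequently (hfreq.and_eventually hev)
  have hlow : ∀ k, δ / 2 ≤ ‖q (u k) - b (u k)‖ := by
    intro k
    obtain ⟨h1, h2⟩ := huk k
    have h3 := dist_triangle (q (u k)) (b (u k)) c
    rw [dist_eq_norm (q (u k)) (b (u k))] at h3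
    linarith
  -- If `q` stays away from `c`, the point of the segment at distance exactly `δ / 2` from `b` stays
  -- in a compact ball even when `q` is unbounded. A limit of such points lies at distance `δ / 2`
  -- from `c`.
  set z : ℕ → E := fun k =>
    b (u k) + ((δ / 2) / ‖q (u k) - b (u k)‖) • (q (u k) - b (u k)) with hz
  have hzb : ∀ k, ‖z k - b (u k)‖ = δ / 2 := by
    intro k
    have h0 : 0 < ‖q (u k) - b (u k)‖ := lt_of_lt_of_le (by positivity) (hlow k)
    rw [hz]
    simp only [add_sub_cancel_left, norm_smul]
    rw [Real.norm_of_nonneg (by positivity), div_mul_cancel₀ _ h0.ne']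
  have hzmem : ∀ k, z k ∈ Metric.closedBall c δ := by
    intro k
    rw [Metric.mem_closedBall]
    have h1 := dist_triangle (z k) (b (u k)) c
    rw [dist_eq_norm (z k) (b (u k)), hzb] at h1
    linarith [(huk k).2]
  obtain ⟨z', -, φ, hφ, hlim⟩ := (isCompact_closedBall c δ).tendsto_subseq hzmem
  have hbφ : Tendsto (fun k => b (u (φ k))) atTop (𝓝 c) :=
    hb.comp (hu.comp hφ.tendsto_atTop)
  have h1 : ‖z' - c‖ = δ / 2 := by
    refine tendsto_nhds_unique (hlim.sub hbφ).norm ?_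
    refine tendsto_const_nhds.congr fun k => ?_
    exact (hzb _).symm
  have h2 : z' = c := by
    refine hseg (u ∘ φ) (z ∘ φ) z' (hu.comp hφ.tendsto_atTop) (fun k => ?_) hlim
    have h0 : 0 < ‖q (u (φ k)) - b (u (φ k))‖ := lt_of_lt_of_le (by positivity) (hlow _)
    rw [segment_eq_image']
    exact ⟨_, ⟨by positivity, (div_le_one h0).2 (hlow _)⟩, rfl⟩
  rw [h2, sub_self, norm_zero] at h1
  linarith

variable {m₀ : Param n} {h : Space n → ℝ}

theorem sTrace_convex {m q : Param n} {t u : ℝ} (ht : 0 ≤ t) (hu : 0 ≤ u) (hm : 0 ≤ sTrace s m)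
    (hq : 0 ≤ sTrace s q) : 0 ≤ sTrace s (t • m + u • q) := by
  have h1 : sTrace s (t • m + u • q) = t * sTrace s m + u * sTrace s q := by
    simp only [sTrace, Prod.fst_add, Prod.snd_add, Prod.smul_fst, Prod.smul_snd, smul_eq_mul,
      Matrix.trace_add, Matrix.trace_smul]
    ring
  rw [h1]
  positivity

theorem continuous_sTrace (s : ℝ) : Continuous fun m : Param n => sTrace s m :=
  (continuous_const.mul (continuous_fst.comp continuous_snd)).add continuous_fst.matrix_trace

/-- The determinant-one competitors built from `m₀` have quotients tending to `m₀`. By convexity and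
minimality the functional on the segments towards the quotients of the minimizers is at most its
value at the competitor, so in the limit `Ī₁` is at most `Ī₁(m₀)`, and `eq_of_le` identifies every
limit point. -/
theorem IsStrictMinimizer.tendsto_logQuotient (hm₀ : IsStrictMinimizer f g H s m₀) (hn : 1 ≤ n)
    (hs : 0 < s) (hH : IsProfile H) (hf : PropF f) (hg : PropG g) {p : ℝ → Param n}
    (hp : ∀ᶠ ε in 𝓝[>] (0 : ℝ), p ε ∈ EUnit n s ∧ IsMinOn (profileL f g H ε) (EUnit n s) (p ε)) :
    Tendsto (fun ε => logQuotient ε (p ε)) (𝓝[>] 0) (𝓝 m₀) := by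
  -- An auxiliary norm inducing the given topology; convergence does not depend on it.
  let _ : NormedAddCommGroup (Matrix (Fin n) (Fin n) ℝ) := Matrix.normedAddCommGroup
  let _ : NormedSpace ℝ (Matrix (Fin n) (Fin n) ℝ) := Matrix.normedSpace
  have hbase := tendsto_logQuotient_unitCurve hs hm₀.1
  refine tendsto_of_segment hbase fun u z z' hu hz hlim => ?_
  have hev : ∀ᶠ k in atTop, (z k).1.IsSymm ∧ 0 ≤ sTrace s (z k) ∧
      profileL f g H (u k) (expCurve (u k) (z k)) ≤
        profileL f g H (u k) (expCurve (u k) (logQuotient (u k) (unitCurve s (u k) m₀))) := by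
    filter_upwards [hu.eventually hp, hu.eventually (unitCurve_mem hs hm₀.1.1),
      hu.eventually self_mem_nhdsWithin] with k hpk hbk huk
    obtain ⟨a, c, ha, hc, hac, hzk⟩ := hz k
    have huk' : 0 < u k := huk
    obtain ⟨hb1, hb2⟩ := logQuotient_mem huk' hbk
    obtain ⟨hq1, hq2⟩ := logQuotient_mem huk' hpk.1
    rw [← hzk]
    refine ⟨(hb1.smul a).add (hq1.smul c), sTrace_convex ha hc hb2 hq2, ?_⟩
    refine (hH.profileL_expCurve_convex hf hg huk' ha hc hac _ _).trans ?_
    rw [expCurve_logQuotient huk'.ne' hpk.1.1.2]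
    set D := profileL f g H (u k) (expCurve (u k) (logQuotient (u k) (unitCurve s (u k) m₀)))
    have hle : profileL f g H (u k) (p (u k)) ≤ D := by
      have h1 := hpk.2 hbk
      rwa [mem_ofPred_eq, ← expCurve_logQuotient huk'.ne' hbk.1.2] at h1
    calc ENNReal.ofReal a * D + ENNReal.ofReal c * profileL f g H (u k) (p (u k))
        ≤ ENNReal.ofReal a * D + ENNReal.ofReal c * D := by gcongr
      _ = D := by rw [← add_mul, ← ENNReal.ofReal_add ha hc, hac, ENNReal.ofReal_one, one_mul]
  refine hm₀.eq_of_le hn hs hH hf hg ?_ ?_ ?_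
  · have h1 : IsClosed {m : Param n | m.1.IsSymm} :=
      isClosed_eq (continuous_fst.matrix_transpose) continuous_fst
    exact h1.mem_of_tendsto hlim (hev.mono fun k hk => hk.1)
  · exact ge_of_tendsto (((continuous_sTrace s).tendsto z').comp hlim) (hev.mono fun k hk => hk.2.1)
  · have h1 := le_of_tendsto_of_tendsto (tendsto_profileL_expCurve hH hf hg hu hlim)
      (tendsto_profileL_expCurve hH hf hg hu (hbase.comp hu)) (hev.mono fun k hk => hk.2.2)
    rwa [ENNReal.ofReal_le_ofReal_iff (profileI_nonneg hH hf hg m₀)] at h1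

/-- The logarithmic and the ordinary quotient of the height parameter have the same limit, because
`(exp (ε b) - 1) / ε` tends to `b'` when `b` tends to `b'`. -/
theorem IsStrictMinimizer.tendsto_quotient {p : ℝ → Param n}
    (hm₀ : IsStrictMinimizer f g (fun x => h x ^ (1 / s)) s m₀) (hn : 1 ≤ n) (hs : 0 < s)
    (hnn : ∀ x, 0 ≤ h x) (hH : IsProfile fun x => h x ^ (1 / s)) (hf : PropF f) (hg : PropG g)
    (hp : ∀ r ∈ Ioo (1 / 2 : ℝ) 1, IsMinimizerLbar f g h s r (p r)) :
    Tendsto (quotient p) (𝓝[<] 1) (𝓝 m₀) := by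
  have hmin : ∀ᶠ ε in 𝓝[>] (0 : ℝ), p (1 - ε) ∈ EUnit n s ∧
      IsMinOn (profileL f g (fun x => h x ^ (1 / s)) ε) (EUnit n s) (p (1 - ε)) := by
    filter_upwards [Ioo_mem_nhdsGT (show (0 : ℝ) < 1 / 2 by norm_num)] with ε hε
    obtain ⟨h1, h2⟩ := hp (1 - ε) ⟨by linarith [hε.2], by linarith [hε.1]⟩
    refine ⟨h1, fun q hq => ?_⟩
    have h3 := h2 hq
    rwa [mem_ofPred_eq, Lbar_eq_profileL hs hnn, Lbar_eq_profileL hs hnn, sub_sub_cancel] at h3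
  have h1 := hm₀.tendsto_logQuotient hn hs hH hf hg hmin
  refine (tendsto_expSlope tendsto_one_sub (h1.comp tendsto_one_sub)).congr' ?_
  filter_upwards [tendsto_one_sub.eventually hmin, self_mem_nhdsWithin] with r hr hr1
  have hr0 : (1 - r) ≠ 0 := (sub_pos.2 (mem_Iio.1 hr1)).ne'
  have h2 := hr.1.1.2
  have h3 : curve (1 - r) (expSlope (1 - r) (logQuotient (1 - r) (p r))) = p r := by
    rw [curve_expSlope hr0]
    rw [sub_sub_cancel] at h2
    exact expCurve_logQuotient hr0 h2
  simp only [Function.comp_apply, sub_sub_cancel]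
  rw [quotient, ← h3, curve, add_sub_cancel_left, inv_smul_smul₀ hr0]
  rw [← curve, h3]

end Convergence
end FunctionalJohn

theorem theorem1p6 (n : ℕ) (hn : 1 ≤ n) (s : ℝ) (hs : 0 < s)
    (h : Space n → ℝ) (hh : ProperLogConcave h)
    (hpos : Metric.closedBall (0 : Space n) 1 ⊆ interior {x | 0 < h x})
    (hJohn : IsJohnEllipsoid h s (idParam n))
    (f g : ℝ → ℝ) (hf : PropF f) (hg : PropG g)
    (m₀ : Param n) (hm₀ : IsUniqueMinimizerIone f g h s m₀) :
    -- minimizers of the functional exist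
    (∀ r ∈ Ioo (1 / 2 : ℝ) 1, ∃ p, IsMinimizerLbar f g h s r p) ∧
    -- every family of minimizers, extended by the identity at 1, has left derivative -m₀ there
    (∀ p : ℝ → Param n, p 1 = idParam n →
      (∀ r ∈ Ioo (1 / 2 : ℝ) 1, IsMinimizerLbar f g h s r (p r)) →
      HasDerivWithinAt p (-m₀) (Iic 1) 1) ∧
    -- the limit measure is centered and isotropic
    IsCentered (limitMeasure f g h s m₀) ∧
    IsSIsotropic s (limitMeasure f g h s m₀) ∧
    -- weak convergence along every curve with the given first order expansion
    (∀ p : ℝ → Param n, (∀ᶠ r in 𝓝[<] (1 : ℝ), p r ∈ EPos n) → HasExpansion p m₀ →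
      ConvergesWeakly (fun r => muMeasure f g h s r (p r)) (limitMeasure f g h s m₀)) ∧
    -- in particular along the minimizers
    (∀ p : ℝ → Param n, (∀ r ∈ Ioo (1 / 2 : ℝ) 1, IsMinimizerLbar f g h s r (p r)) →
      ConvergesWeakly (fun r => muMeasure f g h s r (p r)) (limitMeasure f g h s m₀)) ∧
    -- and along their linear part
    ConvergesWeakly (fun r => muMeasure f g h s r (idParam n + (1 - r) • m₀))
      (limitMeasure f g h s m₀) := by
  have hH := hh.isProfile hs hpos hJohn.2.1
  have hnn := hh.nonneg
  have hm := hm₀.isStrictMinimizer hH hnn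
  refine ⟨fun r hr => exists_isMinimizerLbar hn hs hnn hH hf hg hr.2,
    fun p h1 hp => hasDerivWithinAt_of_tendsto_quotient h1
      (hm.tendsto_quotient hn hs hnn hH hf hg hp), ?_, ?_,
    fun p _ hp => convergesWeakly_of_tendsto hs hH hnn hf hg hp.tendsto_quotient,
    fun p hp => convergesWeakly_of_tendsto hs hH hnn hf hg
      (hm.tendsto_quotient hn hs hnn hH hf hg hp),
    convergesWeakly_of_tendsto hs hH hnn hf hg (tendsto_quotient_linear m₀)⟩
  · rw [limitMeasure_eq hH hnn]
    exact hm.isCentered hH hf hg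
  · rw [limitMeasure_eq hH hnn]
    exact hm.isSIsotropic hn hs hH hf hg
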